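/- Let $R$ be a real closed field with algebraic closure $C=R[i]$; give $R^m$ the Euclidean (order) topology. A semi-algebraic set is called semi-algebraically connected if it is not the disjoint union of two non-empty relatively closed semi-algebraic subsets. For a morphism $T\to Y$ of schemes and $y\in Y$, write $T_{\overline y}=T\times_Y\operatorname{Spec}\overline{\kappa(y)}$ for the geometric fiber and $\#T_{\overline y}$ for its number of points. A morphism $\operatorname{Spec}E\to\operatorname{Spec}A$ is called free if $E$ is a free $A$-module. **Setting.** 1. $X=\operatorname{Spec}B$ and $Y=\operatorname{Spec}A$ are affine $R$-schemes of finite type, $Y$ is integral, and $\pi:X\to Y$ is a dominant, generically finite $R$-morphism. There are closed immersions over $R$, $i_X:X\hookrightarrow\mathbb A^{n+1}_R$ and $i_Y:Y\hookrightarrow\mathbb A^n_R$, such that $i_Y\circ\pi=\mathrm{pr}\circ i_X$, where $\mathrm{pr}:\mathbb A^{n+1}_R\to\mathbb A^n_R$ is the projection onto the first $n$ coordinates. 2. $W=D(w)\subseteq Y$ is a distinguished open such that $X_W=X\times_YW\to W$ is finite and free. 3. $Z$ is a closed subscheme of $X_W$, $h'\in\Gamma(Z,\mathcal O_Z)$,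 $U=Z_{h'}$ is the distinguished open $D(h')$ of $Z$, and $V$ is the scheme-theoretic image of $U$ in $W$; we assume that $V$ is integral. 4. $v\in\Gamma(V,\mathcal O_V)$ is such that $U_v=U\times_VV_v\to V_v$ is free, where $V_v=D(v)\subseteq V$. 5. $h\in\Gamma(X,\mathcal O_X)$, $D(h)$ is the corresponding distinguished open of $X$, and $U_h$ is the distinguished open of $U$ cut out by $h$. Rational points are identified with points of $R^n$ and $R^{n+1}$ through $i_Y$ and $i_X$. Write $\pi_0:U_h(R)\to V(R)$ for the map induced by $\pi$ on rational points. **Definition.** Let $T=V(f_1,\dots,f_s)\cap D(g)\subseteq\mathbb A^{n+1}_R$ with $f_1,\dots,f_s,g\in R[x_1,\dots,x_{n+1}]$, and let $S\subseteq R^n$ be a semi-algebraically connected semi-algebraic set. Then $T$ is *geometrically delineable* over $S$ if * (i) for $a\in S$ the number of $c\in C$ with $f_1(a,c)=\dots=f_s(a,c)=0$ and $g(a,c)\neq0$ is finite and does not depend on $a$; * (ii) there are $k\ge 0$ and continuous semi-algebraic maps $\xi_1,\dots,\xi_k:S\to T(R)$ with $\mathrm{pr}\circ\xi_i=\mathrm{id}_S$,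 in strictly ascending order in the last coordinate; * (iii) for each $t\in T(R)\cap(S\times R)$ there is a unique $i$ with $t=\xi_i(\mathrm{pr}(t))$. **Theorem.** In the setting above, let $S\subseteq V_v(R)$ be a semi-algebraically connected semi-algebraic set such that $\#(D(h))_{\overline y}$ is the same for all $y\in S$. Then: * $\#(U_h)_{\overline y}$ is the same for all $y\in S$; * the number $\#\pi_0^{-1}(y)$ of real points of $U_h$ above $y$ is the same for all $y\in S$; * there are finitely many continuous semi-algebraic sections $\xi_i:S\to U_h(R)$ of $\pi_0$ whose images cover $\pi_0^{-1}(S)$; * $U_h$, as a basic constructible subset of $\mathbb A^{n+1}_R$, is geometrically delineable over $S$. -/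

import Mathlib

open scoped TensorProduct

namespace GeomCAD

noncomputable section

/-! ### Semi-algebraic geometry over a real closed field

`R ^ n` is `Fin n → R`. If `R` carries its order topology, the product topology on `Fin n → R` is
the Euclidean topology (the one generated by the open Euclidean balls). -/

section Semialgebraic

/-- Basic semi-algebraic sets `{x | f x = 0 for f ∈ F, g x > 0 for g ∈ G}`, with `F`, `G` finite. -/
def IsBasicSemialgebraic {R : Type*} [Field R] [LinearOrder R] {ι : Type*}
    (s : Set (ι → R)) : Prop :=
  ∃ F G : Finset (MvPolynomial ι R),
    s = {x | (∀ f ∈ F, MvPolynomial.eval x f = 0) ∧ ∀ g ∈ G, 0 < MvPolynomial.eval x g}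

/-- Semi-algebraic sets: finite unions of basic semi-algebraic sets. -/
def IsSemialgebraic {R : Type*} [Field R] [LinearOrder R] {ι : Type*}
    (s : Set (ι → R)) : Prop :=
  ∃ 𝒯 : Set (Set (ι → R)), 𝒯.Finite ∧ (∀ t ∈ 𝒯, IsBasicSemialgebraic t) ∧ s = ⋃₀ 𝒯

/-- `s` is not the disjoint union of two nonempty semi-algebraic subsets that are closed in `s`. -/
def IsSemialgebraicallyConnected {R : Type*} [Field R] [LinearOrder R] [TopologicalSpace R]
    {ι : Type*} (s : Set (ι → R)) : Prop :=
  ¬ ∃ t₁ t₂ : Set (ι → R), IsSemialgebraic t₁ ∧ IsSemialgebraic t₂ ∧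
      (∃ Z₁, IsClosed Z₁ ∧ t₁ = Z₁ ∩ s) ∧ (∃ Z₂, IsClosed Z₂ ∧ t₂ = Z₂ ∩ s) ∧
      t₁.Nonempty ∧ t₂.Nonempty ∧ Disjoint t₁ t₂ ∧ t₁ ∪ t₂ = s

/-- The graph of `f` restricted to `s`, in the affine space with coordinates `ι ⊕ κ`, is
semi-algebraic. -/
def IsSemialgebraicOn {R : Type*} [Field R] [LinearOrder R] {ι κ : Type*}
    (f : (ι → R) → κ → R) (s : Set (ι → R)) : Prop :=
  IsSemialgebraic {z : ι ⊕ κ → R | z ∘ Sum.inl ∈ s ∧ z ∘ Sum.inr = f (z ∘ Sum.inl)}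

end Semialgebraic

/-! ### Geometric delineability -/

section Delineability

variable {R : Type*} [Field R] [LinearOrder R] [TopologicalSpace R] {n : ℕ}

/-- The `R`-rational points of `V(F) ∩ D(g)`, as points of `R ^ (n + 1)`. -/
def realLocus (F : Finset (MvPolynomial (Fin (n + 1)) R)) (g : MvPolynomial (Fin (n + 1)) R) :
    Set (Fin (n + 1) → R) :=
  {t | (∀ f ∈ F, MvPolynomial.eval t f = 0) ∧ MvPolynomial.eval t g ≠ 0}

/-- The solutions `c`, in the algebraic closure of `R`, of the system
`f (a, c) = 0` for `f ∈ F`, `g (a, c) ≠ 0`. -/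
def complexSolutions (F : Finset (MvPolynomial (Fin (n + 1)) R))
    (g : MvPolynomial (Fin (n + 1)) R) (a : Fin n → R) : Set (AlgebraicClosure R) :=
  {c | (∀ f ∈ F, MvPolynomial.aeval (Fin.snoc (α := fun _ => AlgebraicClosure R)
          (fun j => algebraMap R (AlgebraicClosure R) (a j)) c) f = 0) ∧
       MvPolynomial.aeval (Fin.snoc (α := fun _ => AlgebraicClosure R)
          (fun j => algebraMap R (AlgebraicClosure R) (a j)) c) g ≠ 0}

/-- The three conditions of geometric delineability of `V(F) ∩ D(g)` over `S`. -/
structure IsDelineableSystem (F : Finset (MvPolynomial (Fin (n + 1)) R))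
    (g : MvPolynomial (Fin (n + 1)) R) (S : Set (Fin n → R)) : Prop where
  /-- The number of distinct solutions in the algebraic closure is finite and invariant. -/
  card_invariant : ∃ m : ℕ, ∀ a ∈ S, (complexSolutions F g a).encard = m
  /-- There are continuous semi-algebraic sections, strictly ascending in the last coordinate,
  such that every real point over `S` lies on exactly one of them. -/
  exists_sections : ∃ (k : ℕ) (ξ : Fin k → (Fin n → R) → Fin (n + 1) → R),
    (∀ i, ContinuousOn (ξ i) S ∧ IsSemialgebraicOn (ξ i) S) ∧
    (∀ i, ∀ a ∈ S, ξ i a ∈ realLocus F g ∧ Fin.init (ξ i a) = a) ∧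
    (∀ i j, i < j → ∀ a ∈ S, ξ i a (Fin.last n) < ξ j a (Fin.last n)) ∧
    (∀ t ∈ realLocus F g, Fin.init t ∈ S → ∃! i, t = ξ i (Fin.init t))

/-- A set `T` in affine `(n + 1)`-space over `R` is a basic constructible set `V(F) ∩ D(g)` that
is geometrically delineable over `S ⊆ R ^ n`. -/
def IsGeometricallyDelineable (T : Set (PrimeSpectrum (MvPolynomial (Fin (n + 1)) R)))
    (S : Set (Fin n → R)) : Prop :=
  ∃ (F : Finset (MvPolynomial (Fin (n + 1)) R)) (g : MvPolynomial (Fin (n + 1)) R),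
    T = PrimeSpectrum.zeroLocus (F : Set (MvPolynomial (Fin (n + 1)) R)) ∩
      (PrimeSpectrum.basicOpen g : Set (PrimeSpectrum (MvPolynomial (Fin (n + 1)) R))) ∧
    IsDelineableSystem F g S

end Delineability

/-! ### Affine schemes

An affine scheme is given by its coordinate ring, a morphism `Spec E ⟶ Spec A` by the ring
homomorphism `A →+* E`, a closed subscheme of `Spec A` by a quotient of `A`, and a distinguished
open `D(h)` of `Spec A` by `Localization.Away h`. -/

section Schemes

/-- `Spec E ⟶ Spec A` is free: `E` is a free `A`-module. -/
def IsFreeHom {A E : Type*} [CommRing A] [CommRing E] (f : A →+* E) : Prop :=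
  letI := f.toAlgebra
  Module.Free A E

/-- The underlying set of the geometric fiber `Spec E ×_{Spec A} Spec κ̄`, with `κ̄` the algebraic
closure of the residue field of `p`. -/
def GeometricFiber {A E : Type*} [CommRing A] [CommRing E] (f : A →+* E)
    (p : PrimeSpectrum A) : Type _ :=
  letI := f.toAlgebra
  PrimeSpectrum (E ⊗[A] AlgebraicClosure p.asIdeal.ResidueField)

/-- The point of `Spec E` underlying an `R`-rational point. -/
def ratPoint {R E : Type*} [Field R] [CommRing E] [Algebra R E] (y : E →ₐ[R] R) :
    PrimeSpectrum E :=
  ⟨RingHom.ker (y : E →+* R), RingHom.ker_isPrime _⟩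

/-- The coordinates of an `R`-rational point of an affine `R`-scheme mapping to affine `m`-space. -/
def coords {R E : Type*} [Field R] [CommRing E] [Algebra R E] {m : ℕ}
    (i : MvPolynomial (Fin m) R →+* E) (y : E →ₐ[R] R) : Fin m → R :=
  fun j => y (i (MvPolynomial.X j))

/-- `π : Spec B ⟶ Spec A` is a projection of relative dimension 1, via the closed immersions `iX`
of `Spec B` in affine `(n + 1)`-space and `iY` of `Spec A` in affine `n`-space; the projection
`(x₁, …, xₙ₊₁) ↦ (x₁, …, xₙ)` corresponds to the inclusion of polynomial rings. -/
structure IsProjectionOfRelDimOne {R A B : Type*} [Field R] [CommRing A] [CommRing B]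
    [Algebra R A] [Algebra R B] {n : ℕ} (π : A →ₐ[R] B)
    (iX : MvPolynomial (Fin (n + 1)) R →ₐ[R] B) (iY : MvPolynomial (Fin n) R →ₐ[R] A) :
    Prop where
  dominant : DenseRange (PrimeSpectrum.comap (π : A →+* B))
  closedImmersion_X : Function.Surjective iX
  closedImmersion_Y : Function.Surjective iY
  comm : iX.comp (MvPolynomial.rename Fin.castSucc) = π.comp iY

/-- The fiber of `Spec B ⟶ Spec A` over the generic point of the integral scheme `Spec A` is
finite. -/
def IsGenericallyFinite {A B : Type*} [CommRing A] [IsDomain A] [CommRing B] (π : A →+* B) : Prop :=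
  {q : PrimeSpectrum B | PrimeSpectrum.comap π q = ⊥}.Finite

end Schemes

/-! ### The two-layer setting

Throughout `X = Spec B`, `Y = Spec A`, `π : X ⟶ Y`. The first layer is `W = D(w) ⊆ Y`, with
`X_W = X ×_Y W`. The second one is `Z ⊆ X_W` closed with ideal `J`, `U = D(h') ⊆ Z`, the
scheme-theoretic image `V` of `U` in `W`, and `V_v = D(v) ⊆ V`, `U_v = U ×_V V_v`. -/

section TwoLayer

variable {A B : Type*} [CommRing A] [CommRing B]

/-- The coordinate ring of `W = D(w)`. -/
abbrev RingW (w : A) : Type _ := Localization.Away w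

/-- The coordinate ring of `X_W`. -/
abbrev RingXW (π : A →+* B) (w : A) : Type _ := Localization.Away (π w)

/-- `X_W ⟶ W`. -/
def mapXW (π : A →+* B) (w : A) : RingW w →+* RingXW π w := Localization.awayMap π w

variable {π : A →+* B} {w : A}

/-- The coordinate ring of `U = D(h') ⊆ Z`, where `Z` is the closed subscheme of `X_W` with
ideal `J`. -/
abbrev RingU {J : Ideal (RingXW π w)} (h' : RingXW π w ⧸ J) : Type _ := Localization.Away h'

variable {J : Ideal (RingXW π w)}

/-- The composite `U ⟶ Z ⟶ X_W ⟶ W`. -/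
def mapUW (h' : RingXW π w ⧸ J) : RingW w →+* RingU h' :=
  (algebraMap (RingXW π w ⧸ J) (RingU h')).comp ((Ideal.Quotient.mk J).comp (mapXW π w))

/-- The coordinate ring of the scheme-theoretic image `V` of `U` in `W`. -/
abbrev RingV (h' : RingXW π w ⧸ J) : Type _ := RingW w ⧸ RingHom.ker (mapUW h')

/-- `U ⟶ V`. -/
def mapUV (h' : RingXW π w ⧸ J) : RingV h' →+* RingU h' := RingHom.kerLift (mapUW h')

/-- The coordinate ring of `V_v`. -/
abbrev RingVv {h' : RingXW π w ⧸ J} (v : RingV h') : Type _ := Localization.Away v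

/-- The coordinate ring of `U_v = U ×_V V_v`. -/
abbrev RingUv {h' : RingXW π w ⧸ J} (v : RingV h') : Type _ := Localization.Away (mapUV h' v)

/-- `U_v ⟶ V_v`. -/
def mapUvVv {h' : RingXW π w ⧸ J} (v : RingV h') : RingVv v →+* RingUv v :=
  Localization.awayMap (mapUV h') v

/-- The composite `U ⟶ X`. -/
def mapUX (h' : RingXW π w ⧸ J) : B →+* RingU h' :=
  (algebraMap (RingXW π w ⧸ J) (RingU h')).comp
    ((Ideal.Quotient.mk J).comp (algebraMap B (RingXW π w)))

/-- The coordinate ring of `U_h`, the distinguished open of `U` cut out by `h`. -/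
abbrev RingUh (h' : RingXW π w ⧸ J) (h : B) : Type _ := Localization.Away (mapUX h' h)

/-- `U_h ⟶ V`. -/
def mapUhV (h' : RingXW π w ⧸ J) (h : B) : RingV h' →+* RingUh h' h :=
  (algebraMap (RingU h') (RingUh h' h)).comp (mapUV h')

/-- `U_h ⟶ X`. -/
def mapUhX (h' : RingXW π w ⧸ J) (h : B) : B →+* RingUh h' h :=
  (algebraMap (RingU h') (RingUh h' h)).comp (mapUX h')

/-- `V_v ⟶ Y`. -/
def mapVvY {h' : RingXW π w ⧸ J} (v : RingV h') : A →+* RingVv v :=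
  (algebraMap (RingV h') (RingVv v)).comp
    ((Ideal.Quotient.mk (RingHom.ker (mapUW h'))).comp (algebraMap A (RingW w)))

/-- `D(h) ⟶ Y` for the distinguished open `D(h) ⊆ X`. -/
def mapDhY (π : A →+* B) (h : B) : A →+* Localization.Away h :=
  (algebraMap B (Localization.Away h)).comp π

/-- The embedding of `V_v(R)` in `R ^ n` given by a closed immersion `iY` of `Y` in affine
`n`-space. -/
def coordsVv {R : Type*} [Field R] [Algebra R A] {n : ℕ} (iY : MvPolynomial (Fin n) R →ₐ[R] A)
    {h' : RingXW π w ⧸ J} {v : RingV h'} (y : RingVv v →ₐ[R] R) : Fin n → R :=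
  coords ((mapVvY v).comp iY.toRingHom) y

/-- `U_h ⟶ X ⟶ 𝔸ⁿ⁺¹`, for a closed immersion `iX` of `X` in affine `(n + 1)`-space. -/
def mapUhAffine {R : Type*} [Field R] [Algebra R B] {n : ℕ}
    (iX : MvPolynomial (Fin (n + 1)) R →ₐ[R] B) (h' : RingXW π w ⧸ J) (h : B) :
    MvPolynomial (Fin (n + 1)) R →+* RingUh h' h :=
  (mapUhX h' h).comp iX.toRingHom

/-- The embedding of `U_h(R)` in `R ^ (n + 1)`. -/
def coordsUh {R : Type*} [Field R] [Algebra R B] {n : ℕ}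
    (iX : MvPolynomial (Fin (n + 1)) R →ₐ[R] B) {h' : RingXW π w ⧸ J} {h : B}
    (u : RingUh h' h →ₐ[R] R) : Fin (n + 1) → R :=
  coords (mapUhAffine iX h' h) u

/-- `#(D(h))_{ȳ}` for `y ∈ V_v(R)`. -/
def cardFiberDh {R : Type*} [Field R] [Algebra R A] {h' : RingXW π w ⧸ J} {v : RingV h'} (h : B)
    (y : RingVv v →ₐ[R] R) : ℕ∞ :=
  ENat.card (GeometricFiber (mapDhY π h) (PrimeSpectrum.comap (mapVvY v) (ratPoint y)))

/-- `#(U_h)_{ȳ}` for `y ∈ V_v(R)`. -/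
def cardFiberUh {R : Type*} [Field R] [Algebra R A] {h' : RingXW π w ⧸ J} {v : RingV h'} (h : B)
    (y : RingVv v →ₐ[R] R) : ℕ∞ :=
  ENat.card (GeometricFiber (mapUhV h' h)
    (PrimeSpectrum.comap (algebraMap (RingV h') (RingVv v)) (ratPoint y)))

/-- The fiber over `y ∈ V_v(R) ⊆ V(R)` of the map `U_h(R) → V(R)` of `R`-rational points. -/
def realFiberUh {R : Type*} [Field R] [Algebra R A] [Algebra R B] {h' : RingXW π w ⧸ J}
    {v : RingV h'} (h : B) (y : RingVv v →ₐ[R] R) : Set (RingUh h' h →ₐ[R] R) :=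
  {u | (u : RingUh h' h →+* R).comp (mapUhV h' h) =
    (y : RingVv v →+* R).comp (algebraMap (RingV h') (RingVv v))}

end TwoLayer

end

end GeomCAD

/-!
Let `x` be the last coordinate of `𝔸ⁿ⁺¹`. Everything happening over a real point `y` of `V_v` is
encoded in polynomials in `x`, and the theorem becomes a statement about their roots.

* *Reduction to polynomials.* The coordinate rings of `X`, `U`, `U_v` are generated over their bases
  by `x` and inverses of polynomials in `x` (`IsFractionGenerated`), so a point of a fibre is
  determined by its coordinate `x`. For a finite free morphism, the values of `x` on the fibre are
  the roots of the characteristic polynomial of multiplication by `x` (`fiberPolynomial`). Over `W`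
  this gives a monic polynomial `P` whose roots are the points of `X_W`. It shows that `x` is
  integral over `V_v`, so the free morphism `U_v ⟶ V_v` is finite (`finite_mapUvVv`) and has such a
  polynomial `Q` as well; the roots of `Q_y` are roots of `P_y`. Writing `h` as a polynomial `H` in
  `x`, the points of the fibres of `D(h)` and `U_h` over `y` become the roots of `P_y` and of `Q_y`
  at which `H_y` does not vanish (`cardFiberDh_eq`, `cardFiberUh_eq`, `isRootFamily_mapUhV`).

* *The count for `U_h` is constant.* The number of roots of `p` at which `g` does not vanish is the
  degree of `activeFactor p g = p / gcd(p, p' g)`. It is at least `m` iff the remainders modulo `p`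
  of `X ^ j p' g`, for `j < m`, are linearly independent, i.e. iff a Gram determinant is nonzero
  (here the base field is real), so it is lower semicontinuous in `y`. The count for `(P, H)` is the
  sum of the counts for `(Q, H)` and `(P, H Q)`. As the sum is constant on `S`, both summands are
  locally constant with semi-algebraic fibres, hence constant since `S` is semi-algebraically
  connected (`natDegree_activeFactor_eq_of_connected`).

* *Sections.* Once its degree is constant, the active factor of `(Q, H)` is given by Cramer's rule
  (`cramerFactor`), up to a nonvanishing factor, as the specialization at `y` of one polynomial with
  polynomial coefficients. It is separable and its leading coefficient does not vanish, so its real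
  roots move continuously, keeping their number and order (`eventually_exists_strictMonoOn_roots`).
  That the number of real roots satisfying a sign condition is a semi-algebraic function is Sturm's
  theorem: by the Euclidean algorithm, Cauchy indices are semi-algebraic in parameters
  (`isSemialgebraic_setOf_cauchyIndex_eq`). Hence the number of real roots is constant on `S`, and
  the `i`-th root is a continuous semi-algebraic function (`exists_root_sections`). The analysis of
  polynomials over `R` needed here rests on the fundamental theorem of algebra over a real closed
  field (`Irreducible.exists_dvd_sq_add_sq`).

* *Embedding.* `U_h` is embedded in `𝔸ⁿ⁺¹` as a closed subscheme of a distinguished open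
  (`IsImmersionInto`). This identifies it with a set `V(F) ∩ D(g)` and its points over `y` with the
  active roots of `Q_y` (`IsRootFamily.delineable`).
-/

namespace GeomCAD

open Polynomial

/-! ### Irreducible polynomials over a real closed field -/

section FundamentalTheorem

/-- Over a field in which every polynomial of odd degree has a root, all finite Galois groups are
`2`-groups: the fixed field of a Sylow `2`-subgroup has odd degree, hence is trivial. -/
theorem exists_card_gal_eq_two_pow {F L : Type*} [Field F] [CharZero F] [Field L] [Algebra F L]
    [FiniteDimensional F L] [IsGalois F L]
    (hodd : ∀ f : F[X], Odd f.natDegree → ∃ x, f.IsRoot x) :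
    ∃ k, Nat.card (L ≃ₐ[F] L) = 2 ^ k := by
  classical
  have : Fact (Nat.Prime 2) := ⟨Nat.prime_two⟩
  obtain ⟨H⟩ : Nonempty (Sylow 2 (L ≃ₐ[F] L)) := inferInstance
  set M := IntermediateField.fixedField (H : Subgroup (L ≃ₐ[F] L)) with hM
  have h1 : Module.finrank M L = Nat.card (H : Subgroup (L ≃ₐ[F] L)) :=
    IntermediateField.finrank_fixedField_eq_card _
  have h2 : Module.finrank F M * Module.finrank M L = Nat.card (L ≃ₐ[F] L) := by
    rw [Module.finrank_mul_finrank, IsGalois.card_aut_eq_finrank]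
  have h3 : Nat.card (H : Subgroup (L ≃ₐ[F] L)) * (H : Subgroup (L ≃ₐ[F] L)).index
      = Nat.card (L ≃ₐ[F] L) := Subgroup.card_mul_index _
  have hpos : 0 < Nat.card (H : Subgroup (L ≃ₐ[F] L)) := Nat.card_pos
  have h4 : Module.finrank F M = (H : Subgroup (L ≃ₐ[F] L)).index := by
    rw [h1, ← h3, mul_comm] at h2
    exact Nat.eq_of_mul_eq_mul_left hpos h2
  have h5 : Odd (Module.finrank F M) := by
    rw [h4, ← Nat.not_even_iff_odd, even_iff_two_dvd]
    exact H.not_dvd_index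
  obtain ⟨α, hα⟩ := Field.exists_primitive_element F M
  have hint : IsIntegral F α := Algebra.IsIntegral.isIntegral α
  have h6 : (minpoly F α).natDegree = Module.finrank F M := by
    rw [← IntermediateField.adjoin.finrank hint, hα]
    exact IntermediateField.finrank_top'
  obtain ⟨x, hx⟩ := hodd (minpoly F α) (h6 ▸ h5)
  have h7 : (minpoly F α).degree = 1 :=
    degree_eq_one_of_irreducible_of_root (minpoly.irreducible hint) hx
  have h8 : (minpoly F α).natDegree = 1 := natDegree_eq_of_degree_eq_some h7
  obtain ⟨k, hk⟩ := IsPGroup.iff_card.mp H.isPGroup'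
  refine ⟨k, ?_⟩
  rw [← h3, ← h4, ← h6, h8, mul_one]
  exact hk

/-- A field of characteristic zero all of whose elements are squares has no Galois extension of
degree `2 ^ k` with `0 < k`. -/
theorem bijective_algebraMap_of_forall_isSquare {K L : Type*} [Field K] [CharZero K] [Field L]
    [Algebra K L] [FiniteDimensional K L] [IsGalois K L] (hsq : ∀ z : K, IsSquare z)
    {k : ℕ} (hk : Nat.card (L ≃ₐ[K] L) = 2 ^ k) : Function.Bijective (algebraMap K L) := by
  classical
  have : Fact (Nat.Prime 2) := ⟨Nat.prime_two⟩
  rcases k with _ | k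
  · have h1 : Module.finrank K L = 1 := by
      rw [← IsGalois.card_aut_eq_finrank, hk, pow_zero]
    have h2 := Subalgebra.bot_eq_top_of_finrank_eq_one h1
    refine ⟨(algebraMap K L).injective, fun x => ?_⟩
    have : x ∈ (⊥ : Subalgebra K L) := h2 ▸ Algebra.mem_top
    exact Algebra.mem_bot.mp this
  · exfalso
    obtain ⟨H, hH⟩ := Sylow.exists_subgroup_card_pow_prime (G := L ≃ₐ[K] L) 2 (n := k)
      (hk ▸ pow_dvd_pow 2 (Nat.le_succ k))
    set M := IntermediateField.fixedField H with hM
    have h1 : Module.finrank M L = Nat.card H := IntermediateField.finrank_fixedField_eq_card _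
    have h2 : Module.finrank K M * Module.finrank M L = Nat.card (L ≃ₐ[K] L) := by
      rw [Module.finrank_mul_finrank, IsGalois.card_aut_eq_finrank]
    have h3 : Module.finrank K M = 2 := by
      rw [h1, hk, hH, pow_succ'] at h2
      exact Nat.eq_of_mul_eq_mul_right (by positivity) h2
    obtain ⟨α, hα⟩ := Field.exists_primitive_element K M
    have hint : IsIntegral K α := Algebra.IsIntegral.isIntegral α
    have h6 : (minpoly K α).natDegree = 2 := by
      rw [← h3, ← IntermediateField.adjoin.finrank hint, hα]
      exact IntermediateField.finrank_top'
    obtain ⟨s, hs⟩ := hsq (discrim 1 ((minpoly K α).coeff 1) ((minpoly K α).coeff 0))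
    obtain ⟨x, hx⟩ := exists_quadratic_eq_zero (one_ne_zero) ⟨s, hs⟩
    have hlead : (minpoly K α).coeff 2 = 1 := by
      have := (minpoly.monic hint).coeff_natDegree
      rwa [h6] at this
    have hroot : (minpoly K α).IsRoot x := by
      rw [IsRoot.def, eval_eq_sum_range, h6]
      simp only [Finset.sum_range_succ, Finset.sum_range_zero, hlead]
      linear_combination hx
    have h7 : (minpoly K α).degree = 1 :=
      degree_eq_one_of_irreducible_of_root (minpoly.irreducible hint) hroot
    have h8 : (minpoly K α).natDegree = 1 := natDegree_eq_of_degree_eq_some h7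
    omega

variable {R : Type*} [Field R] [LinearOrder R] [IsStrictOrderedRing R] [IsRealClosed R]

/-- The square root of `a + b i` in `R(i)`. -/
theorem exists_sq_sub_sq_and_two_mul (a b : R) : ∃ u v : R, u ^ 2 - v ^ 2 = a ∧ 2 * u * v = b := by
  obtain ⟨s, hs0, hs⟩ : ∃ s : R, 0 ≤ s ∧ a ^ 2 + b ^ 2 = s ^ 2 := by
    obtain ⟨r, hr⟩ := IsRealClosed.exists_eq_pow_of_nonneg (x := a ^ 2 + b ^ 2) (by positivity)
      two_ne_zero
    exact ⟨|r|, abs_nonneg r, by rw [hr, sq_abs]⟩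
  have habs : |a| ≤ s := abs_le_of_sq_le_sq (by nlinarith [sq_nonneg b]) hs0
  obtain ⟨h1, h2⟩ := abs_le.mp habs
  obtain ⟨u, hu⟩ := IsRealClosed.exists_eq_pow_of_nonneg (x := (a + s) / 2) (by linarith)
    two_ne_zero
  obtain ⟨v, hv⟩ := IsRealClosed.exists_eq_pow_of_nonneg (x := (s - a) / 2) (by linarith)
    two_ne_zero
  have hb : (2 * u * v) ^ 2 = b ^ 2 := by
    have : (2 * u * v) ^ 2 = 4 * u ^ 2 * v ^ 2 := by ring
    rw [this, ← hu, ← hv]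
    linear_combination -hs
  rcases sq_eq_sq_iff_eq_or_eq_neg.mp hb with h | h
  · exact ⟨u, v, by rw [← hu, ← hv]; ring, h⟩
  · exact ⟨u, -v, by rw [neg_sq, ← hu, ← hv]; ring, by linear_combination -h⟩

/-- The fundamental theorem of algebra over a real closed field: an irreducible polynomial divides
the minimal polynomial `(X - a) ^ 2 + b ^ 2` of some `a + b i`. -/
theorem Irreducible.exists_dvd_sq_add_sq {f : R[X]} (hf : Irreducible f) :
    ∃ a b : R, f ∣ (X - C a) ^ 2 + C (b ^ 2) := by
  classical
  set g : R[X] := f * (X ^ 2 + 1) with hg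
  have hne : (X ^ 2 + 1 : R[X]) ≠ 0 := by
    intro h
    have := congrArg (eval 0) h
    simp at this
  have hg0 : g ≠ 0 := mul_ne_zero hf.ne_zero hne
  let L := g.SplittingField
  have : IsGalois R L := ⟨⟩
  have hspl : (g.map (algebraMap R L)).Splits := SplittingField.splits g
  have hgm : g.map (algebraMap R L) ≠ 0 := Polynomial.map_ne_zero hg0
  have hdvd1 : (X ^ 2 + 1 : R[X]).map (algebraMap R L) ∣ g.map (algebraMap R L) :=
    Polynomial.map_dvd _ (Dvd.intro_left f rfl)
  have hdvd2 : f.map (algebraMap R L) ∣ g.map (algebraMap R L) :=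
    Polynomial.map_dvd _ (Dvd.intro _ rfl)
  obtain ⟨i, hi⟩ : ∃ i : L, i ^ 2 = -1 := by
    obtain ⟨i, hi⟩ := (hspl.of_dvd hgm hdvd1).exists_eval_eq_zero (by
      rw [degree_map, show (X ^ 2 + 1 : R[X]) = X ^ 2 + C 1 by simp, degree_X_pow_add_C two_pos]
      norm_num)
    exact ⟨i, by simp at hi; linear_combination hi⟩
  obtain ⟨α, hα⟩ : ∃ α : L, aeval α f = 0 := by
    obtain ⟨α, hα⟩ := (hspl.of_dvd hgm hdvd2).exists_eval_eq_zero (by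
      rw [degree_map]; exact (degree_pos_of_irreducible hf).ne')
    exact ⟨α, by rwa [eval_map_algebraMap] at hα⟩
  let K := IntermediateField.adjoin R {i}
  -- the elements of `R(i)` are the `a + b i`
  have hK : ∀ z ∈ K, ∃ a b : R, z = algebraMap R L a + algebraMap R L b * i := by
    intro z hz
    have hz' : z ∈ Algebra.adjoin R {i} := by
      rw [← IntermediateField.adjoin_simple_toSubalgebra_of_isAlgebraic
        (Algebra.IsAlgebraic.isAlgebraic i)]
      exact hz
    clear hz
    induction hz' using Algebra.adjoin_induction with
    | mem x hx => exact ⟨0, 1, by simpa using hx⟩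
    | algebraMap r => exact ⟨r, 0, by simp⟩
    | add x y hx hy h1 h2 =>
      obtain ⟨a, b, rfl⟩ := h1
      obtain ⟨c, d, rfl⟩ := h2
      exact ⟨a + c, b + d, by simp only [map_add]; ring⟩
    | mul x y hx hy h1 h2 =>
      obtain ⟨a, b, rfl⟩ := h1
      obtain ⟨c, d, rfl⟩ := h2
      refine ⟨a * c - b * d, a * d + b * c, ?_⟩
      simp only [map_add, map_sub, map_mul]
      linear_combination (algebraMap R L b * algebraMap R L d) * hi
  have hiK : i ∈ K := IntermediateField.mem_adjoin_simple_self R i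
  have hsq : ∀ z : K, IsSquare z := by
    rintro ⟨z, hz⟩
    obtain ⟨a, b, rfl⟩ := hK z hz
    obtain ⟨u, v, h1, h2⟩ := exists_sq_sub_sq_and_two_mul a b
    refine ⟨⟨algebraMap R L u + algebraMap R L v * i,
      K.add_mem (K.algebraMap_mem u) (K.mul_mem (K.algebraMap_mem v) hiK)⟩, Subtype.ext ?_⟩
    simp only [MulMemClass.mk_mul_mk, ← h1, ← h2, map_sub, map_mul, map_pow, map_ofNat]
    linear_combination -(algebraMap R L v) ^ 2 * hi
  obtain ⟨k, hk⟩ := exists_card_gal_eq_two_pow (F := R) (L := L)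
    (fun f hf => IsRealClosed.exists_isRoot_of_odd_natDegree hf)
  have hdvd : Nat.card (L ≃ₐ[K] L) ∣ 2 ^ k := by
    rw [← hk, IsGalois.card_aut_eq_finrank, IsGalois.card_aut_eq_finrank]
    exact Dvd.intro_left _ (Module.finrank_mul_finrank R K L)
  obtain ⟨j, -, hj⟩ := (Nat.dvd_prime_pow Nat.prime_two).mp hdvd
  obtain ⟨⟨z, hz⟩, rfl⟩ := (bijective_algebraMap_of_forall_isSquare hsq hj).2 α
  obtain ⟨a, b, hab⟩ := hK z hz
  refine ⟨a, b, ?_⟩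
  have hα' : aeval z f = 0 := hα
  have hmin : f ∣ (X - C a) ^ 2 + C (b ^ 2) := by
    have h1 : aeval z ((X - C a) ^ 2 + C (b ^ 2) : R[X]) = 0 := by
      simp only [map_add, map_pow, map_sub, aeval_X, aeval_C, hab]
      linear_combination (algebraMap R L b) ^ 2 * hi
    have h2 : minpoly R z ∣ f := minpoly.dvd R z hα'
    have h3 := (minpoly.irreducible (Algebra.IsIntegral.isIntegral (R := R) z)).associated_of_dvd
      hf h2
    exact h3.symm.dvd.trans (minpoly.dvd R z h1)
  exact hmin

end FundamentalTheorem

end GeomCAD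

namespace GeomCAD

open Polynomial

/-! ### Signs of polynomials over a real closed field -/

section Signs

theorem induction_on_roots {F : Type*} [Field F] {P : F[X] → Prop}
    (rootless : ∀ p : F[X], p ≠ 0 → (∀ x, ¬ p.IsRoot x) → P p)
    (mul : ∀ (r : F) (q : F[X]), q ≠ 0 → P q → P ((X - C r) * q)) (p : F[X]) (hp : p ≠ 0) :
    P p := by
  induction hn : p.natDegree using Nat.strong_induction_on generalizing p with
  | _ n ih =>
    by_cases h : ∃ r, p.IsRoot r
    · obtain ⟨r, hr⟩ := h
      obtain ⟨q, rfl⟩ := dvd_iff_isRoot.mpr hr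
      have hq : q ≠ 0 := right_ne_zero_of_mul hp
      refine mul r q hq (ih _ ?_ q hq rfl)
      rw [← hn, natDegree_mul (X_sub_C_ne_zero r) hq, natDegree_X_sub_C]
      omega
    · exact rootless p hp (not_exists.mp h)

variable {R : Type*} [Field R] [LinearOrder R] [IsStrictOrderedRing R] [IsRealClosed R]

/-- A polynomial without roots is bounded away from zero and has the sign of its leading
coefficient everywhere. -/
theorem exists_pos_le_leadingCoeff_mul_eval (p : R[X]) (hp : p ≠ 0) (hroot : ∀ x, ¬ p.IsRoot x) :
    ∃ δ > 0, ∀ t, δ ≤ p.leadingCoeff * p.eval t := by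
  induction hn : p.natDegree using Nat.strong_induction_on generalizing p with
  | _ n ih =>
    by_cases hd : p.natDegree = 0
    · rw [natDegree_eq_zero] at hd
      obtain ⟨c, rfl⟩ := hd
      have hc : c ≠ 0 := by rintro rfl; simp at hp
      exact ⟨c * c, mul_self_pos.mpr hc, fun t => by simp⟩
    have hu : ¬ IsUnit p := fun h => hd (natDegree_eq_zero_of_isUnit h)
    obtain ⟨f, hf, hfp⟩ := WfDvdMonoid.exists_irreducible_factor hu hp
    obtain ⟨a, b, hab⟩ := Irreducible.exists_dvd_sq_add_sq hf
    have hfroot : ∀ x, ¬ f.IsRoot x := fun x hx => hroot x (hx.dvd hfp)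
    set m : R[X] := (X - C a) ^ 2 + C (b ^ 2) with hm
    have hb : b ≠ 0 := by
      rintro rfl
      have h1 : f ∣ (X - C a) ^ 2 := by simpa [hm] using hab
      have h2 : f ∣ X - C a := hf.prime.dvd_of_dvd_pow h1
      have h4 := hf.associated_of_dvd (irreducible_X_sub_C a) h2
      exact hfroot a (dvd_iff_isRoot.mp h4.symm.dvd)
    have hmdeg : m.natDegree = 2 := by
      rw [hm, natDegree_add_C, natDegree_pow, natDegree_X_sub_C]
    have hmm : m.Monic := by
      rw [Monic, leadingCoeff, hmdeg, hm]
      simp [pow_two, sub_mul, mul_sub, coeff_X]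
    have hfdeg : f.natDegree = 2 := by
      have h1 : f.natDegree ≤ 2 := hmdeg ▸ natDegree_le_of_dvd hab hmm.ne_zero
      have h2 : 0 < f.natDegree := hf.natDegree_pos
      have h3 : f.natDegree ≠ 1 := fun h => by
        obtain ⟨x, hx⟩ := exists_root_of_degree_eq_one
          ((degree_eq_iff_natDegree_eq hf.ne_zero).mpr h)
        exact hfroot x hx
      omega
    have hmp : m ∣ p := by
      obtain ⟨u, hu'⟩ := hab
      have hu0 : u ≠ 0 := by rintro rfl; exact hmm.ne_zero (by rw [hu', mul_zero])
      have h1 : u.natDegree = 0 := by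
        have := congrArg natDegree hu'
        rw [hmdeg, natDegree_mul hf.ne_zero hu0, hfdeg] at this
        omega
      have h2 : IsUnit u := by
        rw [isUnit_iff_degree_eq_zero, degree_eq_natDegree hu0, h1]; rfl
      rw [hu']
      exact (h2.mul_right_dvd).mpr hfp
    obtain ⟨q, rfl⟩ := hmp
    have hq0 : q ≠ 0 := right_ne_zero_of_mul hp
    obtain ⟨δ, hδ, hq⟩ := ih q.natDegree (by
        rw [← hn, natDegree_mul hmm.ne_zero hq0, hmdeg]; omega) q hq0
      (fun x hx => hroot x (hx.dvd (Dvd.intro_left m rfl))) rfl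
    refine ⟨b ^ 2 * δ, by positivity, fun t => ?_⟩
    rw [leadingCoeff_mul, hmm.leadingCoeff, one_mul, eval_mul]
    have hmt : m.eval t = (t - a) ^ 2 + b ^ 2 := by simp [hm]
    calc b ^ 2 * δ ≤ m.eval t * (q.leadingCoeff * q.eval t) := by
          rw [hmt]
          have := hq t
          gcongr
          linarith [sq_nonneg (t - a)]
      _ = _ := by ring

theorem sign_eval_eq_sign_leadingCoeff_of_forall_not_isRoot (p : R[X]) (hp : p ≠ 0)
    (hroot : ∀ x, ¬ p.IsRoot x) (t : R) :
    SignType.sign (p.eval t) = SignType.sign p.leadingCoeff := by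
  obtain ⟨δ, hδ, h⟩ := exists_pos_le_leadingCoeff_mul_eval p hp hroot
  have h1 : 0 < p.leadingCoeff * p.eval t := hδ.trans_le (h t)
  rcases pos_and_pos_or_neg_and_neg_of_mul_pos h1 with ⟨h2, h3⟩ | ⟨h2, h3⟩
  · rw [sign_pos h2, sign_pos h3]
  · rw [sign_neg h2, sign_neg h3]

/-- A polynomial without roots in an interval has the same sign at its end points. -/
theorem sign_eval_eq_of_forall_mem_Icc (p : R[X]) (hp : p ≠ 0) {a b : R} (hab : a ≤ b)
    (hroot : ∀ x ∈ Set.Icc a b, ¬ p.IsRoot x) :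
    SignType.sign (p.eval a) = SignType.sign (p.eval b) := by
  revert hroot
  refine induction_on_roots (P := fun p => (∀ x ∈ Set.Icc a b, ¬ p.IsRoot x) →
    SignType.sign (p.eval a) = SignType.sign (p.eval b)) ?_ ?_ p hp
  · intro p hp h _
    rw [sign_eval_eq_sign_leadingCoeff_of_forall_not_isRoot p hp h,
      sign_eval_eq_sign_leadingCoeff_of_forall_not_isRoot p hp h]
  · intro r q hq ih h
    have hr : r < a ∨ b < r := by
      by_contra! hr
      exact h r hr (by simp)
    rw [eval_mul, eval_mul, sign_mul, sign_mul, ih fun x hx hx' => h x hx (by simp_all)]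
    congr 1
    simp only [eval_sub, eval_X, eval_C]
    rcases hr with hr | hr
    · rw [sign_pos (by linarith), sign_pos (by linarith)]
    · rw [sign_neg (by linarith), sign_neg (by linarith)]

/-- A polynomial has the sign of its leading coefficient to the right of all its roots. -/
theorem sign_eval_eq_sign_leadingCoeff_of_forall_le (p : R[X]) (hp : p ≠ 0) {c : R}
    (hroot : ∀ x, c ≤ x → ¬ p.IsRoot x) :
    SignType.sign (p.eval c) = SignType.sign p.leadingCoeff := by
  revert hroot
  refine induction_on_roots (P := fun p => (∀ x, c ≤ x → ¬ p.IsRoot x) →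
    SignType.sign (p.eval c) = SignType.sign p.leadingCoeff) ?_ ?_ p hp
  · intro p hp h _
    rw [sign_eval_eq_sign_leadingCoeff_of_forall_not_isRoot p hp h]
  · intro r q hq ih h
    have hr : r < c := by
      by_contra! hr
      exact h r hr (by simp)
    rw [eval_mul, sign_mul, ih fun x hx hx' => h x hx (by simp_all), leadingCoeff_mul,
      leadingCoeff_X_sub_C, one_mul]
    simp only [eval_sub, eval_X, eval_C]
    rw [sign_pos (by linarith), one_mul]

/-- The intermediate value theorem for polynomials over a real closed field. -/
theorem exists_isRoot_mem_Ioo (p : R[X]) {a b : R} (hab : a ≤ b)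
    (h : p.eval a * p.eval b < 0) : ∃ x ∈ Set.Ioo a b, p.IsRoot x := by
  have hp : p ≠ 0 := by rintro rfl; simp at h
  by_contra! hcon
  have ha : p.eval a ≠ 0 := by rintro h0; simp [h0] at h
  have hb : p.eval b ≠ 0 := by rintro h0; simp [h0] at h
  have h1 := sign_eval_eq_of_forall_mem_Icc p hp hab (fun x hx hx' => by
    rcases eq_or_lt_of_le hx.1 with rfl | h1
    · exact ha hx'
    rcases eq_or_lt_of_le hx.2 with rfl | h2
    · exact hb hx'
    exact hcon x ⟨h1, h2⟩ hx')
  rcases lt_or_gt_of_ne ha with h2 | h2 <;> rcases lt_or_gt_of_ne hb with h3 | h3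
  · nlinarith
  · rw [sign_neg h2, sign_pos h3] at h1; exact absurd h1 (by decide)
  · rw [sign_pos h2, sign_neg h3] at h1; exact absurd h1 (by decide)
  · nlinarith

end Signs

end GeomCAD

namespace GeomCAD

/-! ### Semi-algebraic sets -/

section SemialgebraicSets

variable {R : Type*} [Field R] [LinearOrder R] {ι κ : Type*}

theorem IsBasicSemialgebraic.inter {s t : Set (ι → R)} (hs : IsBasicSemialgebraic s)
    (ht : IsBasicSemialgebraic t) : IsBasicSemialgebraic (s ∩ t) := by
  classical
  obtain ⟨F, G, rfl⟩ := hs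
  obtain ⟨F', G', rfl⟩ := ht
  refine ⟨F ∪ F', G ∪ G', ?_⟩
  ext x
  simp only [Set.mem_inter_iff, Set.mem_ofPred_eq, Finset.mem_union]
  constructor
  · rintro ⟨⟨h1, h2⟩, h3, h4⟩
    exact ⟨fun f hf => hf.elim (h1 f) (h3 f), fun f hf => hf.elim (h2 f) (h4 f)⟩
  · rintro ⟨h1, h2⟩
    exact ⟨⟨fun f hf => h1 f (.inl hf), fun f hf => h2 f (.inl hf)⟩,
      fun f hf => h1 f (.inr hf), fun f hf => h2 f (.inr hf)⟩

theorem IsBasicSemialgebraic.isSemialgebraic {s : Set (ι → R)} (hs : IsBasicSemialgebraic s) :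
    IsSemialgebraic s :=
  ⟨{s}, Set.finite_singleton s, by simpa using hs, by simp⟩

theorem isSemialgebraic_setOf_eval_eq_zero (f : MvPolynomial ι R) :
    IsSemialgebraic {x : ι → R | MvPolynomial.eval x f = 0} :=
  IsBasicSemialgebraic.isSemialgebraic ⟨{f}, ∅, by simp⟩

theorem isSemialgebraic_setOf_eval_pos (f : MvPolynomial ι R) :
    IsSemialgebraic {x : ι → R | 0 < MvPolynomial.eval x f} :=
  IsBasicSemialgebraic.isSemialgebraic ⟨∅, {f}, by simp⟩

theorem isSemialgebraic_univ : IsSemialgebraic (Set.univ : Set (ι → R)) :=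
  IsBasicSemialgebraic.isSemialgebraic ⟨∅, ∅, by simp⟩

theorem isSemialgebraic_empty : IsSemialgebraic (∅ : Set (ι → R)) :=
  ⟨∅, Set.finite_empty, by simp, by simp⟩

theorem IsSemialgebraic.union {s t : Set (ι → R)} (hs : IsSemialgebraic s)
    (ht : IsSemialgebraic t) : IsSemialgebraic (s ∪ t) := by
  obtain ⟨S, hS, hS', rfl⟩ := hs
  obtain ⟨T, hT, hT', rfl⟩ := ht
  exact ⟨S ∪ T, hS.union hT, fun u hu => hu.elim (hS' u) (hT' u), (Set.sUnion_union S T).symm⟩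

theorem IsSemialgebraic.inter {s t : Set (ι → R)} (hs : IsSemialgebraic s)
    (ht : IsSemialgebraic t) : IsSemialgebraic (s ∩ t) := by
  obtain ⟨S, hS, hS', rfl⟩ := hs
  obtain ⟨T, hT, hT', rfl⟩ := ht
  refine ⟨Set.image2 (· ∩ ·) S T, hS.image2 _ hT, ?_, ?_⟩
  · rintro _ ⟨u, hu, v, hv, rfl⟩
    exact (hS' u hu).inter (hT' v hv)
  · ext x
    simp only [Set.mem_inter_iff, Set.mem_sUnion, Set.mem_image2]
    constructor
    · rintro ⟨⟨u, hu, hx⟩, v, hv, hx'⟩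
      exact ⟨_, ⟨u, hu, v, hv, rfl⟩, hx, hx'⟩
    · rintro ⟨_, ⟨u, hu, v, hv, rfl⟩, hx, hx'⟩
      exact ⟨⟨u, hu, hx⟩, v, hv, hx'⟩

theorem IsSemialgebraic.iInter_finset {α : Type*} (T : Finset α) {s : α → Set (ι → R)}
    (h : ∀ a ∈ T, IsSemialgebraic (s a)) : IsSemialgebraic (⋂ a ∈ T, s a) := by
  classical
  induction T using Finset.induction_on with
  | empty => simpa using isSemialgebraic_univ
  | insert a T ha ih =>
    rw [Finset.set_biInter_insert]
    exact (h a (Finset.mem_insert_self a T)).inter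
      (ih fun b hb => h b (Finset.mem_insert_of_mem hb))

theorem IsSemialgebraic.iUnion_finset {α : Type*} (T : Finset α) {s : α → Set (ι → R)}
    (h : ∀ a ∈ T, IsSemialgebraic (s a)) : IsSemialgebraic (⋃ a ∈ T, s a) := by
  classical
  induction T using Finset.induction_on with
  | empty => simpa using isSemialgebraic_empty
  | insert a T ha ih =>
    rw [Finset.set_biUnion_insert]
    exact (h a (Finset.mem_insert_self a T)).union
      (ih fun b hb => h b (Finset.mem_insert_of_mem hb))

/-- The preimage of a semi-algebraic set under a polynomial map is semi-algebraic. -/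
theorem IsSemialgebraic.preimage {s : Set (ι → R)} (hs : IsSemialgebraic s)
    (φ : ι → MvPolynomial κ R) :
    IsSemialgebraic {x : κ → R | (fun i => MvPolynomial.eval x (φ i)) ∈ s} := by
  classical
  obtain ⟨S, hS, hS', rfl⟩ := hs
  refine ⟨(fun u => {x : κ → R | (fun i => MvPolynomial.eval x (φ i)) ∈ u}) '' S, hS.image _,
    ?_, ?_⟩
  · rintro _ ⟨u, hu, rfl⟩
    obtain ⟨F, G, rfl⟩ := hS' u hu
    have key : ∀ (x : κ → R) (f : MvPolynomial ι R),
        MvPolynomial.eval (fun i => MvPolynomial.eval x (φ i)) f =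
          MvPolynomial.eval x (MvPolynomial.bind₁ φ f) := fun x f => by
      rw [MvPolynomial.eval, MvPolynomial.eval, MvPolynomial.eval₂Hom_bind₁]
    refine ⟨F.image (MvPolynomial.bind₁ φ), G.image (MvPolynomial.bind₁ φ), ?_⟩
    ext x
    simp [key]
  · ext x
    simp

/-- On a semi-algebraically connected set, a subset that is relatively clopen and semi-algebraic
is empty or everything. -/
theorem IsSemialgebraicallyConnected.eq_of_isClopen [TopologicalSpace R] {s t₁ t₂ : Set (ι → R)}
    (hs : IsSemialgebraicallyConnected s) (h₁ : IsSemialgebraic t₁) (h₂ : IsSemialgebraic t₂)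
    (ho₁ : ∃ U, IsOpen U ∧ t₁ = U ∩ s) (ho₂ : ∃ U, IsOpen U ∧ t₂ = U ∩ s)
    (hd : Disjoint t₁ t₂) (hu : t₁ ∪ t₂ = s) (hne : t₁.Nonempty) : t₁ = s := by
  by_contra hcon
  have hne₂ : t₂.Nonempty := by
    by_contra h
    rw [Set.not_nonempty_iff_eq_empty] at h
    exact hcon (by simpa [h] using hu)
  obtain ⟨U₁, hU₁, rfl⟩ := ho₁
  obtain ⟨U₂, hU₂, rfl⟩ := ho₂
  have hdis : ∀ x, x ∈ s → x ∈ U₁ → x ∈ U₂ → False := fun x hx h1 h2 =>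
    Set.disjoint_left.mp hd ⟨h1, hx⟩ ⟨h2, hx⟩
  have hcov : ∀ x, x ∈ s → x ∈ U₁ ∨ x ∈ U₂ := fun x hx => by
    rw [← hu] at hx
    exact hx.imp And.left And.left
  refine hs ⟨_, _, h₁, h₂, ⟨U₂ᶜ, hU₂.isClosed_compl, ?_⟩, ⟨U₁ᶜ, hU₁.isClosed_compl, ?_⟩,
    hne, hne₂, hd, hu⟩
  · ext x
    constructor
    · rintro ⟨h1, hx⟩; exact ⟨fun h2 => hdis x hx h1 h2, hx⟩
    · rintro ⟨h1, hx⟩; exact ⟨(hcov x hx).resolve_right h1, hx⟩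
  · ext x
    constructor
    · rintro ⟨h1, hx⟩; exact ⟨fun h2 => hdis x hx h2 h1, hx⟩
    · rintro ⟨h1, hx⟩; exact ⟨(hcov x hx).resolve_left h1, hx⟩

variable [IsStrictOrderedRing R]

theorem isSemialgebraic_setOf_eval_ne_zero (f : MvPolynomial ι R) :
    IsSemialgebraic {x : ι → R | MvPolynomial.eval x f ≠ 0} := by
  have := (isSemialgebraic_setOf_eval_pos f).union (isSemialgebraic_setOf_eval_pos (-f))
  refine (congrArg IsSemialgebraic ?_).mp this
  ext x
  simp only [Set.mem_union, Set.mem_ofPred_eq, map_neg, Left.neg_pos_iff]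
  rw [ne_iff_lt_or_gt, or_comm]

theorem isSemialgebraic_setOf_eval_neg (f : MvPolynomial ι R) :
    IsSemialgebraic {x : ι → R | MvPolynomial.eval x f < 0} := by
  simpa using isSemialgebraic_setOf_eval_pos (-f)

theorem IsBasicSemialgebraic.compl {s : Set (ι → R)} (hs : IsBasicSemialgebraic s) :
    IsSemialgebraic sᶜ := by
  obtain ⟨F, G, rfl⟩ := hs
  have h1 : IsSemialgebraic (⋃ f ∈ F, {x : ι → R | MvPolynomial.eval x f ≠ 0}) :=
    IsSemialgebraic.iUnion_finset F fun f _ => isSemialgebraic_setOf_eval_ne_zero f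
  have h2 : IsSemialgebraic (⋃ f ∈ G, ({x : ι → R | MvPolynomial.eval x f = 0} ∪
      {x : ι → R | MvPolynomial.eval x f < 0})) :=
    IsSemialgebraic.iUnion_finset G fun f _ =>
      (isSemialgebraic_setOf_eval_eq_zero f).union (isSemialgebraic_setOf_eval_neg f)
  refine (congrArg IsSemialgebraic ?_).mp (h1.union h2)
  ext x
  simp only [Set.mem_union, Set.mem_iUnion, Set.mem_ofPred_eq, Set.mem_compl_iff, not_and_or,
    not_forall, not_lt, exists_prop, le_iff_eq_or_lt, ne_eq]

theorem IsSemialgebraic.compl {s : Set (ι → R)} (hs : IsSemialgebraic s) :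
    IsSemialgebraic sᶜ := by
  obtain ⟨S, hS, hS', rfl⟩ := hs
  have := IsSemialgebraic.iInter_finset hS.toFinset (s := fun u => uᶜ)
    fun u hu => (hS' u (by simpa using hu)).compl
  refine (congrArg IsSemialgebraic ?_).mp this
  ext x
  simp

end SemialgebraicSets

end GeomCAD

namespace GeomCAD

open Polynomial

/-! ### The Cauchy index -/

section CauchyIndex

variable {R : Type*} [Field R]

theorem exists_eq_pow_mul_eval_ne_zero {f : R[X]} (hf : f ≠ 0) (t : R) :
    ∃ g : R[X], f = (X - C t) ^ f.rootMultiplicity t * g ∧ g.eval t ≠ 0 := by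
  obtain ⟨g, hg, hg'⟩ := exists_eq_pow_rootMultiplicity_mul_and_not_dvd f hf t
  exact ⟨g, hg, fun h => hg' (dvd_iff_isRoot.mpr h)⟩

theorem rootMultiplicity_pow_mul {g : R[X]} {t : R} (hg : g.eval t ≠ 0) (m : ℕ) :
    ((X - C t) ^ m * g).rootMultiplicity t = m := by
  have hg0 : g ≠ 0 := by rintro rfl; simp at hg
  rw [rootMultiplicity_mul (mul_ne_zero (pow_ne_zero _ (X_sub_C_ne_zero t)) hg0),
    rootMultiplicity_X_sub_C_pow, rootMultiplicity_eq_zero hg, add_zero]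

theorem even_natDegree_of_forall_not_isRoot [IsRealClosed R] {p : R[X]} (h : ∀ x, ¬ p.IsRoot x) :
    Even p.natDegree := by
  by_contra hodd
  obtain ⟨x, hx⟩ := IsRealClosed.exists_isRoot_of_odd_natDegree (Nat.not_even_iff_odd.mp hodd)
  exact h x hx

variable [LinearOrder R]

/-- The sign of `f` immediately to the right of `t`: the sign at `t` of the cofactor of the
highest power of `X - t` dividing `f`. -/
noncomputable def localSign (f : R[X]) (t : R) : SignType :=
  SignType.sign ((f /ₘ (X - C t) ^ f.rootMultiplicity t).eval t)

/-- The contribution of `t` to the Cauchy index of `q / p`: the sign of the jump at `t` if the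
rational function `q / p` has a pole of odd order there, and zero otherwise. -/
noncomputable def localIndex (q p : R[X]) (t : R) : ℤ :=
  if q.rootMultiplicity t < p.rootMultiplicity t ∧
    Odd (p.rootMultiplicity t + q.rootMultiplicity t) then
    ((localSign p t * localSign q t : SignType) : ℤ) else 0

/-- The Cauchy index of the rational function `q / p`: the number of its jumps from `-∞` to `+∞`
minus the number of its jumps from `+∞` to `-∞`. -/
noncomputable def cauchyIndex (q p : R[X]) : ℤ := ∑ t ∈ p.roots.toFinset, localIndex q p t

/-- The net number of sign changes of `f`, counted by the sign after the change. -/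
noncomputable def totalJump (f : R[X]) : ℤ :=
  ∑ t ∈ f.roots.toFinset, if Odd (f.rootMultiplicity t) then (localSign f t : ℤ) else 0

theorem localSign_pow_mul {g : R[X]} {t : R} (hg : g.eval t ≠ 0) (m : ℕ) :
    localSign ((X - C t) ^ m * g) t = SignType.sign (g.eval t) := by
  rw [localSign, rootMultiplicity_pow_mul hg,
    mul_divByMonic_cancel_left _ ((monic_X_sub_C t).pow m)]

theorem localSign_of_eval_ne_zero {g : R[X]} {t : R} (hg : g.eval t ≠ 0) :
    localSign g t = SignType.sign (g.eval t) := by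
  simpa using localSign_pow_mul hg 0

@[simp] theorem localSign_zero (t : R) : localSign (0 : R[X]) t = 0 := by simp [localSign]

theorem localIndex_eq_of_lt {q p s : R[X]} {t : R} (hq : q ≠ 0) (hp : p ≠ 0)
    (h : q.rootMultiplicity t < p.rootMultiplicity t) :
    localIndex (q + p * s) p t = localIndex q p t := by
  obtain ⟨p', hp', hpt⟩ := exists_eq_pow_mul_eval_ne_zero hp t
  obtain ⟨q', hq', hqt⟩ := exists_eq_pow_mul_eval_ne_zero hq t
  obtain ⟨d, hd⟩ := Nat.exists_eq_add_of_lt h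
  set a := q.rootMultiplicity t with ha
  have hsum : q + p * s = (X - C t) ^ a * (q' + (X - C t) ^ (d + 1) * p' * s) := by
    conv_lhs => rw [hp', hq', hd]
    ring
  have hev : (q' + (X - C t) ^ (d + 1) * p' * s).eval t ≠ 0 := by simpa using hqt
  have h1 : (q + p * s).rootMultiplicity t = q.rootMultiplicity t := by
    rw [hsum, rootMultiplicity_pow_mul hev]
  have h2 : localSign (q + p * s) t = localSign q t := by
    rw [hsum, localSign_pow_mul hev]
    conv_rhs => rw [hq']
    rw [localSign_pow_mul hqt]
    simp
  rw [localIndex, localIndex, h1, h2]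

theorem localIndex_eq_zero {q p : R[X]} {t : R}
    (h : ¬ (q ≠ 0 ∧ q.rootMultiplicity t < p.rootMultiplicity t)) : localIndex q p t = 0 := by
  rw [localIndex]
  split_ifs with h1
  · have : q = 0 := by
      by_contra hq
      exact h ⟨hq, h1.1⟩
    simp [this]
  · rfl

theorem cauchyIndex_add_mul (q p s : R[X]) : cauchyIndex (q + p * s) p = cauchyIndex q p := by
  by_cases hp : p = 0
  · simp [cauchyIndex, hp]
  refine Finset.sum_congr rfl fun t _ => ?_
  by_cases h1 : q ≠ 0 ∧ q.rootMultiplicity t < p.rootMultiplicity t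
  · exact localIndex_eq_of_lt h1.1 hp h1.2
  by_cases h2 : q + p * s ≠ 0 ∧ (q + p * s).rootMultiplicity t < p.rootMultiplicity t
  · have := localIndex_eq_of_lt (s := -s) h2.1 hp h2.2
    rw [← this]
    congr 1
    ring
  · rw [localIndex_eq_zero h1, localIndex_eq_zero h2]

variable [IsStrictOrderedRing R]

theorem localSign_mul (f g : R[X]) (t : R) :
    localSign (f * g) t = localSign f t * localSign g t := by
  by_cases hf : f = 0
  · simp [hf]
  by_cases hg : g = 0
  · simp [hg]
  obtain ⟨f', hf', hft⟩ := exists_eq_pow_mul_eval_ne_zero hf t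
  obtain ⟨g', hg', hgt⟩ := exists_eq_pow_mul_eval_ne_zero hg t
  generalize f.rootMultiplicity t = a at hf'
  generalize g.rootMultiplicity t = b at hg'
  subst hf' hg'
  rw [show (X - C t) ^ a * f' * ((X - C t) ^ b * g') = (X - C t) ^ (a + b) * (f' * g') by ring,
    localSign_pow_mul hft, localSign_pow_mul hgt,
    localSign_pow_mul (by rw [eval_mul]; exact mul_ne_zero hft hgt), eval_mul, sign_mul]

theorem cauchyIndex_C_mul {c : R} (hc : 0 < c) (q p : R[X]) :
    cauchyIndex (C c * q) p = cauchyIndex q p := by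
  refine Finset.sum_congr rfl fun t _ => ?_
  have h1 : (C c * q).rootMultiplicity t = q.rootMultiplicity t := by
    by_cases hq : q = 0
    · simp [hq]
    rw [rootMultiplicity_mul (mul_ne_zero (by simpa using hc.ne') hq), rootMultiplicity_C, zero_add]
  have h2 : localSign (C c * q) t = localSign q t := by
    rw [localSign_mul, localSign_of_eval_ne_zero (by simpa using hc.ne'), eval_C, sign_pos hc,
      one_mul]
  rw [localIndex, localIndex, h1, h2]

/-- The reciprocity law: the poles of odd order of `q / p` and of `p / q` are together the sign
changes of `p q`. -/
theorem cauchyIndex_add_cauchyIndex {p q : R[X]} (hp : p ≠ 0) (hq : q ≠ 0) :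
    cauchyIndex q p + cauchyIndex p q = totalJump (p * q) := by
  have hpq : p * q ≠ 0 := mul_ne_zero hp hq
  have h1 : cauchyIndex q p = ∑ t ∈ (p * q).roots.toFinset, localIndex q p t := by
    refine Finset.sum_subset (fun t ht => ?_) fun t _ ht => ?_
    · simp_all
    · have : p.rootMultiplicity t = 0 := rootMultiplicity_eq_zero (by simpa [hp] using ht)
      simp [localIndex, this]
  have h2 : cauchyIndex p q = ∑ t ∈ (p * q).roots.toFinset, localIndex p q t := by
    refine Finset.sum_subset (fun t ht => ?_) fun t _ ht => ?_
    · simp_all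
    · have : q.rootMultiplicity t = 0 := rootMultiplicity_eq_zero (by simpa [hq] using ht)
      simp [localIndex, this]
  rw [h1, h2, ← Finset.sum_add_distrib, totalJump]
  refine Finset.sum_congr rfl fun t _ => ?_
  rw [localIndex, localIndex, rootMultiplicity_mul hpq, localSign_mul,
    add_comm (q.rootMultiplicity t), mul_comm (localSign q t)]
  rcases lt_trichotomy (p.rootMultiplicity t) (q.rootMultiplicity t) with h | h | h
  · simp [h, h.not_gt]
  · simp [h]
  · simp [h, h.not_gt]

/-- The derivative of `p` divided by `p` jumps from `-∞` to `+∞` at each root of `p`, so weighting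
it by `r` counts the roots of `p` with the signs of `r`. -/
theorem cauchyIndex_derivative_mul {p : R[X]} (hp : p ≠ 0) (r : R[X]) :
    cauchyIndex (derivative p * r) p =
      ∑ t ∈ p.roots.toFinset, ((SignType.sign (r.eval t) : SignType) : ℤ) := by
  refine Finset.sum_congr rfl fun t ht => ?_
  have hroot : p.IsRoot t := by simpa [hp] using ht
  obtain ⟨p', hp', hpt⟩ := exists_eq_pow_mul_eval_ne_zero hp t
  have hpos : 0 < p.rootMultiplicity t := (rootMultiplicity_pos hp).mpr hroot
  obtain ⟨m, hm⟩ : ∃ m, p.rootMultiplicity t = m + 1 := ⟨_, (Nat.succ_pred_eq_of_pos hpos).symm⟩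
  have hder : derivative p =
      (X - C t) ^ m * (C ((m : R) + 1) * p' + (X - C t) * derivative p') := by
    conv_lhs => rw [hp', hm]
    rw [derivative_mul, derivative_X_sub_C_pow]
    push_cast
    simp only [map_add, map_natCast, map_one]
    ring
  have hm0 : (0 : R) < (m : R) + 1 := by positivity
  have hev : (C ((m : R) + 1) * p' + (X - C t) * derivative p').eval t ≠ 0 := by
    simpa using mul_ne_zero hm0.ne' hpt
  have hd0 : derivative p ≠ 0 := by
    rw [hder]
    refine mul_ne_zero (pow_ne_zero _ (X_sub_C_ne_zero t)) ?_
    rintro h; rw [h] at hev; simp at hev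
  have hmd : (derivative p).rootMultiplicity t = m := by
    rw [hder, rootMultiplicity_pow_mul hev]
  have hsp : localSign p t = SignType.sign (p'.eval t) := by
    conv_lhs => rw [hp']
    rw [localSign_pow_mul hpt]
  have hsd : localSign (derivative p) t = SignType.sign (p'.eval t) := by
    rw [hder, localSign_pow_mul hev]
    simp [sign_mul, sign_pos hm0]
  have hss : localSign p t * localSign (derivative p) t = 1 := by
    rw [hsp, hsd, ← sign_mul, sign_pos (mul_self_pos.mpr hpt)]
  by_cases hr : r = 0
  · simp [hr, localIndex]
  rw [localIndex, rootMultiplicity_mul (mul_ne_zero hd0 hr), hm, hmd, localSign_mul, ← mul_assoc,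
    hss, one_mul]
  by_cases hrt : r.eval t = 0
  · have : 0 < r.rootMultiplicity t := (rootMultiplicity_pos hr).mpr hrt
    rw [if_neg (by omega), hrt]
    simp
  · rw [rootMultiplicity_eq_zero hrt, localSign_of_eval_ne_zero hrt, if_pos]
    exact ⟨by omega, ⟨m, by ring⟩⟩

variable [IsRealClosed R]

/-- The sign changes of `f` telescope to the difference of its signs at the two infinities. -/
theorem totalJump_eq {f : R[X]} (hf : f ≠ 0) :
    totalJump f =
      if Odd f.natDegree then ((SignType.sign f.leadingCoeff : SignType) : ℤ) else 0 := by
  induction hn : f.natDegree using Nat.strong_induction_on generalizing f with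
  | _ n ih =>
    by_cases hroot : ∃ x, f.IsRoot x
    swap
    · have h1 := even_natDegree_of_forall_not_isRoot (not_exists.mp hroot)
      have h2 : f.roots.toFinset = ∅ := by
        ext x; simpa [hf] using not_exists.mp hroot x
      rw [totalJump, h2, Finset.sum_empty, if_neg]
      rw [← hn]; exact Nat.not_odd_iff_even.mpr h1
    obtain ⟨x, hx⟩ := hroot
    -- remove a linear factor belonging to the largest root
    have hne : f.roots.toFinset.Nonempty := ⟨x, by simpa [hf] using hx⟩
    obtain ⟨c, hc, hmax⟩ := f.roots.toFinset.exists_max_image id hne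
    have hcroot : f.IsRoot c := by simpa [hf] using hc
    obtain ⟨g, rfl⟩ := dvd_iff_isRoot.mpr hcroot
    have hg : g ≠ 0 := right_ne_zero_of_mul hf
    have hdeg : ((X - C c) * g).natDegree = g.natDegree + 1 := by
      rw [natDegree_mul (X_sub_C_ne_zero c) hg, natDegree_X_sub_C, add_comm]
    have hIH := ih g.natDegree (by omega) hg rfl
    set T := ((X - C c) * g).roots.toFinset with hT
    have hgT : totalJump g =
        ∑ t ∈ T, if Odd (g.rootMultiplicity t) then (localSign g t : ℤ) else 0 := by
      refine Finset.sum_subset (fun t ht => ?_) fun t _ ht => ?_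
      · simp_all
      · have : g.rootMultiplicity t = 0 := rootMultiplicity_eq_zero (by simpa [hg] using ht)
        simp [this]
    have hlc : localSign g c = SignType.sign g.leadingCoeff := by
      obtain ⟨g', hg', hgc⟩ := exists_eq_pow_mul_eval_ne_zero hg c
      generalize g.rootMultiplicity c = m at hg'
      have hg'0 : g' ≠ 0 := by rintro rfl; simp at hgc
      have h1 : g.leadingCoeff = g'.leadingCoeff := by
        rw [hg', leadingCoeff_mul, ((monic_X_sub_C c).pow m).leadingCoeff, one_mul]
      rw [h1, hg', localSign_pow_mul hgc]
      refine sign_eval_eq_sign_leadingCoeff_of_forall_le g' hg'0 fun x hcx hx => ?_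
      have hxT : x ∈ T := by
        rw [hT, Multiset.mem_toFinset, mem_roots hf, hg']
        simp [hx.eq_zero]
      have := hmax x hxT
      have hxc : x = c := le_antisymm this hcx
      exact hgc (hxc ▸ hx)
    have key : totalJump ((X - C c) * g) + totalJump g = SignType.sign g.leadingCoeff := by
      rw [hgT, totalJump, ← hT, ← Finset.sum_add_distrib, ← Finset.add_sum_erase T _ hc,
        Finset.sum_eq_zero, add_zero]
      · rw [rootMultiplicity_mul hf, rootMultiplicity_X_sub_C_self, localSign_mul]
        have h1 : localSign (X - C c) c = 1 := by
          have := localSign_pow_mul (g := (1 : R[X])) (t := c) (by simp) 1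
          simpa using this
        rw [h1, one_mul, hlc]
        rcases Nat.even_or_odd (g.rootMultiplicity c) with h | h
        · simp [Nat.not_odd_iff_even.mpr h, h.one_add]
        · simp [h, Nat.not_odd_iff_even.mpr h.one_add]
      · intro t ht
        have htc : t < c := lt_of_le_of_ne (hmax t (Finset.mem_of_mem_erase ht))
          (Finset.ne_of_mem_erase ht)
        have h0 : (X - C c).eval t ≠ 0 := by simpa using sub_ne_zero.mpr htc.ne
        rw [rootMultiplicity_mul hf, rootMultiplicity_eq_zero (p := X - C c) h0, localSign_mul,
          zero_add, localSign_of_eval_ne_zero h0]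
        have : SignType.sign ((X - C c).eval t) = -1 := by
          simpa using sign_neg (sub_neg.mpr htc)
        rw [this]
        split_ifs
        · simp
        · rfl
    rw [leadingCoeff_mul, leadingCoeff_X_sub_C, one_mul]
    rw [hIH] at key
    rw [← hn, hdeg]
    rcases Nat.even_or_odd g.natDegree with h | h
    · rw [if_neg (Nat.not_odd_iff_even.mpr h)] at key
      rw [if_pos h.add_one]
      linarith
    · rw [if_pos h] at key
      rw [if_neg (Nat.not_odd_iff_even.mpr h.add_one)]
      linarith

end CauchyIndex

end GeomCAD

namespace GeomCAD

open Polynomial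

/-! ### Semi-algebraicity of root counts -/

section Parameters

variable {R : Type*} [Field R] {ι : Type*}

/-- The specialization at `x` of a polynomial whose coefficients are polynomials. -/
noncomputable abbrev specialize (p : (MvPolynomial ι R)[X]) (x : ι → R) : R[X] :=
  p.map (MvPolynomial.eval x)

theorem specialize_eraseLead {p : (MvPolynomial ι R)[X]} {x : ι → R}
    (h : MvPolynomial.eval x p.leadingCoeff = 0) :
    specialize p.eraseLead x = specialize p x := by
  conv_rhs => rw [specialize, ← eraseLead_add_monomial_natDegree_leadingCoeff p]
  rw [Polynomial.map_add, map_monomial, h, monomial_zero_right, add_zero]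

theorem leadingCoeff_specialize {p : (MvPolynomial ι R)[X]} {x : ι → R}
    (h : MvPolynomial.eval x p.leadingCoeff ≠ 0) :
    (specialize p x).leadingCoeff = MvPolynomial.eval x p.leadingCoeff :=
  leadingCoeff_map_of_leadingCoeff_ne_zero _ h

theorem natDegree_specialize {p : (MvPolynomial ι R)[X]} {x : ι → R}
    (h : MvPolynomial.eval x p.leadingCoeff ≠ 0) :
    (specialize p x).natDegree = p.natDegree :=
  natDegree_map_of_leadingCoeff_ne_zero _ h

/-- One step of the Euclidean algorithm, with denominators cleared by the positive factor
`lc(p) ^ 2`. -/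
noncomputable def euclidStep (q p : (MvPolynomial ι R)[X]) : (MvPolynomial ι R)[X] :=
  C (p.leadingCoeff ^ 2) * q -
    p * (C (p.leadingCoeff * q.leadingCoeff) * X ^ (q.natDegree - p.natDegree))

theorem degree_euclidStep_lt {q p : (MvPolynomial ι R)[X]} (hq : q ≠ 0) (hp : p ≠ 0)
    (h : p.natDegree ≤ q.natDegree) : (euclidStep q p).degree < q.degree := by
  have hp' := leadingCoeff_ne_zero.mpr hp
  have hq' := leadingCoeff_ne_zero.mpr hq
  have h1 : (C (p.leadingCoeff ^ 2) * q).degree = q.degree :=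
    degree_C_mul (pow_ne_zero 2 hp')
  have h2 : (p * (C (p.leadingCoeff * q.leadingCoeff) *
      X ^ (q.natDegree - p.natDegree))).degree = q.degree := by
    rw [degree_mul, degree_C_mul_X_pow _ (mul_ne_zero hp' hq'), degree_eq_natDegree hp,
      degree_eq_natDegree hq, ← Nat.cast_add, Nat.add_sub_cancel' h]
  rw [euclidStep, ← h1]
  refine degree_sub_lt_left (h1.trans h2.symm) (mul_ne_zero (by simpa using hp) hq) ?_
  simp only [leadingCoeff_mul, leadingCoeff_C, leadingCoeff_X_pow]
  ring

variable [LinearOrder R] [IsStrictOrderedRing R]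

theorem cauchyIndex_specialize_euclidStep {q p : (MvPolynomial ι R)[X]} {x : ι → R}
    (h : MvPolynomial.eval x p.leadingCoeff ≠ 0) :
    cauchyIndex (specialize (euclidStep q p) x) (specialize p x) =
      cauchyIndex (specialize q x) (specialize p x) := by
  have h1 : specialize (euclidStep q p) x =
      C ((MvPolynomial.eval x p.leadingCoeff) ^ 2) * specialize q x + specialize p x *
        -(C (MvPolynomial.eval x (p.leadingCoeff * q.leadingCoeff)) *
          X ^ (q.natDegree - p.natDegree)) := by
    simp only [specialize, euclidStep, Polynomial.map_sub, Polynomial.map_mul, map_C,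
      Polynomial.map_pow, map_X, map_pow]
    ring
  rw [h1, cauchyIndex_add_mul, cauchyIndex_C_mul (by positivity)]

variable [IsRealClosed R]

/-- The Cauchy index of a family of rational functions is a semi-algebraic function of the
parameters: the Euclidean algorithm, together with the reciprocity law, computes it from the signs
of finitely many polynomials in the parameters. -/
theorem isSemialgebraic_setOf_cauchyIndex_eq (q p : (MvPolynomial ι R)[X]) (k : ℤ) :
    IsSemialgebraic {x : ι → R | cauchyIndex (specialize q x) (specialize p x) = k} := by
  classical
  set size : (MvPolynomial ι R)[X] → ℕ := fun p => if p = 0 then 0 else p.natDegree + 1 with hsize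
  have size_lt : ∀ f g : (MvPolynomial ι R)[X], f.degree < g.degree → size f < size g := by
    intro f g hfg
    have hg : g ≠ 0 := by rintro rfl; simp at hfg
    by_cases hf : f = 0
    · simp [hsize, hf, hg]
    · simpa [hsize, hf, hg] using natDegree_lt_natDegree hf hfg
  induction hn : size q + size p using Nat.strong_induction_on generalizing q p k with
  | _ n ih =>
    have hconst : ∀ {P : Prop}, IsSemialgebraic {_x : ι → R | P} := by
      intro P
      by_cases hP : P
      · simpa [hP] using isSemialgebraic_univ
      · simpa [hP] using isSemialgebraic_empty
    by_cases hp : p = 0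
    · simpa [hp, specialize, cauchyIndex] using hconst
    by_cases hq : q = 0
    · simpa [hq, specialize, cauchyIndex, localIndex] using hconst
    have hsplit : {x : ι → R | cauchyIndex (specialize q x) (specialize p x) = k} =
        ({x | MvPolynomial.eval x p.leadingCoeff = 0} ∩
          {x | cauchyIndex (specialize q x) (specialize p.eraseLead x) = k}) ∪
        ({x | MvPolynomial.eval x q.leadingCoeff = 0} ∩
          {x | cauchyIndex (specialize q.eraseLead x) (specialize p x) = k}) ∪
        ({x | MvPolynomial.eval x p.leadingCoeff ≠ 0} ∩
          {x | MvPolynomial.eval x q.leadingCoeff ≠ 0} ∩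
          {x | cauchyIndex (specialize q x) (specialize p x) = k}) := by
      ext x
      simp only [Set.mem_union, Set.mem_inter_iff, Set.mem_ofPred_eq]
      by_cases h1 : MvPolynomial.eval x p.leadingCoeff = 0 <;>
      by_cases h2 : MvPolynomial.eval x q.leadingCoeff = 0 <;>
      simp [h1, h2, specialize_eraseLead]
    rw [hsplit]
    refine (((isSemialgebraic_setOf_eval_eq_zero _).inter (ih _ ?_ _ _ _ rfl)).union
      ((isSemialgebraic_setOf_eval_eq_zero _).inter (ih _ ?_ _ _ _ rfl))).union ?_
    · have := size_lt _ _ (degree_eraseLead_lt hp)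
      omega
    · have := size_lt _ _ (degree_eraseLead_lt hq)
      omega
    rcases le_or_gt p.natDegree q.natDegree with hle | hlt
    · have h1 := size_lt _ _ (degree_euclidStep_lt hq hp hle)
      have h2 := ((isSemialgebraic_setOf_eval_ne_zero p.leadingCoeff).inter
        (isSemialgebraic_setOf_eval_ne_zero q.leadingCoeff)).inter
        (ih _ (by omega) (euclidStep q p) p k rfl)
      refine (congrArg IsSemialgebraic ?_).mp h2
      ext x
      simp only [Set.mem_inter_iff, Set.mem_ofPred_eq]
      refine and_congr_right fun hx => ?_
      rw [cauchyIndex_specialize_euclidStep hx.1]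
    · have h1 := size_lt _ _ (degree_euclidStep_lt hp hq hlt.le)
      -- the Cauchy index with numerator and denominator exchanged
      have hI : ∀ j, IsSemialgebraic
          {x : ι → R | cauchyIndex (specialize (euclidStep p q) x) (specialize q x) = j} :=
        fun j => ih _ (by omega) (euclidStep p q) q j rfl
      have hrec : ∀ x : ι → R, MvPolynomial.eval x p.leadingCoeff ≠ 0 →
          MvPolynomial.eval x q.leadingCoeff ≠ 0 →
          cauchyIndex (specialize q x) (specialize p x) =
            (if Odd (p.natDegree + q.natDegree) then
              ((SignType.sign (MvPolynomial.eval x (p.leadingCoeff * q.leadingCoeff)) :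
                SignType) : ℤ) else 0) -
            cauchyIndex (specialize (euclidStep p q) x) (specialize q x) := by
        intro x hpx hqx
        have hp0 : specialize p x ≠ 0 := by
          rw [← leadingCoeff_ne_zero, leadingCoeff_specialize hpx]; exact hpx
        have hq0 : specialize q x ≠ 0 := by
          rw [← leadingCoeff_ne_zero, leadingCoeff_specialize hqx]; exact hqx
        have := cauchyIndex_add_cauchyIndex hp0 hq0
        rw [totalJump_eq (mul_ne_zero hp0 hq0), natDegree_mul hp0 hq0, leadingCoeff_mul,
          leadingCoeff_specialize hpx, leadingCoeff_specialize hqx, natDegree_specialize hpx,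
          natDegree_specialize hqx, ← map_mul] at this
        rw [cauchyIndex_specialize_euclidStep hqx]
        linarith
      by_cases hodd : Odd (p.natDegree + q.natDegree)
      · have h2 := ((isSemialgebraic_setOf_eval_pos (p.leadingCoeff * q.leadingCoeff)).inter
            (hI (1 - k))).union
          ((isSemialgebraic_setOf_eval_neg (p.leadingCoeff * q.leadingCoeff)).inter
            (hI (-1 - k)))
        refine (congrArg IsSemialgebraic ?_).mp h2
        ext x
        simp only [Set.mem_union, Set.mem_inter_iff, Set.mem_ofPred_eq]
        constructor
        · rintro (⟨h3, h4⟩ | ⟨h3, h4⟩)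
          · have h5 := h3.ne'
            rw [map_mul] at h5
            refine ⟨⟨left_ne_zero_of_mul h5, right_ne_zero_of_mul h5⟩, ?_⟩
            rw [hrec x (left_ne_zero_of_mul h5) (right_ne_zero_of_mul h5), if_pos hodd,
              sign_pos h3, h4]
            simp
          · have h5 := h3.ne
            rw [map_mul] at h5
            refine ⟨⟨left_ne_zero_of_mul h5, right_ne_zero_of_mul h5⟩, ?_⟩
            rw [hrec x (left_ne_zero_of_mul h5) (right_ne_zero_of_mul h5), if_pos hodd,
              sign_neg h3, h4]
            simp
        · rintro ⟨⟨h3, h4⟩, h5⟩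
          rw [hrec x h3 h4, if_pos hodd] at h5
          have h6 : MvPolynomial.eval x (p.leadingCoeff * q.leadingCoeff) ≠ 0 := by
            rw [map_mul]; exact mul_ne_zero h3 h4
          rcases lt_or_gt_of_ne h6 with h7 | h7
          · rw [sign_neg h7] at h5
            right
            refine ⟨h7, ?_⟩
            simp at h5
            linarith
          · rw [sign_pos h7] at h5
            left
            refine ⟨h7, ?_⟩
            simp at h5
            linarith
      · have h2 := ((isSemialgebraic_setOf_eval_ne_zero p.leadingCoeff).inter
          (isSemialgebraic_setOf_eval_ne_zero q.leadingCoeff)).inter (hI (-k))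
        refine (congrArg IsSemialgebraic ?_).mp h2
        ext x
        simp only [Set.mem_inter_iff, Set.mem_ofPred_eq]
        refine and_congr_right fun hx => ?_
        rw [hrec x hx.1 hx.2, if_neg hodd]
        constructor <;> intro h <;> linarith

end Parameters

end GeomCAD

namespace GeomCAD

open Polynomial Filter Topology

/-! ### Continuity of the real roots of a family of separable polynomials -/

section ContinuityOfRoots

theorem sum_sign_sub_strictMonoOn {R : Type*} [Field R] [LinearOrder R] [IsStrictOrderedRing R]
    (T : Finset R) :
    StrictMonoOn (fun t => ∑ r ∈ T, ((SignType.sign (t - r) : SignType) : ℤ)) T := by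
  intro t ht t' ht' h
  have hmono : ∀ a b : SignType, a ≤ b → (a : ℤ) ≤ b := by decide
  refine Finset.sum_lt_sum (fun r _ => hmono _ _ (SignType.sign.monotone (by linarith)))
    ⟨t, ht, ?_⟩
  rw [sub_self, sign_zero, sign_pos (sub_pos.mpr h)]
  simp

/-- A function on a semi-algebraically connected set which is locally constant and has
semi-algebraic fibres is constant. -/
theorem IsSemialgebraicallyConnected.eq_of_eventually_eq {R : Type*} [Field R] [LinearOrder R]
    [IsStrictOrderedRing R] [TopologicalSpace R] {ι α : Type*} {s : Set (ι → R)}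
    (hconn : IsSemialgebraicallyConnected s) (hs : IsSemialgebraic s) {f : (ι → R) → α}
    (hf : ∀ k, IsSemialgebraic {a | a ∈ s ∧ f a = k})
    (hloc : ∀ a ∈ s, ∀ᶠ b in 𝓝[s] a, f b = f a) {a b : ι → R} (ha : a ∈ s) (hb : b ∈ s) :
    f b = f a := by
  have hopen : ∀ P : α → Prop, ∃ U, IsOpen U ∧ {c | c ∈ s ∧ P (f c)} = U ∩ s := by
    intro P
    refine ⟨interior {c | c ∈ s → P (f c)}, isOpen_interior, ?_⟩
    ext c
    constructor
    · rintro ⟨hc, hP⟩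
      refine ⟨mem_interior_iff_mem_nhds.mpr ?_, hc⟩
      filter_upwards [eventually_nhdsWithin_iff.mp (hloc c hc)] with d hd hds
      rw [hd hds]
      exact hP
    · rintro ⟨h1, hc⟩
      exact ⟨hc, interior_subset h1 hc⟩
  have h2 : IsSemialgebraic {c | c ∈ s ∧ f c ≠ f a} := by
    refine (congrArg IsSemialgebraic ?_).mp (hs.inter (hf (f a)).compl)
    ext c
    simp only [Set.mem_inter_iff, Set.mem_compl_iff, Set.mem_ofPred_eq]
    tauto
  have h3 := hconn.eq_of_isClopen (hf (f a)) h2 (hopen (· = f a)) (hopen (· ≠ f a))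
    (Set.disjoint_left.mpr fun c h1 h2 => h2.2 h1.2)
    (by ext c; simp only [Set.mem_union, Set.mem_ofPred_eq]; tauto) ⟨a, ha, rfl⟩
  rw [← h3] at hb
  exact hb.2

/-- A polynomial over a real closed field is bounded away from zero away from its roots. -/
theorem exists_pos_le_abs_eval {R : Type*} [Field R] [LinearOrder R] [IsStrictOrderedRing R]
    [IsRealClosed R] {p : R[X]} (hp : p ≠ 0) {ε : R} (hε : 0 < ε) :
    ∃ η > 0, ∀ t, (∀ r, p.IsRoot r → ε ≤ |t - r|) → η ≤ |p.eval t| := by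
  refine induction_on_roots (P := fun p => ∃ η > 0, ∀ t, (∀ r, p.IsRoot r → ε ≤ |t - r|) →
    η ≤ |p.eval t|) ?_ ?_ p hp
  · intro p hp hroot
    obtain ⟨δ, hδ, h⟩ := exists_pos_le_leadingCoeff_mul_eval p hp hroot
    have hl : 0 < |p.leadingCoeff| := abs_pos.mpr (leadingCoeff_ne_zero.mpr hp)
    refine ⟨δ / |p.leadingCoeff|, by positivity, fun t _ => ?_⟩
    rw [div_le_iff₀' hl, ← abs_mul]
    exact (h t).trans (le_abs_self _)
  · rintro r q hq ⟨η, hη, h⟩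
    refine ⟨ε * η, by positivity, fun t ht => ?_⟩
    rw [eval_mul, abs_mul]
    have h1 := ht r (by simp)
    have h2 := h t fun r' hr' => ht r' (by simp [hr'.eq_zero])
    have h3 : (X - C r).eval t = t - r := by simp
    rw [h3]
    gcongr

theorem eval_specialize_eq_sum {R ι : Type*} [Field R] {p : (MvPolynomial ι R)[X]} {N : ℕ}
    (hN : p.natDegree ≤ N)
    (a : ι → R) (t : R) :
    (specialize p a).eval t =
      ∑ j ∈ Finset.range (N + 1), MvPolynomial.eval a (p.coeff j) * t ^ j := by
  rw [eval_eq_sum_range' (n := N + 1) (Nat.lt_succ_of_le (natDegree_map_le.trans hN))]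
  simp [coeff_map]

variable {R : Type*} [Field R] [LinearOrder R] [IsStrictOrderedRing R]
  [TopologicalSpace R] [OrderTopology R] {ι : Type*}

theorem continuous_eval_specialize (p : (MvPolynomial ι R)[X]) :
    Continuous fun z : (ι → R) × R => (specialize p z.1).eval z.2 := by
  simp only [eval_specialize_eq_sum le_rfl]
  refine continuous_finsetSum _ fun j _ => ?_
  exact ((MvPolynomial.continuous_eval _).comp continuous_fst).mul (continuous_snd.pow j)

/-- Near a simple root there is at most one root of a small perturbation: the divided difference
does not vanish there. -/
theorem exists_pos_eventually_isRoot_unique {p : (MvPolynomial ι R)[X]} {a₀ : ι → R}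
    (hsep : (specialize p a₀).Separable) {r : R} (hr : (specialize p a₀).IsRoot r) :
    ∃ ε > 0, ∀ᶠ a in 𝓝 a₀, ∀ t t', (specialize p a).IsRoot t → (specialize p a).IsRoot t' →
      |t - r| < ε → |t' - r| < ε → t = t' := by
  set N := p.natDegree
  let H : (ι → R) × (R × R) → R := fun z => ∑ j ∈ Finset.range (N + 1),
    MvPolynomial.eval z.1 (p.coeff j) * ∑ i ∈ Finset.range j, z.2.1 ^ i * z.2.2 ^ (j - 1 - i)
  have hH : ∀ a t t', (specialize p a).eval t - (specialize p a).eval t' =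
      H (a, (t, t')) * (t - t') := by
    intro a t t'
    rw [eval_specialize_eq_sum le_rfl, eval_specialize_eq_sum le_rfl, ← Finset.sum_sub_distrib,
      Finset.sum_mul]
    refine Finset.sum_congr rfl fun j _ => ?_
    rw [mul_assoc, geom_sum₂_mul]
    ring
  have hHc : Continuous H := by
    refine continuous_finsetSum _ fun j _ =>
      ((MvPolynomial.continuous_eval _).comp continuous_fst).mul
        (continuous_finsetSum _ fun i _ => ?_)
    exact ((continuous_fst.comp continuous_snd).pow i).mul
      ((continuous_snd.comp continuous_snd).pow _)
  have hH0 : H (a₀, (r, r)) ≠ 0 := by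
    have h1 := hsep.eval₂_derivative_ne_zero (RingHom.id R) (x := r) (by simpa using hr)
    have h2 : (derivative (specialize p a₀)).eval r = H (a₀, (r, r)) := by
      rw [derivative_eval, sum_over_range' _ _ (N + 1) (Nat.lt_succ_of_le natDegree_map_le)]
      · refine Finset.sum_congr rfl fun j _ => ?_
        simp only [coeff_map, geom_sum₂_self]
        ring
      · simp
    rwa [← h2]
  have hev : ∀ᶠ z in 𝓝 (a₀, (r, r)), H z ≠ 0 := hHc.continuousAt.eventually_ne hH0
  rw [nhds_prod_eq, nhds_prod_eq] at hev
  obtain ⟨P, hP, Q, hQ, hPQ⟩ := eventually_prod_iff.mp hev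
  obtain ⟨Q₁, hQ₁, Q₂, hQ₂, hQQ⟩ := eventually_prod_iff.mp hQ
  obtain ⟨ε, hε, h1⟩ := (nhds_basis_abs_sub_lt r).eventually_iff.mp (hQ₁.and hQ₂)
  refine ⟨ε, hε, ?_⟩
  filter_upwards [hP] with a ha t t' ht ht' hd hd'
  have h2 := hPQ ha (hQQ (h1 hd).1 (h1 hd').2)
  have h3 := hH a t t'
  rw [ht.eq_zero, ht'.eq_zero, sub_zero] at h3
  exact sub_eq_zero.mp ((mul_eq_zero.mp h3.symm).resolve_left h2)

/-- As long as the leading coefficient does not vanish, the roots stay bounded. -/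
theorem exists_eventually_abs_le_of_isRoot {p : (MvPolynomial ι R)[X]} {N : ℕ}
    (hN : p.natDegree ≤ N) {a₀ : ι → R} (hlead : MvPolynomial.eval a₀ (p.coeff N) ≠ 0) :
    ∃ M : R, 0 ≤ M ∧ ∀ᶠ a in 𝓝 a₀, ∀ t, (specialize p a).IsRoot t → |t| ≤ M := by
  set c : ℕ → (ι → R) → R := fun j a => MvPolynomial.eval a (p.coeff j) with hc
  have hcc : ∀ j, Continuous (c j) := fun j => MvPolynomial.continuous_eval _
  set l := |c N a₀| / 2 with hl
  have hl0 : 0 < l := half_pos (abs_pos.mpr hlead)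
  set L := ∑ j ∈ Finset.range N, (|c j a₀| + 1) with hL
  have hL0 : 0 ≤ L := Finset.sum_nonneg fun j _ => by positivity
  have hev1 : ∀ᶠ a in 𝓝 a₀, l < |c N a| :=
    (hcc N).abs.continuousAt.eventually (lt_mem_nhds (half_lt_self (abs_pos.mpr hlead)))
  have hev2 : ∀ᶠ a in 𝓝 a₀, ∀ j ∈ Finset.range N, |c j a| < |c j a₀| + 1 :=
    (Finset.eventually_all _).mpr fun j _ =>
      (hcc j).abs.continuousAt.eventually (gt_mem_nhds (lt_add_one _))
  refine ⟨max 1 (L / l), by positivity, ?_⟩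
  filter_upwards [hev1, hev2] with a h1 h2 t ht
  by_contra! hcon
  have ht1 : 1 < |t| := (le_max_left _ _).trans_lt hcon
  have ht2 : L < l * |t| := by
    have := (le_max_right _ _).trans_lt hcon
    rwa [div_lt_iff₀' hl0] at this
  have hsum := ht.eq_zero
  rw [eval_specialize_eq_sum hN, Finset.sum_range_succ] at hsum
  rcases N with _ | N
  · simp at hsum
    simp [hc, hsum] at h1
    linarith
  have h3 : |c (N + 1) a * t ^ (N + 1)| ≤ L * |t| ^ N := by
    rw [show c (N + 1) a * t ^ (N + 1) = -∑ j ∈ Finset.range (N + 1), c j a * t ^ j from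
      eq_neg_of_add_eq_zero_right hsum, abs_neg, hL, Finset.sum_mul]
    refine (Finset.abs_sum_le_sum_abs _ _).trans (Finset.sum_le_sum fun j hj => ?_)
    rw [abs_mul, abs_pow]
    exact mul_le_mul (h2 j hj).le
      (pow_le_pow_right₀ ht1.le (Nat.lt_succ_iff.mp (Finset.mem_range.mp hj)))
      (by positivity) (by positivity)
  rw [abs_mul, abs_pow, pow_succ] at h3
  have h4 : 0 < |t| ^ N := by positivity
  have h5 : |c (N + 1) a| * |t| ≤ L := by
    by_contra! h6
    nlinarith
  nlinarith

variable [IsRealClosed R]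

/-- A simple root persists under small perturbations: the polynomial changes sign there. -/
theorem eventually_exists_isRoot_abs_sub_lt {p : (MvPolynomial ι R)[X]} {a₀ : ι → R}
    (hsep : (specialize p a₀).Separable) {r : R} (hr : (specialize p a₀).IsRoot r) {ε : R}
    (hε : 0 < ε) : ∀ᶠ a in 𝓝 a₀, ∃ t, (specialize p a).IsRoot t ∧ |t - r| < ε := by
  obtain ⟨q, hq⟩ := dvd_iff_isRoot.mpr hr
  have hqr : q.eval r ≠ 0 := by
    intro h
    have h1 := hsep.eval₂_derivative_ne_zero (RingHom.id R) (x := r) (by simpa using hr)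
    rw [hq] at h1
    simp [h] at h1
  -- the cofactor `q` has constant sign near `r`
  have hcont : ∀ᶠ t in 𝓝 r, 0 < q.eval t * q.eval r := by
    have h1 : Continuous fun t => q.eval t * q.eval r := q.continuous.mul continuous_const
    exact h1.continuousAt.eventually (lt_mem_nhds (mul_self_pos.mpr hqr))
  obtain ⟨ε', hε', h1⟩ := (nhds_basis_abs_sub_lt r).eventually_iff.mp hcont
  obtain ⟨d, hd, hdε⟩ : ∃ d : R, 0 < d ∧ d < ε ∧ d < ε' :=
    ⟨min ε ε' / 2, by positivity,
      (half_lt_self (by positivity)).trans_le (min_le_left _ _),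
      (half_lt_self (by positivity)).trans_le (min_le_right _ _)⟩
  have h2 := h1 (x := r - d) (by simpa [abs_of_pos hd] using hdε.2)
  have h3 := h1 (x := r + d) (by simpa [abs_of_pos hd] using hdε.2)
  have h4 : (specialize p a₀).eval (r - d) * (specialize p a₀).eval (r + d) < 0 := by
    rw [hq]
    simp only [eval_mul, eval_sub, eval_X, eval_C]
    have h5 : 0 < q.eval (r - d) * q.eval (r + d) := by
      have h6 := mul_pos h2 h3
      have h7 : 0 < (q.eval r) ^ 2 := by positivity
      by_contra! h8
      nlinarith
    have h6 : (r - d - r) * q.eval (r - d) * ((r + d - r) * q.eval (r + d)) =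
        -(d ^ 2 * (q.eval (r - d) * q.eval (r + d))) := by ring
    rw [h6]
    have : 0 < d ^ 2 * (q.eval (r - d) * q.eval (r + d)) := by positivity
    linarith
  have hc : Continuous fun a => (specialize p a).eval (r - d) * (specialize p a).eval (r + d) :=
    ((continuous_eval_specialize p).comp (continuous_id.prodMk continuous_const)).mul
      ((continuous_eval_specialize p).comp (continuous_id.prodMk continuous_const))
  filter_upwards [hc.continuousAt.eventually (gt_mem_nhds h4)] with a ha
  obtain ⟨t, ht, hroot⟩ := exists_isRoot_mem_Ioo _ (by linarith) ha
  exact ⟨t, hroot, abs_lt.mpr ⟨by linarith [ht.1], by linarith [ht.2]⟩⟩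

/-- No roots appear away from the old ones. -/
theorem eventually_forall_isRoot_exists_abs_sub_lt {p : (MvPolynomial ι R)[X]} {N : ℕ}
    (hN : p.natDegree ≤ N) {a₀ : ι → R} (hlead : MvPolynomial.eval a₀ (p.coeff N) ≠ 0) {ε : R}
    (hε : 0 < ε) :
    ∀ᶠ a in 𝓝 a₀, ∀ t, (specialize p a).IsRoot t →
      ∃ r, (specialize p a₀).IsRoot r ∧ |t - r| < ε := by
  have hp : specialize p a₀ ≠ 0 := by
    intro h
    have := congrArg (coeff · N) h
    simp [coeff_map] at this
    exact hlead this
  obtain ⟨η, hη, h1⟩ := exists_pos_le_abs_eval hp hε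
  obtain ⟨M, hM, h2⟩ := exists_eventually_abs_le_of_isRoot hN hlead
  have hc : Continuous fun a => ∑ j ∈ Finset.range (N + 1),
      |MvPolynomial.eval a₀ (p.coeff j) - MvPolynomial.eval a (p.coeff j)| * M ^ j :=
    continuous_finsetSum _ fun j _ =>
      ((continuous_const.sub (MvPolynomial.continuous_eval _)).abs).mul continuous_const
  have h3 : ∀ᶠ a in 𝓝 a₀, ∑ j ∈ Finset.range (N + 1),
      |MvPolynomial.eval a₀ (p.coeff j) - MvPolynomial.eval a (p.coeff j)| * M ^ j < η :=
    hc.continuousAt.eventually (gt_mem_nhds (by simpa using hη))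
  filter_upwards [h2, h3] with a h4 h5 t ht
  by_contra! hcon
  have h6 := h1 t hcon
  have h7 : |(specialize p a₀).eval t| ≤ ∑ j ∈ Finset.range (N + 1),
      |MvPolynomial.eval a₀ (p.coeff j) - MvPolynomial.eval a (p.coeff j)| * M ^ j := by
    rw [← sub_zero ((specialize p a₀).eval t), ← ht.eq_zero, eval_specialize_eq_sum hN,
      eval_specialize_eq_sum hN, ← Finset.sum_sub_distrib]
    refine (Finset.abs_sum_le_sum_abs _ _).trans (Finset.sum_le_sum fun j _ => ?_)
    rw [← sub_mul, abs_mul, abs_pow]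
    gcongr
    exact h4 t ht
  linarith

/-- The real roots of a separable polynomial move continuously, keeping their number and order,
as long as the leading coefficient does not vanish. -/
theorem eventually_exists_strictMonoOn_roots {p : (MvPolynomial ι R)[X]} {N : ℕ}
    (hN : p.natDegree ≤ N) {a₀ : ι → R} (hlead : MvPolynomial.eval a₀ (p.coeff N) ≠ 0)
    (hsep : (specialize p a₀).Separable) {ε : R} (hε : 0 < ε) :
    ∀ᶠ a in 𝓝 a₀, ∃ f : R → R, StrictMonoOn f (specialize p a₀).roots.toFinset ∧
      (specialize p a₀).roots.toFinset.image f = (specialize p a).roots.toFinset ∧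
      ∀ r ∈ (specialize p a₀).roots.toFinset, |f r - r| < ε := by
  have hp : specialize p a₀ ≠ 0 := hsep.ne_zero
  set T := (specialize p a₀).roots.toFinset with hT
  have hTr : ∀ r, r ∈ T ↔ (specialize p a₀).IsRoot r := fun r => by simp [hT, hp]
  -- a distance below which the roots do not interact
  obtain ⟨δ, hδ, hδε, hgap, huniq⟩ : ∃ δ > 0, δ ≤ ε ∧ (∀ r ∈ T, ∀ r' ∈ T, r < r' → 2 * δ ≤ r' - r) ∧
      ∀ r ∈ T, ∀ᶠ a in 𝓝 a₀, ∀ t t', (specialize p a).IsRoot t → (specialize p a).IsRoot t' →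
        |t - r| < δ → |t' - r| < δ → t = t' := by
    have h1 : ∀ᶠ δ in 𝓝[>] (0 : R), δ ≤ ε :=
      nhdsWithin_le_nhds ((gt_mem_nhds hε).mono fun δ h => le_of_lt h)
    have h2 : ∀ᶠ δ in 𝓝[>] (0 : R), ∀ r ∈ T, ∀ r' ∈ T, r < r' → 2 * δ ≤ r' - r := by
      refine (Finset.eventually_all _).mpr fun r _ => (Finset.eventually_all _).mpr fun r' _ => ?_
      by_cases hrr : r < r'
      · filter_upwards [nhdsWithin_le_nhds (gt_mem_nhds (half_pos (sub_pos.mpr hrr)))] with δ h _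
        have h : δ < (r' - r) / 2 := h
        linarith
      · exact Eventually.of_forall fun δ h => absurd h hrr
    have h3 : ∀ᶠ δ in 𝓝[>] (0 : R), ∀ r ∈ T, ∀ᶠ a in 𝓝 a₀, ∀ t t',
        (specialize p a).IsRoot t → (specialize p a).IsRoot t' →
        |t - r| < δ → |t' - r| < δ → t = t' := by
      refine (Finset.eventually_all _).mpr fun r hr => ?_
      obtain ⟨ε', hε', h⟩ := exists_pos_eventually_isRoot_unique hsep ((hTr r).mp hr)
      filter_upwards [nhdsWithin_le_nhds (gt_mem_nhds hε')] with δ hδ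
      have hδ : δ < ε' := hδ
      filter_upwards [h] with a ha t t' h1 h2 h3 h4
      exact ha t t' h1 h2 (h3.trans hδ) (h4.trans hδ)
    obtain ⟨δ, ⟨⟨h4, h5⟩, h6⟩, h7⟩ := (((h1.and h2).and h3).and self_mem_nhdsWithin).exists
    exact ⟨δ, h7, h4, h5, h6⟩
  have hex : ∀ᶠ a in 𝓝 a₀, ∀ r ∈ T, ∃ t, (specialize p a).IsRoot t ∧ |t - r| < δ :=
    (Finset.eventually_all _).mpr fun r hr =>
      eventually_exists_isRoot_abs_sub_lt hsep ((hTr r).mp hr) hδ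
  have hne : ∀ᶠ a in 𝓝 a₀, MvPolynomial.eval a (p.coeff N) ≠ 0 :=
    (MvPolynomial.continuous_eval _).continuousAt.eventually_ne hlead
  filter_upwards [hex, (Finset.eventually_all _).mpr huniq, hne,
    eventually_forall_isRoot_exists_abs_sub_lt hN hlead hδ] with a h1 h2 h3 h4
  have hpa : specialize p a ≠ 0 := by
    intro h
    have := congrArg (coeff · N) h
    simp [coeff_map] at this
    exact h3 this
  choose! f hf hfd using h1
  refine ⟨f, ?_, ?_, fun r hr => (hfd r hr).trans_le hδε⟩
  · intro r hr r' hr' hlt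
    have h5 := abs_lt.mp (hfd r hr)
    have h6 := abs_lt.mp (hfd r' hr')
    have h7 := hgap r hr r' hr' hlt
    linarith [h5.2, h6.1]
  · ext t
    simp only [Finset.mem_image, Multiset.mem_toFinset, mem_roots hpa]
    constructor
    · rintro ⟨r, hr, rfl⟩
      exact hf r hr
    · intro ht
      obtain ⟨r, hr, hd⟩ := h4 t ht
      have hrT := (hTr r).mpr hr
      exact ⟨r, hrT, h2 r hrT _ _ (hf r hrT) ht (hfd r hrT) hd⟩

end ContinuityOfRoots

end GeomCAD

namespace GeomCAD

open Polynomial Filter Topology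

/-! ### Semi-algebraic sections given by the real roots of a family of separable polynomials -/

section RootSections

variable {R : Type*} [Field R] [LinearOrder R] [IsStrictOrderedRing R] [IsRealClosed R]
  {n : ℕ}

theorem cauchyIndex_derivative {F : Type*} [Field F] [LinearOrder F] [IsStrictOrderedRing F]
    {p : F[X]} (hp : p ≠ 0) :
    cauchyIndex (derivative p) p = (p.roots.toFinset.card : ℤ) := by
  have := cauchyIndex_derivative_mul hp 1
  simpa using this

/-- The graph of the function enumerating the `i`-th root is semi-algebraic: a root is the `i`-th
one if and only if the right number of roots lies to its left, and this number is given by a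
Cauchy index. -/
theorem isSemialgebraicOn_snoc_root {p : (MvPolynomial (Fin n) R)[X]} {s : Set (Fin n → R)}
    (hs : IsSemialgebraic s) (hne : ∀ a ∈ s, specialize p a ≠ 0) {k : ℕ}
    {ξ : Fin k → (Fin n → R) → R} (hmono : ∀ a ∈ s, StrictMono fun i => ξ i a)
    (hroot : ∀ a ∈ s, ∀ t, (specialize p a).IsRoot t ↔ ∃ i, t = ξ i a) (i : Fin k) :
    IsSemialgebraicOn (fun a => Fin.snoc (α := fun _ => R) a (ξ i a)) s := by
  classical
  let P : (MvPolynomial (Fin n ⊕ Fin (n + 1)) R)[X] :=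
    p.map (MvPolynomial.rename (R := R) (Sum.inl : Fin n → Fin n ⊕ Fin (n + 1))).toRingHom
  let T : MvPolynomial (Fin n ⊕ Fin (n + 1)) R := MvPolynomial.X (Sum.inr (Fin.last n))
  have hP : ∀ z, specialize P z = specialize p (z ∘ Sum.inl) := by
    intro z
    rw [specialize, specialize, Polynomial.map_map]
    congr 1
    ext j
    · simp
    · simp
  set m : ℤ := ∑ j : Fin k, ((SignType.sign ((i : ℤ) - (j : ℤ)) : SignType) : ℤ) with hm
  have hroots : ∀ a ∈ s, (specialize p a).roots.toFinset = Finset.univ.image fun j => ξ j a := by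
    intro a ha
    ext t
    rw [Multiset.mem_toFinset, mem_roots (hne a ha), hroot a ha]
    simp [eq_comm]
  have hindex : ∀ a ∈ s, ∑ r ∈ (specialize p a).roots.toFinset,
      ((SignType.sign (ξ i a - r) : SignType) : ℤ) = m := by
    intro a ha
    rw [hroots a ha, Finset.sum_image fun j _ j' _ h => (hmono a ha).injective h, hm]
    refine Finset.sum_congr rfl fun j _ => ?_
    congr 1
    rcases lt_trichotomy i j with h | h | h
    · have h1 : ξ i a < ξ j a := hmono a ha h
      have h2 : ((i : ℕ) : ℤ) < ((j : ℕ) : ℤ) := by exact_mod_cast h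
      rw [sign_neg (sub_neg.mpr h1), sign_neg (sub_neg.mpr h2)]
    · simp [h]
    · have h1 : ξ j a < ξ i a := hmono a ha h
      have h2 : ((j : ℕ) : ℤ) < ((i : ℕ) : ℤ) := by exact_mod_cast h
      rw [sign_pos (sub_pos.mpr h1), sign_pos (sub_pos.mpr h2)]
  have hset : {z : Fin n ⊕ Fin (n + 1) → R | z ∘ Sum.inl ∈ s ∧
        z ∘ Sum.inr = Fin.snoc (α := fun _ => R) (z ∘ Sum.inl) (ξ i (z ∘ Sum.inl))} =
      {z | (fun j => MvPolynomial.eval z (MvPolynomial.X (Sum.inl j))) ∈ s} ∩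
      ((⋂ j ∈ (Finset.univ : Finset (Fin n)), {z | MvPolynomial.eval z
        (MvPolynomial.X (Sum.inr j.castSucc) - MvPolynomial.X (Sum.inl j)) = 0}) ∩
      ({z | MvPolynomial.eval z (P.eval T) = 0} ∩
        {z | cauchyIndex (specialize (derivative P * (C T - X)) z) (specialize P z) = m})) := by
    ext z
    have h1 : (fun j => MvPolynomial.eval z (MvPolynomial.X (R := R) (Sum.inl j))) =
        z ∘ (Sum.inl : Fin n → Fin n ⊕ Fin (n + 1)) := by
      funext j; simp
    simp only [Set.mem_inter_iff, Set.mem_ofPred_eq, Set.mem_iInter, h1]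
    refine and_congr_right fun hz => ?_
    have h2 : MvPolynomial.eval z (P.eval T) =
        (specialize p (z ∘ Sum.inl)).eval (z (Sum.inr (Fin.last n))) := by
      rw [← hP, specialize, ← eval₂_hom, eval_map]
      simp [T]
    have h3 : cauchyIndex (specialize (derivative P * (C T - X)) z) (specialize P z) =
        ∑ r ∈ (specialize p (z ∘ Sum.inl)).roots.toFinset,
          ((SignType.sign (z (Sum.inr (Fin.last n)) - r) : SignType) : ℤ) := by
      have h4 : specialize (derivative P * (C T - X)) z =
          derivative (specialize P z) * (C (z (Sum.inr (Fin.last n))) - X) := by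
        simp [specialize, derivative_map, T]
      rw [h4, hP, cauchyIndex_derivative_mul (hne _ hz)]
      simp
    have h5 : z ∘ Sum.inr = Fin.snoc (α := fun _ => R) (z ∘ Sum.inl) (ξ i (z ∘ Sum.inl)) ↔
        (∀ j ∈ (Finset.univ : Finset (Fin n)), z (Sum.inr j.castSucc) - z (Sum.inl j) = 0) ∧
          z (Sum.inr (Fin.last n)) = ξ i (z ∘ Sum.inl) := by
      constructor
      · intro h
        refine ⟨fun j _ => ?_, ?_⟩
        · have := congrFun h j.castSucc
          simp at this
          simp [this]
        · have := congrFun h (Fin.last n)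
          simpa using this
      · rintro ⟨h, h'⟩
        funext j
        refine Fin.lastCases ?_ (fun j => ?_) j
        · simpa using h'
        · simpa using sub_eq_zero.mp (h j (Finset.mem_univ j))
    rw [h5, h2, h3]
    simp only [map_sub, MvPolynomial.eval_X]
    refine and_congr_right fun _ => ?_
    constructor
    · intro h
      rw [h]
      exact ⟨(hroot _ hz _).mpr ⟨i, rfl⟩, hindex _ hz⟩
    · rintro ⟨h6, h7⟩
      rw [← hindex _ hz] at h7
      have hmem : ∀ t, (specialize p (z ∘ Sum.inl)).IsRoot t →
          t ∈ (specialize p (z ∘ Sum.inl)).roots.toFinset := fun t ht => by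
        rw [Multiset.mem_toFinset, mem_roots (hne _ hz)]; exact ht
      exact (sum_sign_sub_strictMonoOn _).injOn (hmem _ h6)
        (hmem _ ((hroot _ hz _).mpr ⟨i, rfl⟩)) h7
  rw [IsSemialgebraicOn, hset]
  exact (hs.preimage _).inter ((IsSemialgebraic.iInter_finset _ fun j _ =>
    isSemialgebraic_setOf_eval_eq_zero _).inter ((isSemialgebraic_setOf_eval_eq_zero _).inter
      (isSemialgebraic_setOf_cauchyIndex_eq _ _ _)))

variable [TopologicalSpace R] [OrderTopology R]

/-- The number of real roots of a family of separable polynomials of constant degree is constant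
over a semi-algebraically connected set. -/
theorem card_roots_eq_of_separable {ι : Type*} {p : (MvPolynomial ι R)[X]} {N : ℕ}
    (hN : p.natDegree ≤ N)
    {s : Set (ι → R)} (hs : IsSemialgebraic s) (hconn : IsSemialgebraicallyConnected s)
    (hlead : ∀ a ∈ s, MvPolynomial.eval a (p.coeff N) ≠ 0)
    (hsep : ∀ a ∈ s, (specialize p a).Separable) {a b : ι → R} (ha : a ∈ s) (hb : b ∈ s) :
    (specialize p b).roots.toFinset.card = (specialize p a).roots.toFinset.card := by
  refine hconn.eq_of_eventually_eq hs
    (f := fun a => (specialize p a).roots.toFinset.card) (fun k => ?_) (fun a ha => ?_) ha hb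
  · have h := hs.inter (isSemialgebraic_setOf_cauchyIndex_eq (derivative p) p k)
    refine (congrArg IsSemialgebraic ?_).mp h
    ext c
    refine and_congr_right fun hc => ?_
    have h1 := cauchyIndex_derivative (hsep c hc).ne_zero
    rw [derivative_map] at h1
    simp only [Set.mem_ofPred_eq, h1, Nat.cast_inj]
  · filter_upwards [nhdsWithin_le_nhds (eventually_exists_strictMonoOn_roots hN (hlead a ha)
      (hsep a ha) one_pos)] with b hb
    obtain ⟨f, hf, him, -⟩ := hb
    rw [← him, Finset.card_image_of_injOn hf.injOn]

/-- Over a semi-algebraically connected set, the real roots of a family of separable polynomials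
of constant degree are the values of finitely many continuous semi-algebraic functions. -/
theorem exists_root_sections {p : (MvPolynomial (Fin n) R)[X]} {N : ℕ} (hN : p.natDegree ≤ N)
    {s : Set (Fin n → R)} (hs : IsSemialgebraic s) (hconn : IsSemialgebraicallyConnected s)
    (hlead : ∀ a ∈ s, MvPolynomial.eval a (p.coeff N) ≠ 0)
    (hsep : ∀ a ∈ s, (specialize p a).Separable) :
    ∃ (k : ℕ) (ξ : Fin k → (Fin n → R) → R), (∀ i, ContinuousOn (ξ i) s) ∧
      (∀ a ∈ s, StrictMono fun i => ξ i a) ∧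
      (∀ a ∈ s, ∀ t, (specialize p a).IsRoot t ↔ ∃ i, t = ξ i a) ∧
      ∀ i, IsSemialgebraicOn (fun a => Fin.snoc (α := fun _ => R) a (ξ i a)) s := by
  classical
  obtain ⟨k, hk⟩ : ∃ k, ∀ a ∈ s, (specialize p a).roots.toFinset.card = k := by
    by_cases hne : s.Nonempty
    · obtain ⟨a, ha⟩ := hne
      exact ⟨_, fun b hb => card_roots_eq_of_separable hN hs hconn hlead hsep ha hb⟩
    · exact ⟨0, fun a ha => absurd ⟨a, ha⟩ hne⟩
  let ξ : Fin k → (Fin n → R) → R := fun i a =>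
    if h : (specialize p a).roots.toFinset.card = k then
      (specialize p a).roots.toFinset.orderEmbOfFin h i else 0
  have hξ : ∀ a (ha : a ∈ s), (fun i => ξ i a) =
      (specialize p a).roots.toFinset.orderEmbOfFin (hk a ha) := by
    intro a ha
    funext i
    simp only [ξ, dif_pos (hk a ha)]
  have hmono : ∀ a ∈ s, StrictMono fun i => ξ i a := by
    intro a ha
    rw [hξ a ha]
    exact OrderEmbedding.strictMono _
  have hmem : ∀ a ∈ s, ∀ i, ξ i a ∈ (specialize p a).roots.toFinset := by
    intro a ha i
    have := congrFun (hξ a ha) i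
    rw [this]
    exact Finset.orderEmbOfFin_mem _ _ _
  have hroot : ∀ a ∈ s, ∀ t, (specialize p a).IsRoot t ↔ ∃ i, t = ξ i a := by
    intro a ha t
    have h1 := Finset.range_orderEmbOfFin (specialize p a).roots.toFinset (hk a ha)
    rw [← hξ a ha] at h1
    have h2 : (specialize p a).IsRoot t ↔ t ∈ Set.range fun i => ξ i a := by
      rw [h1, Finset.mem_coe, Multiset.mem_toFinset, mem_roots (hsep a ha).ne_zero]
    rw [h2]
    simp [eq_comm]
  refine ⟨k, ξ, fun i a ha => ?_, hmono, hroot,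
    isSemialgebraicOn_snoc_root hs (fun a ha => (hsep a ha).ne_zero) hmono hroot⟩
  rw [ContinuousWithinAt, LinearOrderedAddCommGroup.tendsto_nhds]
  intro ε hε
  filter_upwards [nhdsWithin_le_nhds (eventually_exists_strictMonoOn_roots hN (hlead a ha)
    (hsep a ha) hε), self_mem_nhdsWithin] with b hb hbs
  obtain ⟨f, hf, him, hfd⟩ := hb
  have h1 : (fun j => f (ξ j a)) = fun j => ξ j b := by
    rw [hξ b hbs]
    refine Finset.orderEmbOfFin_unique _ (fun j => ?_) fun j j' h => ?_
    · rw [← him]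
      exact Finset.mem_image_of_mem f (hmem a ha j)
    · exact hf (hmem a ha j) (hmem a ha j') (hmono a ha h)
  rw [← congrFun h1 i]
  exact hfd _ (hmem a ha i)

end RootSections

end GeomCAD

namespace GeomCAD

open Polynomial

/-! ### Counting the roots of `p` at which `g` does not vanish -/

section ActiveFactor

variable {k : Type*} [Field k]

/-- The monic polynomial `p / gcd(p, p' g)`. In characteristic zero it has exactly the roots of
`p` at which `g` does not vanish, and these are simple. -/
noncomputable def activeFactor (p g : k[X]) : k[X] :=
  letI := Classical.decEq k
  normalize (p / EuclideanDomain.gcd p (derivative p * g))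

theorem exists_activeFactor_decomposition {p : k[X]} (hp : p ≠ 0) (g : k[X]) :
    ∃ d f : k[X], d ≠ 0 ∧ p = d * activeFactor p g ∧ derivative p * g = d * f ∧
      IsCoprime (activeFactor p g) f := by
  classical
  obtain ⟨d, hd⟩ : ∃ d, d = EuclideanDomain.gcd p (derivative p * g) := ⟨_, rfl⟩
  have hd0 : d ≠ 0 := by
    rintro rfl
    exact hp (EuclideanDomain.gcd_eq_zero_iff.mp hd.symm).1
  obtain ⟨e, he⟩ : d ∣ p := hd ▸ EuclideanDomain.gcd_dvd_left _ _
  obtain ⟨f, hf⟩ : d ∣ derivative p * g := hd ▸ EuclideanDomain.gcd_dvd_right _ _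
  have hdiv : p / d = e := by
    conv_lhs => rw [he]
    exact mul_div_cancel_left₀ e hd0
  have hact : activeFactor p g = normalize e := by
    rw [← hdiv, hd, activeFactor]
  have hcop : IsCoprime e f := by
    have h1 := EuclideanDomain.gcd_eq_gcd_ab p (derivative p * g)
    rw [← hd] at h1
    generalize EuclideanDomain.gcdA p (derivative p * g) = a at h1
    generalize EuclideanDomain.gcdB p (derivative p * g) = b at h1
    rw [hf] at h1
    refine ⟨a, b, mul_left_cancel₀ hd0 ?_⟩
    linear_combination -h1 - a * he
  have hassoc : Associated e (normalize e) := (normalize_associated e).symm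
  obtain ⟨u, hu⟩ := hassoc
  refine ⟨d * (↑u⁻¹ : k[X]), f * u, mul_ne_zero hd0 u⁻¹.ne_zero, ?_, ?_, ?_⟩
  · rw [hact, ← hu, he]
    have : (↑u⁻¹ : k[X]) * u = 1 := u.inv_mul
    linear_combination -(d * e) * this
  · have : (↑u⁻¹ : k[X]) * u = 1 := u.inv_mul
    rw [hf]
    linear_combination -(d * f) * this
  · rw [hact, ← hu]
    exact (isCoprime_mul_unit_right u.isUnit e f).mpr hcop

theorem activeFactor_monic {p : k[X]} (hp : p ≠ 0) (g : k[X]) : (activeFactor p g).Monic := by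
  classical
  obtain ⟨d, f, hd, hpd, -, -⟩ := exists_activeFactor_decomposition hp g
  have h0 : activeFactor p g ≠ 0 := by
    intro h
    rw [h, mul_zero] at hpd
    exact hp hpd
  rw [activeFactor] at h0 ⊢
  exact monic_normalize (normalize_eq_zero.not.mp h0)

/-- The active factor generates the annihilator of `p' g` modulo `p`. -/
theorem activeFactor_dvd_iff {p : k[X]} (hp : p ≠ 0) (g r : k[X]) :
    activeFactor p g ∣ r ↔ p ∣ r * (derivative p * g) := by
  obtain ⟨d, f, hd, hpd, hf, hcop⟩ := exists_activeFactor_decomposition hp g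
  generalize activeFactor p g = e at *
  rw [hf, mul_left_comm, hpd, mul_dvd_mul_iff_left hd]
  exact ⟨fun h => h.mul_right f, fun h => hcop.dvd_of_dvd_mul_right h⟩

variable [CharZero k] {K : Type*} [Field K]

theorem derivative_ne_zero_of_eval₂_eq_zero {p : k[X]} (hp : p ≠ 0) (φ : k →+* K) {c : K}
    (hc : p.eval₂ φ c = 0) : derivative p ≠ 0 := by
  intro h
  obtain ⟨a, rfl⟩ := natDegree_eq_zero.mp (derivative_eq_zero.mp h)
  rw [eval₂_C, map_eq_zero] at hc
  exact hp (by rw [hc, C_0])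

/-- Comparing multiplicities at `c` in `p = d e` and `p' g = d f`, where `e` is the active factor
and `f` does not vanish at its roots. -/
theorem rootMultiplicity_activeFactor {p : k[X]} (hp : p ≠ 0) (g : k[X]) (φ : k →+* K) (c : K)
    (hc : (activeFactor p g).eval₂ φ c = 0) :
    ((activeFactor p g).map φ).rootMultiplicity c = 1 ∧ p.eval₂ φ c = 0 ∧ g.eval₂ φ c ≠ 0 := by
  have hK : CharZero K := charZero_of_injective_ringHom φ.injective
  obtain ⟨d, f, hd, hpd, hf, hcop⟩ := exists_activeFactor_decomposition hp g
  generalize activeFactor p g = e at *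
  have hpc : p.eval₂ φ c = 0 := by rw [hpd, eval₂_mul, hc, mul_zero]
  have hφ : Function.Injective (map φ) := map_injective φ φ.injective
  have hpK : p.map φ ≠ 0 := Polynomial.map_ne_zero hp
  have hp'K : (derivative p).map φ ≠ 0 :=
    Polynomial.map_ne_zero (derivative_ne_zero_of_eval₂_eq_zero hp φ hpc)
  have hcopK := hcop.map (mapRingHom φ)
  simp only [coe_mapRingHom] at hcopK
  have hfc : (f.map φ).eval c ≠ 0 := by
    intro h
    obtain ⟨a, b, hab⟩ := hcopK
    have := congrArg (eval c) hab
    simp only [eval_add, eval_mul, h, eval_map, hc, mul_zero, add_zero, eval_one] at this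
    exact zero_ne_one this
  have hfK : f.map φ ≠ 0 := by rintro h; rw [h] at hfc; simp at hfc
  have hdK : d.map φ ≠ 0 := Polynomial.map_ne_zero hd
  have hgK : g.map φ ≠ 0 := by
    intro h
    have := congrArg (map φ) hf
    rw [Polynomial.map_mul, h, mul_zero, Polynomial.map_mul] at this
    exact mul_ne_zero hdK hfK this.symm
  have heK : e.map φ ≠ 0 := by
    intro h
    rw [hpd, Polynomial.map_mul, h, mul_zero] at hpK
    exact hpK rfl
  have h1 : (p.map φ).rootMultiplicity c =
      (d.map φ).rootMultiplicity c + (e.map φ).rootMultiplicity c := by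
    have h : p.map φ = d.map φ * e.map φ := by rw [hpd, Polynomial.map_mul]
    rw [h, rootMultiplicity_mul (mul_ne_zero hdK heK)]
  have h2 : (p.map φ).rootMultiplicity c - 1 + (g.map φ).rootMultiplicity c =
      (d.map φ).rootMultiplicity c := by
    have h : (derivative p).map φ * g.map φ = d.map φ * f.map φ := by
      rw [← Polynomial.map_mul, hf, Polynomial.map_mul]
    have h' := congrArg (rootMultiplicity c) h
    rw [rootMultiplicity_mul (mul_ne_zero hp'K hgK), rootMultiplicity_mul (mul_ne_zero hdK hfK),
      rootMultiplicity_eq_zero hfc, add_zero, ← derivative_map,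
      derivative_rootMultiplicity_of_root (by rwa [IsRoot.def, eval_map])] at h'
    exact h'
  have h3 : 0 < (e.map φ).rootMultiplicity c :=
    (rootMultiplicity_pos heK).mpr (by rwa [IsRoot.def, eval_map])
  have h4 : (g.map φ).rootMultiplicity c = 0 := by omega
  refine ⟨by omega, hpc, fun h => ?_⟩
  have : 0 < (g.map φ).rootMultiplicity c :=
    (rootMultiplicity_pos hgK).mpr (by rwa [IsRoot.def, eval_map])
  omega

theorem eval₂_activeFactor_eq_zero_iff {p : k[X]} (hp : p ≠ 0) (g : k[X]) (φ : k →+* K) (c : K) :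
    (activeFactor p g).eval₂ φ c = 0 ↔ p.eval₂ φ c = 0 ∧ g.eval₂ φ c ≠ 0 := by
  refine ⟨fun h => (rootMultiplicity_activeFactor hp g φ c h).2, ?_⟩
  rintro ⟨hpc, hgc⟩
  by_contra hec
  have hK : CharZero K := charZero_of_injective_ringHom φ.injective
  obtain ⟨d, f, hd, hpd, hf, hcop⟩ := exists_activeFactor_decomposition hp g
  generalize activeFactor p g = e at *
  have hpK : p.map φ ≠ 0 := Polynomial.map_ne_zero hp
  have hdK : d.map φ ≠ 0 := Polynomial.map_ne_zero hd
  have heK : e.map φ ≠ 0 := by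
    rintro h; rw [← eval_map, h] at hec; simp at hec
  have hgK : g.map φ ≠ 0 := by
    rintro h; rw [← eval_map, h] at hgc; simp at hgc
  have h1 : (p.map φ).rootMultiplicity c = (d.map φ).rootMultiplicity c := by
    have h : p.map φ = d.map φ * e.map φ := by rw [hpd, Polynomial.map_mul]
    rw [h, rootMultiplicity_mul (mul_ne_zero hdK heK),
      rootMultiplicity_eq_zero (p := e.map φ) (by rwa [IsRoot.def, eval_map]), add_zero]
  have hroot : (p.map φ).IsRoot c := by rwa [IsRoot.def, eval_map]
  have h0 : 0 < (p.map φ).rootMultiplicity c := (rootMultiplicity_pos hpK).mpr hroot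
  have hp'K : (derivative p).map φ ≠ 0 :=
    Polynomial.map_ne_zero (derivative_ne_zero_of_eval₂_eq_zero hp φ hpc)
  have h : (derivative p).map φ * g.map φ = d.map φ * f.map φ := by
    rw [← Polynomial.map_mul, hf, Polynomial.map_mul]
  have h' := congrArg (rootMultiplicity c) h
  rw [rootMultiplicity_mul (mul_ne_zero hp'K hgK),
    rootMultiplicity_mul (h ▸ mul_ne_zero hp'K hgK),
    rootMultiplicity_eq_zero (p := g.map φ) (by rwa [IsRoot.def, eval_map]), ← derivative_map,
    derivative_rootMultiplicity_of_root hroot] at h'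
  omega

theorem activeFactor_separable {p : k[X]} (hp : p ≠ 0) (g : k[X]) :
    (activeFactor p g).Separable := by
  classical
  rw [← nodup_aroots_iff_of_splits (K := AlgebraicClosure k) (activeFactor_monic hp g).ne_zero
    (IsAlgClosed.splits _), aroots, Multiset.nodup_iff_count_le_one]
  intro c
  rw [count_roots]
  by_cases hc : (activeFactor p g).eval₂ (algebraMap k (AlgebraicClosure k)) c = 0
  · exact (rootMultiplicity_activeFactor hp g _ c hc).1.le
  · rw [rootMultiplicity_eq_zero (by rwa [IsRoot.def, eval_map])]
    exact Nat.zero_le _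

theorem encard_setOf_eval₂_eq_zero_and_ne_zero [IsAlgClosed K] {p : k[X]} (hp : p ≠ 0) (g : k[X])
    (φ : k →+* K) :
    {c : K | p.eval₂ φ c = 0 ∧ g.eval₂ φ c ≠ 0}.encard = (activeFactor p g).natDegree := by
  let := φ.toAlgebra
  have h1 : {c : K | p.eval₂ φ c = 0 ∧ g.eval₂ φ c ≠ 0} = (activeFactor p g).rootSet K := by
    ext c
    rw [mem_rootSet_of_ne (activeFactor_monic hp g).ne_zero]
    exact (eval₂_activeFactor_eq_zero_iff hp g φ c).symm
  rw [h1, Set.encard_eq_coe_toFinset_card, Set.toFinset_card,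
    card_rootSet_eq_natDegree (activeFactor_separable hp g) (IsAlgClosed.splits _)]

end ActiveFactor

section Gram

variable {D : Type*} [CommRing D]

/-- The columns of this matrix are the coefficients of the remainders of `X ^ j p' g` modulo the
monic polynomial `p` of degree `d`, for `j < m`. -/
noncomputable def remainderMatrix (d m : ℕ) (p g : D[X]) : Matrix (Fin d) (Fin m) D :=
  fun i j => ((X ^ (j : ℕ) * (derivative p * g)) %ₘ p).coeff i

/-- The Gram determinant of the columns of `remainderMatrix`. -/
noncomputable def gramDet (d m : ℕ) (p g : D[X]) : D :=
  ((remainderMatrix d m p g).transpose * remainderMatrix d m p g).det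

/-- Cramer's rule for the linear relation between the remainders of the `X ^ j p' g`, `j ≤ m`,
modulo `p`: if the first `m` of them are linearly independent, this is a multiple of
`activeFactor p g`, with the Gram determinant as leading coefficient. -/
noncomputable def cramerFactor (d m : ℕ) (p g : D[X]) : D[X] :=
  C (gramDet d m p g) * X ^ m - ∑ j : Fin m,
    C ((((remainderMatrix d m p g).transpose * remainderMatrix d m p g).adjugate.mulVec
      ((remainderMatrix d m p g).transpose.mulVec
        fun i => ((X ^ m * (derivative p * g)) %ₘ p).coeff i)) j) * X ^ (j : ℕ)

theorem coeff_modByMonic_map {E : Type*} [CommRing E] (φ : D →+* E) (m : ℕ) {p : D[X]}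
    (hp : p.Monic) (g : D[X]) (i : ℕ) :
    ((X ^ m * (derivative (p.map φ) * g.map φ)) %ₘ p.map φ).coeff i =
      φ (((X ^ m * (derivative p * g)) %ₘ p).coeff i) := by
  have h : X ^ m * (derivative (p.map φ) * g.map φ) = (X ^ m * (derivative p * g)).map φ := by
    simp [derivative_map]
  rw [h, ← map_modByMonic φ hp, coeff_map]

theorem remainderMatrix_map {E : Type*} [CommRing E] (φ : D →+* E) (d m : ℕ) {p : D[X]}
    (hp : p.Monic) (g : D[X]) :
    remainderMatrix d m (p.map φ) (g.map φ) = (remainderMatrix d m p g).map φ := by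
  ext i j
  exact coeff_modByMonic_map φ j hp g i

theorem gramDet_map {E : Type*} [CommRing E] (φ : D →+* E) (d m : ℕ) {p : D[X]}
    (hp : p.Monic) (g : D[X]) :
    gramDet d m (p.map φ) (g.map φ) = φ (gramDet d m p g) := by
  rw [gramDet, gramDet, remainderMatrix_map φ d m hp, RingHom.map_det, RingHom.mapMatrix_apply,
    Matrix.map_mul, Matrix.transpose_map]

theorem cramerFactor_map {E : Type*} [CommRing E] (φ : D →+* E) (d m : ℕ) {p : D[X]}
    (hp : p.Monic) (g : D[X]) :
    cramerFactor d m (p.map φ) (g.map φ) = (cramerFactor d m p g).map φ := by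
  have h1 : ((remainderMatrix d m p g).map φ).transpose * (remainderMatrix d m p g).map φ =
      ((remainderMatrix d m p g).transpose * remainderMatrix d m p g).map φ := by
    rw [Matrix.map_mul, Matrix.transpose_map]
  rw [cramerFactor, cramerFactor, gramDet_map φ d m hp, remainderMatrix_map φ d m hp, h1]
  simp only [coeff_modByMonic_map φ m hp, Polynomial.map_sub, Polynomial.map_mul, map_C,
    Polynomial.map_pow, map_X, Polynomial.map_sum]
  congr 1
  refine Finset.sum_congr rfl fun j _ => ?_
  congr 2
  rw [← RingHom.mapMatrix_apply, ← RingHom.map_adjugate, RingHom.mapMatrix_apply,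
    ← Matrix.transpose_map]
  simp only [Matrix.mulVec, dotProduct, map_sum, map_mul, Matrix.map_apply]

theorem natDegree_cramerFactor_le (d m : ℕ) (p g : D[X]) :
    (cramerFactor d m p g).natDegree ≤ m := by
  refine (natDegree_sub_le _ _).trans (max_le (natDegree_C_mul_X_pow_le _ _) ?_)
  exact natDegree_sum_le_of_forall_le _ _ fun j _ =>
    (natDegree_C_mul_X_pow_le _ _).trans j.2.le

theorem mulVec_remainderMatrix {d m : ℕ} {p : D[X]} (g : D[X]) (r : Fin m → D)
    (i : Fin d) :
    (remainderMatrix d m p g).mulVec r i =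
      (((∑ j : Fin m, C (r j) * X ^ (j : ℕ)) * (derivative p * g)) %ₘ p).coeff i := by
  rw [Finset.sum_mul, ← modByMonicHom_apply, map_sum, finsetSum_coeff, Matrix.mulVec, dotProduct]
  refine Finset.sum_congr rfl fun j _ => ?_
  rw [mul_assoc, ← smul_eq_C_mul, map_smul, coeff_smul, modByMonicHom_apply, smul_eq_mul, mul_comm,
    remainderMatrix]

theorem dvd_iff_forall_coeff_modByMonic_eq_zero {p : D[X]} (hp : p.Monic) (f : D[X]) :
    p ∣ f ↔ ∀ i : Fin p.natDegree, (f %ₘ p).coeff i = 0 := by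
  rw [← modByMonic_eq_zero_iff_dvd hp]
  constructor
  · intro h i; simp [h]
  · intro h
    nontriviality D
    ext i
    rw [coeff_zero]
    by_cases hi : i < p.natDegree
    · exact h ⟨i, hi⟩
    · refine coeff_eq_zero_of_degree_lt ((degree_modByMonic_lt f hp).trans_le ?_)
      rw [degree_eq_natDegree hp.ne_zero]
      exact_mod_cast not_lt.mp hi

variable {k : Type*} [Field k]

/-- At a point where the number of active roots is `m`, Cramer's rule recovers the active factor:
it is the monic relation of least degree between the remainders of the `X ^ j p' g`. -/
theorem cramerFactor_eq {p : k[X]} (hp : p.Monic) (g : k[X]) :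
    cramerFactor p.natDegree (activeFactor p g).natDegree p g =
      C (gramDet p.natDegree (activeFactor p g).natDegree p g) * activeFactor p g := by
  set e := activeFactor p g with he
  have hem : e.Monic := activeFactor_monic hp.ne_zero g
  set m := e.natDegree with hm
  set M := remainderMatrix p.natDegree m p g with hM
  set b : Fin p.natDegree → k := fun i => ((X ^ m * (derivative p * g)) %ₘ p).coeff i with hb
  have hesum : e = X ^ m + ∑ j : Fin m, C (e.coeff j) * X ^ (j : ℕ) := by
    rw [Fin.sum_univ_eq_sum_range (fun j => C (e.coeff j) * X ^ j)]
    exact hem.as_sum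
  have h1 : b + M.mulVec (fun j => e.coeff j) = 0 := by
    have h2 : p ∣ e * (derivative p * g) := (activeFactor_dvd_iff hp.ne_zero g e).mp (he ▸ dvd_rfl)
    rw [dvd_iff_forall_coeff_modByMonic_eq_zero hp] at h2
    funext i
    have h3 := h2 i
    rw [hesum, add_mul, add_modByMonic, coeff_add] at h3
    rw [Pi.add_apply, mulVec_remainderMatrix]
    exact h3
  have h2 : (M.transpose * M).adjugate.mulVec (M.transpose.mulVec b) =
      fun j : Fin m => -(gramDet p.natDegree m p g * e.coeff j) := by
    rw [eq_neg_of_add_eq_zero_left h1, Matrix.mulVec_neg, Matrix.mulVec_neg, Matrix.mulVec_mulVec,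
      Matrix.mulVec_mulVec, Matrix.mul_assoc, Matrix.adjugate_mul, Matrix.smul_mulVec,
      Matrix.one_mulVec]
    rfl
  rw [cramerFactor, ← hM, h2]
  conv_rhs => rw [hesum]
  rw [mul_add, Finset.mul_sum, sub_eq_add_neg, ← Finset.sum_neg_distrib]
  congr 1
  refine Finset.sum_congr rfl fun j _ => ?_
  rw [C_neg, C_mul]
  ring

variable [LinearOrder k] [IsStrictOrderedRing k]

/-- The Gram determinants detect the number of roots of `p` at which `g` does not vanish. -/
theorem gramDet_ne_zero_iff {m : ℕ} {p : k[X]} (hp : p.Monic) (g : k[X]) :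
    gramDet p.natDegree m p g ≠ 0 ↔ m ≤ (activeFactor p g).natDegree := by
  have h1 : gramDet p.natDegree m p g ≠ 0 ↔
      ∀ r : Fin m → k, (remainderMatrix p.natDegree m p g).mulVec r = 0 → r = 0 := by
    rw [gramDet, ne_eq, ← Matrix.exists_mulVec_eq_zero_iff]
    push Not
    -- over an ordered field, `MᵀM` and `M` have the same kernel
    have hker := Matrix.ker_mulVecLin_transpose_mul_self (remainderMatrix p.natDegree m p g)
    have h2 : ∀ r, ((remainderMatrix p.natDegree m p g).transpose *
        remainderMatrix p.natDegree m p g).mulVec r = 0 ↔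
        (remainderMatrix p.natDegree m p g).mulVec r = 0 := by
      intro r
      have := SetLike.ext_iff.mp hker r
      rwa [LinearMap.mem_ker, LinearMap.mem_ker, Matrix.mulVecLin_apply,
        Matrix.mulVecLin_apply] at this
    constructor
    · intro h r hr
      by_contra hr0
      exact h r hr0 ((h2 r).mpr hr)
    · intro h r hr0 hr
      exact hr0 (h r ((h2 r).mp hr))
  have h2 : ∀ r : Fin m → k, (remainderMatrix p.natDegree m p g).mulVec r = 0 ↔
      activeFactor p g ∣ ∑ j : Fin m, C (r j) * X ^ (j : ℕ) := by
    intro r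
    rw [activeFactor_dvd_iff hp.ne_zero, dvd_iff_forall_coeff_modByMonic_eq_zero hp, funext_iff]
    simp only [mulVec_remainderMatrix, Pi.zero_apply]
  have hcoeff : ∀ (r : Fin m → k) (i : Fin m),
      (∑ j : Fin m, C (r j) * X ^ (j : ℕ)).coeff i = r i := by
    intro r i
    simp [coeff_X_pow, Fin.val_inj]
  rw [h1]
  constructor
  · intro h
    by_contra! hlt
    have h3 : ∑ j : Fin m, C ((activeFactor p g).coeff j) * X ^ (j : ℕ) = activeFactor p g := by
      rw [Fin.sum_univ_eq_sum_range (fun j => C ((activeFactor p g).coeff j) * X ^ j)]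
      exact ((activeFactor p g).as_sum_range_C_mul_X_pow' hlt).symm
    have h4 := h (fun j => (activeFactor p g).coeff j) ((h2 _).mpr (by rw [h3]))
    have h5 := congrFun h4 ⟨_, hlt⟩
    simp only [Pi.zero_apply, (activeFactor_monic hp.ne_zero g).coeff_natDegree] at h5
    exact one_ne_zero h5
  · intro hle r hr
    have h3 : ∑ j : Fin m, C (r j) * X ^ (j : ℕ) = 0 := by
      refine eq_zero_of_dvd_of_degree_lt ((h2 r).mp hr) ?_
      rw [degree_eq_natDegree (activeFactor_monic hp.ne_zero g).ne_zero]
      refine lt_of_lt_of_le ?_ (Nat.cast_le.mpr hle)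
      rw [← mem_degreeLT]
      refine Submodule.sum_mem _ fun j _ => ?_
      rw [mem_degreeLT]
      exact (degree_C_mul_X_pow_le _ _).trans_lt (Nat.cast_lt.mpr j.2)
    funext i
    rw [← hcoeff r i, h3, coeff_zero, Pi.zero_apply]

end Gram

end GeomCAD

namespace GeomCAD

open Polynomial

/-! ### Points of finite free and of quasi-finite algebras generated by one element -/

section Points

/-- `E` is generated over `A` by `x` and by inverses of polynomials in `x`: geometrically,
`Spec E` is an immersed subscheme of the affine line over `Spec A`, with coordinate `x`. -/
def IsFractionGenerated {A E : Type*} [CommRing A] [CommRing E] (f : A →+* E) (x : E) : Prop :=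
  ∀ e : E, ∃ a b : A[X], IsUnit (b.eval₂ f x) ∧ b.eval₂ f x * e = a.eval₂ f x

theorem IsFractionGenerated.ringHom_ext {A E K : Type*} [CommRing A] [CommRing E] [CommRing K]
    {f : A →+* E} {x : E} (h : IsFractionGenerated f x) {g g' : E →+* K}
    (hf : g.comp f = g'.comp f) (hx : g x = g' x) : g = g' := by
  ext e
  obtain ⟨a, b, hb, he⟩ := h e
  have key : ∀ p : A[X], g (p.eval₂ f x) = g' (p.eval₂ f x) := fun p => by
    rw [hom_eval₂, hom_eval₂, hf, hx]
  have h1 := congrArg g he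
  have h2 := congrArg g' he
  rw [map_mul] at h1 h2
  rw [key a, key b, ← h2] at h1
  exact (hb.map g').mul_left_cancel h1

/-- A finite-dimensional subalgebra generated by `x` is closed under division by units of the
ambient algebra. -/
theorem mem_adjoin_of_isUnit_mul {k T : Type*} [Field k] [CommRing T] [Algebra k T] {x : T}
    (hx : IsIntegral k x) {b t : T} (hb : b ∈ Algebra.adjoin k {x}) (hu : IsUnit b)
    (ht : b * t ∈ Algebra.adjoin k {x}) : t ∈ Algebra.adjoin k {x} := by
  have hfin : Module.Finite k (Algebra.adjoin k {x}) :=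
    Algebra.finite_adjoin_simple_of_isIntegral hx
  have hinj : Function.Injective (LinearMap.mulLeft k (⟨b, hb⟩ : Algebra.adjoin k {x})) := by
    intro u v huv
    exact Subtype.ext (hu.mul_left_cancel (congrArg Subtype.val huv))
  obtain ⟨⟨c, hc⟩, hc1⟩ := LinearMap.injective_iff_surjective.mp hinj 1
  have hbc : b * c = 1 := congrArg Subtype.val hc1
  have : t = c * (b * t) := by rw [← mul_assoc, mul_comm c b, hbc, one_mul]
  rw [this]
  exact mul_mem hc ht

variable {D U K : Type*} [CommRing D] [CommRing U] [Algebra D U] [Field K]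

/-- Base change to a field turns fractions of an integral element into polynomials. -/
theorem IsFractionGenerated.adjoin_eq_top [Algebra D K] {x : U}
    (h : IsFractionGenerated (algebraMap D U) x)
    (hx : IsIntegral D x) : Algebra.adjoin K {(1 : K) ⊗ₜ[D] x} = ⊤ := by
  have hint : IsIntegral K ((1 : K) ⊗ₜ[D] x) := hx.tmul 1
  have hpoly : ∀ p : D[X], (1 : K) ⊗ₜ[D] (p.eval₂ (algebraMap D U) x) ∈
      Algebra.adjoin K {(1 : K) ⊗ₜ[D] x} := by
    intro p
    have : (1 : K) ⊗ₜ[D] (p.eval₂ (algebraMap D U) x) =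
        aeval ((1 : K) ⊗ₜ[D] x) (p.map (algebraMap D K)) := by
      rw [aeval_map_algebraMap, ← aeval_def]
      exact (aeval_algHom_apply (Algebra.TensorProduct.includeRight : U →ₐ[D] K ⊗[D] U) x p).symm
    rw [this]
    exact aeval_mem_adjoin_singleton K _
  rw [eq_top_iff]
  rintro t -
  induction t using TensorProduct.induction_on with
  | zero => exact zero_mem _
  | add s t hs ht => exact add_mem hs ht
  | tmul c e =>
    have h1 : c ⊗ₜ[D] e = c • ((1 : K) ⊗ₜ[D] e) := by
      rw [TensorProduct.smul_tmul', smul_eq_mul, mul_one]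
    rw [h1]
    refine Subalgebra.smul_mem _ ?_ c
    obtain ⟨a, b, hb, he⟩ := h e
    refine mem_adjoin_of_isUnit_mul hint (hpoly b)
      (hb.map (Algebra.TensorProduct.includeRight : U →ₐ[D] K ⊗[D] U)) ?_
    rw [Algebra.TensorProduct.tmul_mul_tmul, one_mul, he]
    exact hpoly a

/-- A free algebra generated by fractions of an integral element is finite as soon as the base has
a point. -/
theorem IsFractionGenerated.finite [Module.Free D U] {x : U}
    (h : IsFractionGenerated (algebraMap D U) x) (hx : IsIntegral D x) (τ : D →+* K) :
    Module.Finite D U := by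
  let := τ.toAlgebra
  have hfin : Module.Finite K (K ⊗[D] U) := by
    have h1 : Module.Finite K (Algebra.adjoin K {(1 : K) ⊗ₜ[D] x}) :=
      Algebra.finite_adjoin_simple_of_isIntegral (hx.tmul 1)
    rw [h.adjoin_eq_top hx] at h1
    exact Module.Finite.equiv (Subalgebra.topEquiv (R := K) (A := K ⊗[D] U)).toLinearEquiv
  let b := Module.Free.chooseBasis D U
  have := Module.Finite.finite_basis (b.baseChange K)
  exact Module.Finite.of_basis b

theorem eval₂_charpoly_lmul_self [Module.Free D U] [Module.Finite D U] (x : U) :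
    (Algebra.lmul D U x).charpoly.eval₂ (algebraMap D U) x = 0 := by
  have h1 := LinearMap.aeval_self_charpoly (Algebra.lmul D U x)
  rw [aeval_algHom_apply] at h1
  have h2 : aeval x (Algebra.lmul D U x).charpoly * 1 = 0 := LinearMap.congr_fun h1 1
  rwa [mul_one, aeval_def] at h2

/-- The points over `τ` of a finite free algebra generated by fractions of `x` are the roots of
the characteristic polynomial of `x`. -/
theorem IsFractionGenerated.eval₂_charpoly_eq_zero_iff [Module.Free D U] [Module.Finite D U]
    {x : U} (h : IsFractionGenerated (algebraMap D U) x) (τ : D →+* K) (c : K) :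
    (Algebra.lmul D U x).charpoly.eval₂ τ c = 0 ↔
      ∃ g : U →+* K, g.comp (algebraMap D U) = τ ∧ g x = c := by
  constructor
  · intro hc
    let := τ.toAlgebra
    have hτ : algebraMap D K = τ := rfl
    have hx : IsIntegral D x := Algebra.IsIntegral.isIntegral x
    let pb := PowerBasis.ofAdjoinEqTop (hx.tmul (1 : K)) (h.adjoin_eq_top (K := K) hx)
    have hgen : pb.gen = (1 : K) ⊗ₜ[D] x := PowerBasis.ofAdjoinEqTop_gen _ _
    have hmin : minpoly K pb.gen = (Algebra.lmul D U x).charpoly.map τ := by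
      rw [← charpoly_leftMulMatrix, Algebra.leftMulMatrix_apply, LinearMap.charpoly_toMatrix, hgen,
        ← hτ, ← LinearMap.charpoly_baseChange, Algebra.baseChange_lmul]
    have hroot : aeval c (minpoly K pb.gen) = 0 := by
      rw [hmin, coe_aeval_eq_eval, eval_map, hc]
    refine ⟨(pb.lift c hroot).toRingHom.comp
      (Algebra.TensorProduct.includeRight : U →ₐ[D] K ⊗[D] U).toRingHom, ?_, ?_⟩
    · ext d
      have h1 : (Algebra.TensorProduct.includeRight : U →ₐ[D] K ⊗[D] U) (algebraMap D U d) =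
          algebraMap K (K ⊗[D] U) (algebraMap D K d) := by
        rw [AlgHom.commutes, IsScalarTower.algebraMap_apply D K]
      have h2 := (pb.lift c hroot).commutes (algebraMap D K d)
      rw [← h1] at h2
      exact h2
    · have h1 := pb.lift_gen c hroot
      rw [hgen] at h1
      exact h1
  · rintro ⟨g, hg, rfl⟩
    rw [← hg, ← hom_eval₂, eval₂_charpoly_lmul_self, map_zero]

end Points

section GeometricFibers

/-- A point of a geometric fibre of an algebra generated by fractions of `x` is given by the value
of `x` there, provided that `x` satisfies a monic equation on the fibre. -/
theorem card_primeSpectrum_tensorProduct {A E K : Type*} [CommRing A] [CommRing E] [Field K]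
    [IsAlgClosed K] [Algebra A K] [Algebra A E] {x : E}
    (h : IsFractionGenerated (algebraMap A E) x) {p : K[X]} (hp : p.Monic)
    (hpx : p.eval₂ (Algebra.TensorProduct.includeRight : K →ₐ[A] E ⊗[A] K).toRingHom
      (x ⊗ₜ[A] 1) = 0) :
    ENat.card (PrimeSpectrum (E ⊗[A] K)) =
      {c : K | ∃ g : E →+* K, g.comp (algebraMap A E) = algebraMap A K ∧ g x = c}.encard := by
  let ιL : E →+* E ⊗[A] K := (Algebra.TensorProduct.includeLeft : E →ₐ[A] E ⊗[A] K).toRingHom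
  let ιR : K →+* E ⊗[A] K := (Algebra.TensorProduct.includeRight : K →ₐ[A] E ⊗[A] K).toRingHom
  have hLR : ιL.comp (algebraMap A E) = ιR.comp (algebraMap A K) := by
    ext a
    simp only [ιL, ιR, RingHom.comp_apply]
    exact (AlgHom.commutes _ a).trans (AlgHom.commutes _ a).symm
  have htmul : ∀ e c, e ⊗ₜ[A] c = ιL e * ιR c := fun e c => by
    simp [ιL, ιR]
  have ext_hom : ∀ {S : Type _} [CommRing S] (f g : E ⊗[A] K →+* S), f.comp ιL = g.comp ιL →
      f.comp ιR = g.comp ιR → f = g := by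
    intro S _ f g h1 h2
    refine RingHom.ext fun t => ?_
    induction t using TensorProduct.induction_on with
    | zero => simp
    | add s t hs ht => rw [map_add, map_add, hs, ht]
    | tmul e c =>
      rw [htmul, map_mul, map_mul]
      exact congrArg₂ (· * ·) (RingHom.congr_fun h1 e) (RingHom.congr_fun h2 c)
  let G := {g : E →+* K // g.comp (algebraMap A E) = algebraMap A K}
  let lift : G → (E ⊗[A] K →+* K) := fun g =>
    (Algebra.TensorProduct.productMap (⟨g.1, RingHom.congr_fun g.2⟩ : E →ₐ[A] K)
      (AlgHom.id A K)).toRingHom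
  have liftL : ∀ g : G, ∀ e, lift g (ιL e) = g.1 e := fun g e => by
    simp [lift, ιL]
  have liftR : ∀ g : G, ∀ c, lift g (ιR c) = c := fun g c => by
    simp [lift, ιR]
  let Φ : G → PrimeSpectrum (E ⊗[A] K) := fun g => ⟨RingHom.ker (lift g), RingHom.ker_isPrime _⟩
  have hΦ : Function.Bijective Φ := by
    constructor
    · intro g g' hgg
      refine Subtype.ext (RingHom.ext fun e => ?_)
      have h1 : ιL e - ιR (g.1 e) ∈ RingHom.ker (lift g) := by
        rw [RingHom.mem_ker, map_sub, liftL, liftR, sub_self]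
      have h2 : RingHom.ker (lift g) = RingHom.ker (lift g') :=
        congrArg PrimeSpectrum.asIdeal hgg
      rw [h2, RingHom.mem_ker, map_sub, liftL, liftR] at h1
      exact (sub_eq_zero.mp h1).symm
    · intro q
      let π := Ideal.Quotient.mk q.asIdeal
      let ψ : K →+* (E ⊗[A] K) ⧸ q.asIdeal := π.comp ιR
      -- the coordinate `x` takes a value in `K` at `q`, since `p` splits
      obtain ⟨c, hc⟩ : ∃ c, π (ιL x) = ψ c := by
        have h1 : p.eval₂ ψ (π (ιL x)) = 0 := by
          have h2 := congrArg π hpx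
          rw [hom_eval₂, map_zero] at h2
          exact h2
        rw [(IsAlgClosed.splits p).eq_prod_roots_of_monic hp, eval₂_multiset_prod,
          Multiset.prod_eq_zero_iff, Multiset.map_map, Multiset.mem_map] at h1
        obtain ⟨c, -, hc⟩ := h1
        exact ⟨c, by simpa [sub_eq_zero] using hc⟩
      have hE : ∀ e, ∃ c, π (ιL e) = ψ c := by
        intro e
        have hpoly : ∀ f : A[X], π (ιL (f.eval₂ (algebraMap A E) x)) =
            ψ (f.eval₂ (algebraMap A K) c) := by
          intro f
          rw [hom_eval₂, hom_eval₂, hc, hom_eval₂, hLR]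
          rfl
        obtain ⟨a, b, hb, he⟩ := h e
        have h1 := congrArg (fun t => π (ιL t)) he
        simp only [map_mul, hpoly] at h1
        have h2 : b.eval₂ (algebraMap A K) c ≠ 0 := by
          intro h0
          have h3 := (hb.map ιL).map π
          rw [hpoly, h0, map_zero] at h3
          exact not_isUnit_zero h3
        refine ⟨a.eval₂ (algebraMap A K) c / b.eval₂ (algebraMap A K) c, ?_⟩
        have h3 : IsUnit (ψ (b.eval₂ (algebraMap A K) c)) := (IsUnit.mk0 _ h2).map ψ
        refine h3.mul_left_cancel ?_
        rw [h1, ← map_mul, mul_div_cancel₀ _ h2]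
      have hψ : Function.Bijective ψ := by
        refine ⟨ψ.injective, fun t => ?_⟩
        obtain ⟨t, rfl⟩ := Ideal.Quotient.mk_surjective t
        induction t using TensorProduct.induction_on with
        | zero => exact ⟨0, by simp⟩
        | add s t hs ht =>
          obtain ⟨a, ha⟩ := hs
          obtain ⟨b, hb⟩ := ht
          exact ⟨a + b, by rw [map_add, map_add, ha, hb]⟩
        | tmul e c' =>
          obtain ⟨a, ha⟩ := hE e
          refine ⟨a * c', ?_⟩
          rw [htmul, map_mul, map_mul, ← ha]
          rfl
      let ψe := RingEquiv.ofBijective ψ hψ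
      have hψe : ∀ c, ψe.symm (ψ c) = c := fun c => ψe.symm_apply_apply c
      let g : G := ⟨(ψe.symm.toRingHom.comp π).comp ιL, by
        rw [RingHom.comp_assoc, hLR]
        ext a
        exact hψe _⟩
      refine ⟨g, PrimeSpectrum.ext ?_⟩
      have h1 : lift g = ψe.symm.toRingHom.comp π := by
        refine ext_hom _ _ (RingHom.ext fun e => liftL g e) (RingHom.ext fun c => ?_)
        rw [RingHom.comp_apply, liftR]
        exact (hψe c).symm
      change RingHom.ker (lift g) = q.asIdeal
      rw [h1]
      ext t
      rw [RingHom.mem_ker, RingHom.comp_apply]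
      have h2 : ψe.symm.toRingHom (π t) = 0 ↔ π t = 0 := map_eq_zero_iff _ ψe.symm.injective
      rw [h2]
      exact Ideal.Quotient.eq_zero_iff_mem
  have hinj : Function.Injective fun g : G => g.1 x := fun g g' hgg =>
    Subtype.ext (h.ringHom_ext (g.2.trans g'.2.symm) hgg)
  have hrange : {c : K | ∃ g : E →+* K, g.comp (algebraMap A E) = algebraMap A K ∧ g x = c} =
      Set.range fun g : G => g.1 x := by
    ext c
    constructor
    · rintro ⟨g, hg, rfl⟩; exact ⟨⟨g, hg⟩, rfl⟩
    · rintro ⟨g, rfl⟩; exact ⟨g.1, g.2, rfl⟩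
  rw [hrange, ← Set.image_univ, hinj.encard_image, Set.encard_univ,
    ENat.card_congr (Equiv.ofBijective Φ hΦ)]

end GeometricFibers

end GeomCAD

namespace GeomCAD

open Polynomial

/-! ### Free morphisms and localizations -/

section FreeHom

variable {D U : Type*} [CommRing D] [CommRing U]

/-- The characteristic polynomial of multiplication by `x` on a finite free algebra `U`. -/
noncomputable def fiberPolynomial (f : D →+* U) (hfree : IsFreeHom f) (hfin : f.Finite) (x : U) :
    D[X] :=
  letI := f.toAlgebra
  haveI : Module.Free D U := hfree
  haveI : Module.Finite D U := hfin
  (Algebra.lmul D U x).charpoly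

theorem fiberPolynomial_monic (f : D →+* U) (hfree : IsFreeHom f) (hfin : f.Finite) (x : U) :
    (fiberPolynomial f hfree hfin x).Monic := by
  let := f.toAlgebra
  have : Module.Free D U := hfree
  have : Module.Finite D U := hfin
  exact LinearMap.charpoly_monic _

theorem eval₂_fiberPolynomial_self (f : D →+* U) (hfree : IsFreeHom f) (hfin : f.Finite) (x : U) :
    (fiberPolynomial f hfree hfin x).eval₂ f x = 0 := by
  let := f.toAlgebra
  have : Module.Free D U := hfree
  have : Module.Finite D U := hfin
  exact eval₂_charpoly_lmul_self x

theorem eval₂_fiberPolynomial_eq_zero_iff {f : D →+* U} (hfree : IsFreeHom f) (hfin : f.Finite)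
    {x : U} (h : IsFractionGenerated f x) {K : Type*} [Field K] (σ : D →+* K) (c : K) :
    (fiberPolynomial f hfree hfin x).eval₂ σ c = 0 ↔ ∃ g : U →+* K, g.comp f = σ ∧ g x = c := by
  let := f.toAlgebra
  have : Module.Free D U := hfree
  have : Module.Finite D U := hfin
  exact IsFractionGenerated.eval₂_charpoly_eq_zero_iff (D := D) h σ c

theorem IsFractionGenerated.finite_of_isFreeHom {f : D →+* U} (hfree : IsFreeHom f) {x : U}
    (h : IsFractionGenerated f x) (hx : f.IsIntegralElem x) {K : Type*} [Field K] (σ : D →+* K) :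
    f.Finite := by
  let := f.toAlgebra
  have : Module.Free D U := hfree
  exact IsFractionGenerated.finite (D := D) h hx σ

theorem IsFractionGenerated.of_comp {A : Type*} [CommRing A] {f : D →+* U} {g : A →+* D} {x : U}
    (h : IsFractionGenerated (f.comp g) x) : IsFractionGenerated f x := by
  intro e
  obtain ⟨a, b, hb, he⟩ := h e
  exact ⟨a.map g, b.map g, by rwa [eval₂_map], by rwa [eval₂_map, eval₂_map]⟩

theorem IsFractionGenerated.comp_surjective {E : Type*} [CommRing E] {f : D →+* U} {x : U}
    (h : IsFractionGenerated f x) {g : U →+* E} (hg : Function.Surjective g) :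
    IsFractionGenerated (g.comp f) (g x) := by
  intro e
  obtain ⟨e, rfl⟩ := hg e
  obtain ⟨a, b, hb, he⟩ := h e
  refine ⟨a, b, ?_, ?_⟩
  · rw [← hom_eval₂]; exact hb.map g
  · rw [← hom_eval₂, ← hom_eval₂, ← he, map_mul]

theorem IsFractionGenerated.comp_away {E : Type*} [CommRing E] [Algebra U E] {f : D →+* U} {x : U}
    (h : IsFractionGenerated f x) (u : U) [IsLocalization.Away u E] :
    IsFractionGenerated ((algebraMap U E).comp f) (algebraMap U E x) := by
  intro e
  obtain ⟨n, e', he⟩ := IsLocalization.Away.surj u e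
  obtain ⟨a, b, hb, hab⟩ := h e'
  -- if `u = a' / b'`, then `e = e' / u ^ n` is a fraction with denominator `b * a' ^ n`
  obtain ⟨a', b', hb', hab'⟩ := h u
  have hu : IsUnit (algebraMap U E u) := IsLocalization.Away.algebraMap_isUnit u
  refine ⟨a * b' ^ n, b * a' ^ n, ?_, ?_⟩
  · rw [← hom_eval₂, eval₂_mul, eval₂_pow, ← hab', map_mul, map_pow, map_mul]
    exact (hb.map _).mul (((hb'.map _).mul hu).pow n)
  · rw [← hom_eval₂, ← hom_eval₂, eval₂_mul, eval₂_mul, eval₂_pow, eval₂_pow, ← hab', ← hab]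
    simp only [map_mul, map_pow, ← he]
    ring

end FreeHom

section Localization

variable {V U : Type*} [CommRing V] [CommRing U] {f : V →+* U} {v : V} {h x : U}

/-- A point of `D(h) ⊆ Spec U` lying over `D(v) ⊆ Spec V` is a point of `D(f v)`. -/
theorem exists_ringHom_away_of_comp {T : Type*} [CommRing T] {σ : Localization.Away v →+* T}
    {g : Localization.Away h →+* T}
    (hg : g.comp ((algebraMap U (Localization.Away h)).comp f) =
      σ.comp (algebraMap V (Localization.Away v))) :
    ∃ g' : Localization.Away (f v) →+* T, g'.comp (Localization.awayMap f v) = σ ∧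
      g'.comp (algebraMap U (Localization.Away (f v))) =
        g.comp (algebraMap U (Localization.Away h)) := by
  have hunit : IsUnit ((g.comp (algebraMap U (Localization.Away h))) (f v)) := by
    have h1 := RingHom.congr_fun hg v
    simp only [RingHom.comp_apply] at h1 ⊢
    rw [h1]
    exact (IsLocalization.Away.algebraMap_isUnit v).map σ
  refine ⟨IsLocalization.Away.lift (f v) hunit, ?_, ?_⟩
  · refine IsLocalization.ringHom_ext (Submonoid.powers v) (RingHom.ext fun a => ?_)
    have h1 := RingHom.congr_fun hg a
    simp only [RingHom.comp_apply] at h1 ⊢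
    rw [← h1, Localization.awayMap, IsLocalization.Away.map, IsLocalization.map_eq,
      IsLocalization.Away.lift_eq, RingHom.comp_apply]
  · exact IsLocalization.Away.lift_comp (f v) hunit

theorem exists_ringHom_away_iff {K : Type*} [Field K] {σ : Localization.Away v →+* K} {c : K} :
    (∃ g : Localization.Away h →+* K,
      g.comp ((algebraMap U (Localization.Away h)).comp f) =
        σ.comp (algebraMap V (Localization.Away v)) ∧ g (algebraMap U _ x) = c) ↔
    ∃ g : Localization.Away (f v) →+* K, g.comp (Localization.awayMap f v) = σ ∧
      g (algebraMap U _ x) = c ∧ g (algebraMap U _ h) ≠ 0 := by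
  constructor
  · rintro ⟨g, hg, hx⟩
    obtain ⟨g', h1, h2⟩ := exists_ringHom_away_of_comp hg
    refine ⟨g', h1, (RingHom.congr_fun h2 x).trans hx, ?_⟩
    have h3 := RingHom.congr_fun h2 h
    simp only [RingHom.comp_apply] at h3
    rw [h3]
    exact ((IsLocalization.Away.algebraMap_isUnit h).map g).ne_zero
  · rintro ⟨g, hg, hx, hh⟩
    have hunit : IsUnit ((g.comp (algebraMap U (Localization.Away (f v)))) h) := IsUnit.mk0 _ hh
    refine ⟨IsLocalization.Away.lift h hunit, ?_, ?_⟩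
    · ext a
      have h1 := RingHom.congr_fun hg (algebraMap V _ a)
      simp only [RingHom.comp_apply] at h1 ⊢
      rw [IsLocalization.Away.lift_eq, ← h1, Localization.awayMap, IsLocalization.Away.map,
        IsLocalization.map_eq, RingHom.comp_apply]
    · rw [IsLocalization.Away.lift_eq]
      exact hx

/-- The points of `D(h) ⊆ Spec U` over a point `σ` of `D(v) ⊆ Spec V`, if `Spec U` is finite and
free over `D(v)`: the coordinate `x` identifies them with the roots of the fibre polynomial at
which `h`, written as a polynomial in `x`, does not vanish. -/
theorem exists_ringHom_away_iff_eval₂ (hfree : IsFreeHom (Localization.awayMap f v))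
    (hfin : (Localization.awayMap f v).Finite) (hgen : IsFractionGenerated f x) {H : V[X]}
    (hH : H.eval₂ f x = h) {K : Type*} [Field K] (σ : Localization.Away v →+* K) (c : K) :
    (∃ g : Localization.Away h →+* K,
      g.comp ((algebraMap U (Localization.Away h)).comp f) =
        σ.comp (algebraMap V (Localization.Away v)) ∧ g (algebraMap U _ x) = c) ↔
    (fiberPolynomial (Localization.awayMap f v) hfree hfin (algebraMap U _ x)).eval₂ σ c = 0 ∧
      H.eval₂ (σ.comp (algebraMap V (Localization.Away v))) c ≠ 0 := by
  have hcomp : (Localization.awayMap f v).comp (algebraMap V (Localization.Away v)) =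
      (algebraMap U (Localization.Away (f v))).comp f := by
    rw [Localization.awayMap, IsLocalization.Away.map, IsLocalization.map_comp]
  have hgen' : IsFractionGenerated (Localization.awayMap f v)
      (algebraMap U (Localization.Away (f v)) x) :=
    IsFractionGenerated.of_comp (hcomp ▸ hgen.comp_away (f v))
  rw [exists_ringHom_away_iff, eval₂_fiberPolynomial_eq_zero_iff hfree hfin hgen',
    ← exists_and_right]
  refine exists_congr fun g => ?_
  rw [and_assoc]
  refine and_congr_right fun hg => and_congr_right fun hx => ?_
  have : H.eval₂ (σ.comp (algebraMap V (Localization.Away v))) c =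
      g (algebraMap U (Localization.Away (f v)) h) := by
    rw [← hg, RingHom.comp_assoc, hcomp, ← hx, ← hH, hom_eval₂, hom_eval₂]
  rw [this]

/-- The number of points of the geometric fibre of `D(h) ⊆ Spec U` over a point of
`D(v) ⊆ Spec V`, if `Spec U` is finite and free over `D(v)`. -/
theorem card_primeSpectrum_away_tensorProduct (hfree : IsFreeHom (Localization.awayMap f v))
    (hfin : (Localization.awayMap f v).Finite) (hgen : IsFractionGenerated f x) {H : V[X]}
    (hH : H.eval₂ f x = h) {K : Type*} [Field K] [IsAlgClosed K] [Algebra V K]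
    (σ : Localization.Away v →+* K)
    (hσ : σ.comp (algebraMap V (Localization.Away v)) = algebraMap V K) :
    letI := ((algebraMap U (Localization.Away h)).comp f).toAlgebra
    ENat.card (PrimeSpectrum (Localization.Away h ⊗[V] K)) =
    {c : K | (fiberPolynomial (Localization.awayMap f v) hfree hfin
      (algebraMap U _ x)).eval₂ σ c = 0 ∧ H.eval₂ (algebraMap V K) c ≠ 0}.encard := by
  let inst := ((algebraMap U (Localization.Away h)).comp f).toAlgebra
  have hgenh : IsFractionGenerated (algebraMap V (Localization.Away h))
      (algebraMap U (Localization.Away h) x) := hgen.comp_away h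
  have hmonic := (fiberPolynomial_monic (Localization.awayMap f v) hfree hfin
    (algebraMap U _ x)).map σ
  refine (card_primeSpectrum_tensorProduct hgenh hmonic ?_).trans ?_
  · let ιL : Localization.Away h →+* Localization.Away h ⊗[V] K :=
      (Algebra.TensorProduct.includeLeft : _ →ₐ[V] Localization.Away h ⊗[V] K).toRingHom
    let ιR : K →+* Localization.Away h ⊗[V] K :=
      (Algebra.TensorProduct.includeRight : K →ₐ[V] Localization.Away h ⊗[V] K).toRingHom
    have h1 : ιL.comp ((algebraMap U (Localization.Away h)).comp f) =
        (ιR.comp σ).comp (algebraMap V (Localization.Away v)) := by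
      rw [RingHom.comp_assoc, hσ]
      ext a
      simp only [RingHom.comp_apply]
      exact ((Algebra.TensorProduct.includeLeft : _ →ₐ[V] Localization.Away h ⊗[V] K).commutes
        a).trans ((Algebra.TensorProduct.includeRight :
          K →ₐ[V] Localization.Away h ⊗[V] K).commutes a).symm
    obtain ⟨g', hg', hx⟩ := exists_ringHom_away_of_comp h1
    have h2 := congrArg g' (eval₂_fiberPolynomial_self (Localization.awayMap f v) hfree hfin
      (algebraMap U _ x))
    rw [hom_eval₂, hg', map_zero] at h2
    have h3 := RingHom.congr_fun hx x
    simp only [RingHom.comp_apply] at h3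
    rw [h3] at h2
    rw [eval₂_map]
    exact h2
  · congr 1
    ext c
    have h1 := exists_ringHom_away_iff_eval₂ (h := h) hfree hfin hgen hH σ c
    rw [hσ] at h1
    exact h1

end Localization

end GeomCAD

namespace GeomCAD

open Polynomial

/-! ### Immersions of affine schemes -/

section Immersions

variable {P E E' : Type*} [CommRing P] [CommRing E] [CommRing E']

/-- `Spec E ⟶ Spec P` is the immersion of a closed subscheme of the distinguished open `D(g)`: `g`
becomes invertible in `E`, and `E` is generated by the image of `P` and the inverse of `g`. -/
def IsImmersionInto (φ : P →+* E) (g : P) : Prop :=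
  IsUnit (φ g) ∧ ∀ e, ∃ (a : P) (n : ℕ), φ g ^ n * e = φ a

theorem isImmersionInto_of_surjective {φ : P →+* E} (hφ : Function.Surjective φ) :
    IsImmersionInto φ 1 :=
  ⟨by simp, fun e => by
    obtain ⟨a, rfl⟩ := hφ e
    exact ⟨a, 0, by simp⟩⟩

theorem isImmersionInto_away [Algebra E E'] (e : E) [IsLocalization.Away e E'] :
    IsImmersionInto (algebraMap E E') e :=
  ⟨IsLocalization.Away.algebraMap_isUnit e, fun z => by
    obtain ⟨n, a, h⟩ := IsLocalization.Away.surj e z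
    exact ⟨a, n, by rw [← h, mul_comm]⟩⟩

theorem IsImmersionInto.comp {φ : P →+* E} {g : P} (hφ : IsImmersionInto φ g) {ψ : E →+* E'}
    {e : E} (hψ : IsImmersionInto ψ e) : ∃ g', IsImmersionInto (ψ.comp φ) g' := by
  obtain ⟨a, k, ha⟩ := hφ.2 e
  refine ⟨g * a, ?_, fun z => ?_⟩
  · rw [RingHom.comp_apply, map_mul, ← ha, map_mul, map_mul]
    exact (hφ.1.map ψ).mul (((hφ.1.pow k).map ψ).mul hψ.1)
  · obtain ⟨z', n, hz⟩ := hψ.2 z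
    obtain ⟨b, m, hb⟩ := hφ.2 z'
    refine ⟨g ^ (n + k * n) * a ^ m * b, n + m, ?_⟩
    simp only [RingHom.comp_apply, map_mul, map_pow, ← ha, ← hb, ← hz]
    ring

theorem IsImmersionInto.ringHom_ext {φ : P →+* E} {g : P} (hφ : IsImmersionInto φ g)
    {θ θ' : E →+* E'} (h : θ.comp φ = θ'.comp φ) : θ = θ' := by
  ext e
  obtain ⟨a, n, ha⟩ := hφ.2 e
  have h1 := RingHom.congr_fun h a
  have h2 := RingHom.congr_fun h g
  simp only [RingHom.comp_apply] at h1 h2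
  rw [← ha, map_mul, map_mul, map_pow, map_pow, h2] at h1
  exact ((hφ.1.map θ').pow n).mul_left_cancel h1

theorem IsImmersionInto.isLocalization {φ : P →+* E} {g : P} (hφ : IsImmersionInto φ g) :
    letI := (RingHom.kerLift φ).toAlgebra
    IsLocalization.Away (Ideal.Quotient.mk (RingHom.ker φ) g) E := by
  let := (RingHom.kerLift φ).toAlgebra
  have hmk : ∀ a, algebraMap (P ⧸ RingHom.ker φ) E (Ideal.Quotient.mk _ a) = φ a :=
    fun a => RingHom.kerLift_mk φ a
  refine ⟨⟨?_, fun e => ?_, fun {x y} hxy => ⟨1, ?_⟩⟩⟩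
  · rintro ⟨_, n, rfl⟩
    simp only [map_pow, hmk]
    exact hφ.1.pow n
  · obtain ⟨a, n, ha⟩ := hφ.2 e
    refine ⟨⟨Ideal.Quotient.mk _ a, ⟨_, n, rfl⟩⟩, ?_⟩
    simp only [map_pow, hmk]
    rw [← ha, mul_comm]
  · rw [RingHom.kerLift_injective φ hxy]

/-- The points of a locally closed subscheme: `F` vanishes and `g` does not. -/
theorem IsImmersionInto.exists_comp_eq_iff {φ : P →+* E} {g : P} (hφ : IsImmersionInto φ g)
    {F : Set P} (hF : Ideal.span F = RingHom.ker φ) {K : Type*} [Field K] (θ : P →+* K) :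
    (∃ θ' : E →+* K, θ'.comp φ = θ) ↔ (∀ f ∈ F, θ f = 0) ∧ θ g ≠ 0 := by
  constructor
  · rintro ⟨θ', rfl⟩
    refine ⟨fun f hf => ?_, (hφ.1.map θ').ne_zero⟩
    have : φ f = 0 := by
      rw [← RingHom.mem_ker, ← hF]
      exact Ideal.subset_span hf
    rw [RingHom.comp_apply, this, map_zero]
  · rintro ⟨h1, h2⟩
    have hker : ∀ a ∈ RingHom.ker φ, θ a = 0 := by
      rw [← hF]
      have : Ideal.span F ≤ RingHom.ker θ := Ideal.span_le.mpr h1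
      exact this
    let := (RingHom.kerLift φ).toAlgebra
    have := hφ.isLocalization
    have hunit : IsUnit (Ideal.Quotient.lift _ θ hker (Ideal.Quotient.mk (RingHom.ker φ) g)) := by
      rw [Ideal.Quotient.lift_mk]
      exact IsUnit.mk0 _ h2
    refine ⟨IsLocalization.Away.lift _ hunit, ?_⟩
    ext a
    have h3 : φ a = algebraMap (P ⧸ RingHom.ker φ) E (Ideal.Quotient.mk _ a) :=
      (RingHom.kerLift_mk φ a).symm
    rw [RingHom.comp_apply, h3, IsLocalization.Away.lift_eq, Ideal.Quotient.lift_mk]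

theorem IsImmersionInto.range_comap {φ : P →+* E} {g : P} (hφ : IsImmersionInto φ g)
    {F : Set P} (hF : Ideal.span F = RingHom.ker φ) :
    Set.range (PrimeSpectrum.comap φ) = PrimeSpectrum.zeroLocus F ∩
      (PrimeSpectrum.basicOpen g : Set (PrimeSpectrum P)) := by
  let := (RingHom.kerLift φ).toAlgebra
  have := hφ.isLocalization
  have h1 : φ = (algebraMap (P ⧸ RingHom.ker φ) E).comp (Ideal.Quotient.mk _) :=
    RingHom.ext fun a => (RingHom.kerLift_mk φ a).symm
  have h2 := PrimeSpectrum.localization_away_comap_range E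
    (Ideal.Quotient.mk (RingHom.ker φ) g)
  have h3 := range_comap_of_surjective _ (Ideal.Quotient.mk (RingHom.ker φ))
    Ideal.Quotient.mk_surjective
  rw [Ideal.mk_ker, ← hF, PrimeSpectrum.zeroLocus_span, hF] at h3
  have h4 : Set.range (PrimeSpectrum.comap φ) =
      PrimeSpectrum.comap (Ideal.Quotient.mk (RingHom.ker φ)) ''
        Set.range (PrimeSpectrum.comap (algebraMap (P ⧸ RingHom.ker φ) E)) := by
    conv_lhs => rw [h1, PrimeSpectrum.comap_comp]
    exact Set.range_comp _ _
  rw [h4, h2, ← h3, Set.inter_comm, ← Set.image_preimage_eq_inter_range]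
  rfl

/-- A polynomial over `E` comes from one over `P`, up to a unit. -/
theorem IsImmersionInto.exists_map_eq {φ : P →+* E} {g : P} (hφ : IsImmersionInto φ g) {N : ℕ}
    (p : E[X]) (hp : p.natDegree ≤ N) :
    ∃ (q : P[X]) (n : ℕ), q.natDegree ≤ N ∧ q.map φ = C (φ g ^ n) * p := by
  choose a m hm using fun j => hφ.2 (p.coeff j)
  set n := ∑ j ∈ Finset.range (N + 1), m j with hn
  refine ⟨∑ j ∈ Finset.range (N + 1), C (g ^ (n - m j) * a j) * X ^ j, n, ?_, ?_⟩
  · exact natDegree_sum_le_of_forall_le _ _ fun j hj =>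
      (natDegree_C_mul_X_pow_le _ _).trans (Nat.lt_succ_iff.mp (Finset.mem_range.mp hj))
  · conv_rhs => rw [p.as_sum_range_C_mul_X_pow' (Nat.lt_succ_of_le hp)]
    rw [Polynomial.map_sum, Finset.mul_sum]
    refine Finset.sum_congr rfl fun j hj => ?_
    have hle : m j ≤ n := Finset.single_le_sum (f := m) (fun _ _ => Nat.zero_le _) hj
    rw [Polynomial.map_mul, map_C, Polynomial.map_pow, map_X, ← mul_assoc, ← C_mul, map_mul,
      map_pow, ← hm j, ← mul_assoc, ← pow_add, Nat.sub_add_cancel hle]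

end Immersions

section AdjoinCoordinate

variable {R : Type*} [CommRing R] {n : ℕ} {T T' : Type*} [CommRing T] [CommRing T']

/-- The homomorphism from the polynomial ring in `n + 1` variables given by a homomorphism from
the polynomial ring in the first `n` variables and the value of the last variable. -/
noncomputable def snocHom (σ : MvPolynomial (Fin n) R →+* T) (c : T) :
    MvPolynomial (Fin (n + 1)) R →+* T :=
  MvPolynomial.eval₂Hom (σ.comp MvPolynomial.C)
    (Fin.snoc (α := fun _ => T) (fun j => σ (MvPolynomial.X j)) c)

theorem snocHom_eq (φ : MvPolynomial (Fin (n + 1)) R →+* T) :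
    snocHom (φ.comp (MvPolynomial.rename Fin.castSucc).toRingHom) (φ (MvPolynomial.X (Fin.last n)))
      = φ := by
  refine MvPolynomial.ringHom_ext (fun r => ?_) fun i => ?_
  · simp [snocHom]
  · refine Fin.lastCases ?_ (fun i => ?_) i
    · simp [snocHom]
    · simp [snocHom]

theorem comp_snocHom (g : T →+* T') (σ : MvPolynomial (Fin n) R →+* T) (c : T) :
    g.comp (snocHom σ c) = snocHom (g.comp σ) (g c) := by
  refine MvPolynomial.ringHom_ext (fun r => ?_) fun i => ?_
  · simp [snocHom]
  · refine Fin.lastCases ?_ (fun i => ?_) i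
    · simp [snocHom]
    · simp [snocHom]

theorem snocHom_comp_rename (σ : MvPolynomial (Fin n) R →+* T) (c : T) :
    (snocHom σ c).comp (MvPolynomial.rename Fin.castSucc).toRingHom = σ := by
  refine MvPolynomial.ringHom_ext (fun r => ?_) fun i => ?_
  · simp [snocHom]
  · simp [snocHom]

theorem snocHom_X_last (σ : MvPolynomial (Fin n) R →+* T) (c : T) :
    snocHom σ c (MvPolynomial.X (Fin.last n)) = c := by
  simp [snocHom]

/-- A polynomial in `n + 1` variables as a polynomial in the last one, with coefficients mapped to
`T`. -/
noncomputable def polynomialInLast (σ : MvPolynomial (Fin n) R →+* T) :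
    MvPolynomial (Fin (n + 1)) R →+* T[X] :=
  snocHom (Polynomial.C.comp σ) Polynomial.X

theorem eval₂_polynomialInLast (σ : MvPolynomial (Fin n) R →+* T) (τ : T →+* T') (c : T')
    (p : MvPolynomial (Fin (n + 1)) R) :
    (polynomialInLast σ p).eval₂ τ c = snocHom (τ.comp σ) c p := by
  have h := comp_snocHom (Polynomial.eval₂RingHom τ c) (Polynomial.C.comp σ) Polynomial.X
  rw [← RingHom.comp_assoc, coe_eval₂RingHom, eval₂_X] at h
  have h2 : (Polynomial.eval₂RingHom τ c).comp Polynomial.C = τ := RingHom.ext fun a => by simp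
  rw [h2] at h
  exact RingHom.congr_fun h p

end AdjoinCoordinate

end GeomCAD

namespace GeomCAD

open Polynomial Topology

/-! ### Families of polynomials over the real points of an affine scheme -/

section Families

variable {R : Type*} [Field R] [LinearOrder R] [IsStrictOrderedRing R] [TopologicalSpace R]
  [OrderTopology R]

/-- Two functions which are lower semicontinuous for polynomial reasons and whose sum is constant
are constant on a semi-algebraically connected set. -/
theorem IsSemialgebraicallyConnected.eq_of_add_eq {ι : Type*} {s : Set (ι → R)}
    (hconn : IsSemialgebraicallyConnected s) (hs : IsSemialgebraic s) {f g : (ι → R) → ℕ}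
    {F G : ℕ → MvPolynomial ι R}
    (hF : ∀ a ∈ s, ∀ m, MvPolynomial.eval a (F m) ≠ 0 ↔ m ≤ f a)
    (hG : ∀ a ∈ s, ∀ m, MvPolynomial.eval a (G m) ≠ 0 ↔ m ≤ g a)
    (hadd : ∀ a ∈ s, ∀ b ∈ s, f a + g a = f b + g b) {a b : ι → R} (ha : a ∈ s) (hb : b ∈ s) :
    f b = f a := by
  refine hconn.eq_of_eventually_eq hs (fun m => ?_) (fun a ha => ?_) ha hb
  · refine (congrArg IsSemialgebraic ?_).mp (hs.inter
      ((isSemialgebraic_setOf_eval_ne_zero (F m)).inter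
      (isSemialgebraic_setOf_eval_eq_zero (F (m + 1)))))
    ext a
    refine and_congr_right fun ha => ?_
    have h1 := hF a ha m
    simp only [Set.mem_inter_iff, Set.mem_ofPred_eq, h1]
    have h2 : MvPolynomial.eval a (F (m + 1)) = 0 ↔ ¬ m + 1 ≤ f a := by
      rw [← hF a ha (m + 1), not_not]
    rw [h2]
    omega
  · have h1 := (MvPolynomial.continuous_eval (F (f a))).continuousAt.eventually_ne
      ((hF a ha _).mpr le_rfl)
    have h2 := (MvPolynomial.continuous_eval (G (g a))).continuousAt.eventually_ne
      ((hG a ha _).mpr le_rfl)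
    filter_upwards [nhdsWithin_le_nhds h1, nhdsWithin_le_nhds h2, self_mem_nhdsWithin]
      with b h3 h4 hb
    have h5 := (hF b hb _).mp h3
    have h6 := (hG b hb _).mp h4
    have h7 := hadd a ha b hb
    omega

variable {D : Type*} [CommRing D] [Algebra R D] {n : ℕ}

theorem map_eq_eval_coords {F E : Type*} [Field F] [CommRing E] [Algebra F E] {n : ℕ}
    {χ : MvPolynomial (Fin n) F →+* E} (hχ : ∀ r, χ (MvPolynomial.C r) = algebraMap F E r)
    (y : E →ₐ[F] F) (f : MvPolynomial (Fin n) F) :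
    y (χ f) = MvPolynomial.eval (coords χ y) f := by
  have h : (y : E →+* F).comp χ = MvPolynomial.eval (coords χ y) := by
    refine MvPolynomial.ringHom_ext (fun r => ?_) fun i => ?_
    · simp [hχ]
    · simp [coords]
  exact RingHom.congr_fun h f

theorem coords_injective {F E : Type*} [Field F] [CommRing E] [Algebra F E] {n : ℕ}
    {χ : MvPolynomial (Fin n) F →+* E} (hχ : ∀ r, χ (MvPolynomial.C r) = algebraMap F E r)
    {g : MvPolynomial (Fin n) F} (himm : IsImmersionInto χ g) :
    Function.Injective fun y : E →ₐ[F] F => coords χ y := by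
  intro y y' h
  have h1 : (y : E →+* F) = (y' : E →+* F) := by
    refine himm.ringHom_ext (RingHom.ext fun f => ?_)
    have h2 : y (χ f) = y' (χ f) := by
      rw [map_eq_eval_coords hχ, map_eq_eval_coords hχ]
      exact congrArg (fun a => MvPolynomial.eval a f) h
    exact h2
  exact AlgHom.ext fun d => RingHom.congr_fun h1 d

/-- If the roots of `Q` are among those of `P`, then the roots of `P` at which `H` does not vanish
are those of `Q` together with those at which `Q` does not vanish either. -/
theorem natDegree_activeFactor_add {k : Type*} [Field k] [CharZero k] {P Q : k[X]} (hP : P ≠ 0)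
    (hQ : Q ≠ 0) (H : k[X])
    (hinc : ∀ c : AlgebraicClosure k, Q.eval₂ (algebraMap k _) c = 0 →
      P.eval₂ (algebraMap k _) c = 0) :
    (activeFactor P H).natDegree =
      (activeFactor Q H).natDegree + (activeFactor P (H * Q)).natDegree := by
  have h1 := encard_setOf_eval₂_eq_zero_and_ne_zero hP H (algebraMap k (AlgebraicClosure k))
  have h2 := encard_setOf_eval₂_eq_zero_and_ne_zero hQ H (algebraMap k (AlgebraicClosure k))
  have h3 := encard_setOf_eval₂_eq_zero_and_ne_zero hP (H * Q) (algebraMap k (AlgebraicClosure k))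
  rw [← Nat.cast_inj (R := ℕ∞), Nat.cast_add, ← h1, ← h2, ← h3, ← Set.encard_union_eq]
  · congr 1
    ext c
    simp only [Set.mem_union, Set.mem_ofPred_eq, eval₂_mul, mul_ne_zero_iff]
    have := hinc c
    tauto
  · refine Set.disjoint_left.mpr fun c hc hc' => ?_
    simp only [Set.mem_ofPred_eq, eval₂_mul, mul_ne_zero_iff] at hc hc'
    exact hc'.2.2 hc.1

/-- Let `P`, `Q` be monic polynomials such that the roots of `Q` are roots of `P`. If the number
of roots of `P` at which `H` does not vanish is constant, then so is that for `Q`. -/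
theorem natDegree_activeFactor_eq_of_connected {χ : MvPolynomial (Fin n) R →+* D}
    (hχ : ∀ r, χ (MvPolynomial.C r) = algebraMap R D r) {g : MvPolynomial (Fin n) R}
    (himm : IsImmersionInto χ g) {S : Set (D →ₐ[R] R)}
    (hS : IsSemialgebraic (coords χ '' S)) (hconn : IsSemialgebraicallyConnected (coords χ '' S))
    {P Q : D[X]} (hP : P.Monic) (hQ : Q.Monic) (H : D[X])
    (hinc : ∀ y ∈ S, ∀ c : AlgebraicClosure R,
      (Q.map (y : D →+* R)).eval₂ (algebraMap R _) c = 0 →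
      (P.map (y : D →+* R)).eval₂ (algebraMap R _) c = 0)
    (hconst : ∀ y₁ ∈ S, ∀ y₂ ∈ S,
      (activeFactor (P.map (y₁ : D →+* R)) (H.map (y₁ : D →+* R))).natDegree =
      (activeFactor (P.map (y₂ : D →+* R)) (H.map (y₂ : D →+* R))).natDegree)
    {y₁ y₂ : D →ₐ[R] R} (hy₁ : y₁ ∈ S) (hy₂ : y₂ ∈ S) :
    (activeFactor (Q.map (y₁ : D →+* R)) (H.map (y₁ : D →+* R))).natDegree =
      (activeFactor (Q.map (y₂ : D →+* R)) (H.map (y₂ : D →+* R))).natDegree := by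
  classical
  -- every element of `D` has the same zeros as a polynomial
  have hpoly : ∀ d : D, ∃ f : MvPolynomial (Fin n) R, ∀ y : D →ₐ[R] R,
      MvPolynomial.eval (coords χ y) f ≠ 0 ↔ y d ≠ 0 := by
    intro d
    obtain ⟨f, m, hf⟩ := himm.2 d
    refine ⟨f, fun y => ?_⟩
    rw [← map_eq_eval_coords hχ, ← hf, map_mul, map_pow, mul_ne_zero_iff]
    have : y (χ g) ≠ 0 := (himm.1.map y).ne_zero
    simp [this]
  choose poly hpoly using hpoly
  let pt : (Fin n → R) → (D →ₐ[R] R) := fun a =>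
    if h : ∃ y ∈ S, coords χ y = a then h.choose else y₁
  have hpt : ∀ y ∈ S, pt (coords χ y) = y := by
    intro y hy
    have h : ∃ y' ∈ S, coords χ y' = coords χ y := ⟨y, hy, rfl⟩
    simp only [pt, dif_pos h]
    exact coords_injective hχ himm h.choose_spec.2
  let count : D[X] → D[X] → (Fin n → R) → ℕ := fun p q a =>
    (activeFactor (p.map (pt a : D →+* R)) (q.map (pt a : D →+* R))).natDegree
  have hcount : ∀ p q : D[X], p.Monic → ∀ a ∈ coords χ '' S, ∀ m,
      MvPolynomial.eval a (poly (gramDet p.natDegree m p q)) ≠ 0 ↔ m ≤ count p q a := by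
    rintro p q hp _ ⟨y, hy, rfl⟩ m
    have h1 := gramDet_ne_zero_iff (m := m) (hp.map (y : D →+* R)) (q.map (y : D →+* R))
    rw [hp.natDegree_map, gramDet_map (y : D →+* R) _ _ hp] at h1
    rw [hpoly]
    simp only [count, hpt y hy]
    exact h1
  have hadd : ∀ a ∈ coords χ '' S, ∀ b ∈ coords χ '' S,
      count Q H a + count P (H * Q) a = count Q H b + count P (H * Q) b := by
    have h1 : ∀ y ∈ S, count Q H (coords χ y) + count P (H * Q) (coords χ y) =
        (activeFactor (P.map (y : D →+* R)) (H.map (y : D →+* R))).natDegree := by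
      intro y hy
      simp only [count, hpt y hy, Polynomial.map_mul]
      exact (natDegree_activeFactor_add (hP.map _).ne_zero (hQ.map _).ne_zero _
        (hinc y hy)).symm
    rintro _ ⟨y, hy, rfl⟩ _ ⟨y', hy', rfl⟩
    rw [h1 y hy, h1 y' hy']
    exact hconst y hy y' hy'
  have := hconn.eq_of_add_eq hS (hcount Q H hQ) (hcount P (H * Q) hP) hadd
    (Set.mem_image_of_mem _ hy₂) (Set.mem_image_of_mem _ hy₁)
  simpa only [count, hpt y₁ hy₁, hpt y₂ hy₂] using this

/-- If the number of roots of the monic polynomial `Q` at which `H` does not vanish is constant,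
then the real ones are given by continuous semi-algebraic sections. -/
theorem exists_activeRoot_sections [IsRealClosed R] {χ : MvPolynomial (Fin n) R →+* D}
    (hχ : ∀ r, χ (MvPolynomial.C r) = algebraMap R D r) {g : MvPolynomial (Fin n) R}
    (himm : IsImmersionInto χ g) {S : Set (D →ₐ[R] R)}
    (hS : IsSemialgebraic (coords χ '' S)) (hconn : IsSemialgebraicallyConnected (coords χ '' S))
    {Q : D[X]} (hQ : Q.Monic) (H : D[X]) {N : ℕ}
    (hN : ∀ y ∈ S, (activeFactor (Q.map (y : D →+* R)) (H.map (y : D →+* R))).natDegree = N) :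
    ∃ (k : ℕ) (ξ : Fin k → (Fin n → R) → R), (∀ i, ContinuousOn (ξ i) (coords χ '' S)) ∧
      (∀ a ∈ coords χ '' S, StrictMono fun i => ξ i a) ∧
      (∀ y ∈ S, ∀ t, (Q.eval₂ (y : D →+* R) t = 0 ∧ H.eval₂ (y : D →+* R) t ≠ 0) ↔
        ∃ i, t = ξ i (coords χ y)) ∧
      ∀ i, IsSemialgebraicOn (fun a => Fin.snoc (α := fun _ => R) a (ξ i a)) (coords χ '' S) := by
  obtain ⟨q, m, hq, hqmap⟩ := himm.exists_map_eq (cramerFactor Q.natDegree N Q H)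
    (natDegree_cramerFactor_le _ _ _ _)
  -- over `S`, the polynomial `q` is a nonzero multiple of the separable polynomial `activeFactor`
  have key : ∀ y ∈ S, ∃ u : R, u ≠ 0 ∧ specialize q (coords χ y) =
      C u * activeFactor (Q.map (y : D →+* R)) (H.map (y : D →+* R)) := by
    intro y hy
    have h1 : specialize q (coords χ y) = (q.map χ).map (y : D →+* R) := by
      rw [specialize, Polynomial.map_map]
      congr 1
      exact RingHom.ext fun f => (map_eq_eval_coords hχ y f).symm
    have h2 := cramerFactor_eq (hQ.map (y : D →+* R)) (H.map (y : D →+* R))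
    have h3 := (gramDet_ne_zero_iff (m := N) (hQ.map (y : D →+* R)) (H.map (y : D →+* R))).mpr
      (hN y hy).ge
    rw [hN y hy, hQ.natDegree_map, cramerFactor_map _ _ _ hQ] at h2
    rw [hQ.natDegree_map] at h3
    refine ⟨y (χ g) ^ m * gramDet Q.natDegree N (Q.map (y : D →+* R)) (H.map (y : D →+* R)),
      mul_ne_zero (pow_ne_zero _ (himm.1.map y).ne_zero) h3, ?_⟩
    rw [h1, hqmap, Polynomial.map_mul, h2, map_C, C_mul, mul_assoc]
    simp
  have hsep : ∀ a ∈ coords χ '' S, (specialize q a).Separable := by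
    rintro _ ⟨y, hy, rfl⟩
    obtain ⟨u, hu, h⟩ := key y hy
    rw [h]
    exact (activeFactor_separable (hQ.map _).ne_zero _).of_dvd
      ((isUnit_C.mpr hu.isUnit).mul_left_dvd.mpr dvd_rfl)
  have hlead : ∀ a ∈ coords χ '' S, MvPolynomial.eval a (q.coeff N) ≠ 0 := by
    rintro _ ⟨y, hy, rfl⟩
    obtain ⟨u, hu, h⟩ := key y hy
    have h1 : MvPolynomial.eval (coords χ y) (q.coeff N) = (specialize q (coords χ y)).coeff N := by
      rw [coeff_map]
    have h2 := (activeFactor_monic (hQ.map (y : D →+* R)).ne_zero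
      (H.map (y : D →+* R))).coeff_natDegree
    rw [hN y hy] at h2
    rw [h1, h, coeff_C_mul, h2, mul_one]
    exact hu
  obtain ⟨k, ξ, h1, h2, h3, h4⟩ := exists_root_sections hq hS hconn hlead hsep
  refine ⟨k, ξ, h1, h2, fun y hy t => ?_, h4⟩
  rw [← h3 _ (Set.mem_image_of_mem _ hy)]
  obtain ⟨u, hu, h⟩ := key y hy
  have h5 := eval₂_activeFactor_eq_zero_iff (hQ.map (y : D →+* R)).ne_zero (H.map (y : D →+* R))
    (RingHom.id R) t
  simp only [eval₂_id, eval₂_map, RingHom.id_comp] at h5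
  rw [← h5, h, IsRoot.def, eval_mul, eval_C, mul_eq_zero, or_iff_right hu]

end Families

end GeomCAD

namespace GeomCAD

open Polynomial

/-! ### Delineability of a family of roots -/

section RootFamily

universe u

variable {R : Type u} [Field R] {V D E : Type*} [CommRing V] [CommRing D] [CommRing E]
  [Algebra R D] {n : ℕ}

/-- `Spec E` lies over `Spec V`, and over the `R`-points of `Spec D ⟶ Spec V` it consists, with
respect to the coordinate `x`, of the roots of `Q` at which `H` does not vanish. The points are
taken in all fields `K` containing `R`; the cases `K = R` and `K` an algebraic closure are the ones
of interest. -/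
def IsRootFamily (F : V →+* E) (κ : V →+* D) (x : E) (Q H : D[X]) : Prop :=
  ∀ (K : Type u) [Field K] (τ : R →+* K) (y : D →ₐ[R] R) (c : K),
    (∃ g : E →+* K, g.comp F = (τ.comp (y : D →+* R)).comp κ ∧ g x = c) ↔
      Q.eval₂ (τ.comp (y : D →+* R)) c = 0 ∧ H.eval₂ (τ.comp (y : D →+* R)) c ≠ 0

/-- A point of `Spec E` lies over a given point of affine `(n + 1)`-space iff it lies over the
corresponding point of `Spec V` and has the right last coordinate. -/
theorem comp_eq_snocHom_iff {R V E : Type*} [Field R] [CommRing V] [CommRing E] {n : ℕ}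
    {F : V →+* E} {θ : MvPolynomial (Fin n) R →+* V}
    {Φ : MvPolynomial (Fin (n + 1)) R →+* E} {gθ : MvPolynomial (Fin n) R}
    (hθ : IsImmersionInto θ gθ)
    (hcomm : Φ.comp (MvPolynomial.rename Fin.castSucc).toRingHom = F.comp θ)
    {K : Type*} [Field K] (g : E →+* K) (σ : V →+* K) (c : K) :
    g.comp Φ = snocHom (σ.comp θ) c ↔
      g.comp F = σ ∧ g (Φ (MvPolynomial.X (Fin.last n))) = c := by
  constructor
  · intro h
    constructor
    · refine hθ.ringHom_ext ?_
      rw [RingHom.comp_assoc, ← hcomm, ← RingHom.comp_assoc, h, snocHom_comp_rename]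
    · have := RingHom.congr_fun h (MvPolynomial.X (Fin.last n))
      rwa [snocHom_X_last] at this
  · rintro ⟨rfl, rfl⟩
    rw [← snocHom_eq (g.comp Φ), RingHom.comp_assoc, hcomm, RingHom.comp_assoc]
    rfl

theorem snocHom_algebraMap_comp_coords {χ : MvPolynomial (Fin n) R →+* D}
    (hχ : ∀ r, χ (MvPolynomial.C r) = algebraMap R D r) {K : Type*} [Field K] [Algebra R K]
    (y : D →ₐ[R] R) (c : K) (f : MvPolynomial (Fin (n + 1)) R) :
    snocHom (((algebraMap R K).comp (y : D →+* R)).comp χ) c f =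
      MvPolynomial.aeval (Fin.snoc (α := fun _ => K)
        (fun j => algebraMap R K (coords χ y j)) c) f := by
  have h : snocHom (((algebraMap R K).comp (y : D →+* R)).comp χ) c =
      (MvPolynomial.aeval (R := R) (Fin.snoc (α := fun _ => K)
        (fun j => algebraMap R K (coords χ y j)) c)).toRingHom := by
    refine MvPolynomial.ringHom_ext (fun r => ?_) fun i => ?_
    · simp [snocHom, hχ]
    · simp [snocHom, coords]
  exact RingHom.congr_fun h f

variable {F : V →+* E} {κ : V →+* D} {θ : MvPolynomial (Fin n) R →+* V}
  {Φ : MvPolynomial (Fin (n + 1)) R →+* E} {gθ : MvPolynomial (Fin n) R}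
  {g : MvPolynomial (Fin (n + 1)) R} {Q H : D[X]}

/-- The points of the locally closed set `V(F₀) ∩ D(g)` above an `R`-point `y`, with coordinates
in an extension field of `R`. -/
theorem IsRootFamily.aeval_snoc_iff
    (hroot : IsRootFamily (R := R) F κ (Φ (MvPolynomial.X (Fin.last n))) Q H)
    (hθ : IsImmersionInto θ gθ) (hΦ : IsImmersionInto Φ g)
    (hcomm : Φ.comp (MvPolynomial.rename Fin.castSucc).toRingHom = F.comp θ)
    (hχ : ∀ r, (κ.comp θ) (MvPolynomial.C r) = algebraMap R D r)
    {F₀ : Set (MvPolynomial (Fin (n + 1)) R)} (hF₀ : Ideal.span F₀ = RingHom.ker Φ)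
    {K : Type u} [Field K] [Algebra R K] (y : D →ₐ[R] R) (c : K) :
    ((∀ f ∈ F₀, MvPolynomial.aeval (Fin.snoc (α := fun _ => K)
        (fun j => algebraMap R K (coords (κ.comp θ) y j)) c) f = 0) ∧
      MvPolynomial.aeval (Fin.snoc (α := fun _ => K)
        (fun j => algebraMap R K (coords (κ.comp θ) y j)) c) g ≠ 0) ↔
      Q.eval₂ ((algebraMap R K).comp (y : D →+* R)) c = 0 ∧
        H.eval₂ ((algebraMap R K).comp (y : D →+* R)) c ≠ 0 := by
  rw [← hroot K (algebraMap R K) y c]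
  simp only [← snocHom_algebraMap_comp_coords hχ]
  rw [← hΦ.exists_comp_eq_iff hF₀, ← RingHom.comp_assoc]
  simp only [comp_eq_snocHom_iff hθ hcomm]

theorem IsRootFamily.encard_complexSolutions [CharZero R]
    (hroot : IsRootFamily (R := R) F κ (Φ (MvPolynomial.X (Fin.last n))) Q H)
    (hθ : IsImmersionInto θ gθ) (hΦ : IsImmersionInto Φ g)
    (hcomm : Φ.comp (MvPolynomial.rename Fin.castSucc).toRingHom = F.comp θ)
    (hχ : ∀ r, (κ.comp θ) (MvPolynomial.C r) = algebraMap R D r) (hQ : Q.Monic)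
    {F₀ : Finset (MvPolynomial (Fin (n + 1)) R)}
    (hF₀ : Ideal.span (F₀ : Set (MvPolynomial (Fin (n + 1)) R)) = RingHom.ker Φ)
    (y : D →ₐ[R] R) :
    (complexSolutions F₀ g (coords (κ.comp θ) y)).encard =
      (activeFactor (Q.map (y : D →+* R)) (H.map (y : D →+* R))).natDegree := by
  rw [← encard_setOf_eval₂_eq_zero_and_ne_zero (hQ.map (y : D →+* R)).ne_zero
    (H.map (y : D →+* R)) (algebraMap R (AlgebraicClosure R))]
  congr 1
  ext c
  have := hroot.aeval_snoc_iff hθ hΦ hcomm hχ hF₀ y c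
  simp only [eval₂_map]
  exact this

theorem IsRootFamily.snoc_mem_realLocus_iff
    (hroot : IsRootFamily (R := R) F κ (Φ (MvPolynomial.X (Fin.last n))) Q H)
    (hθ : IsImmersionInto θ gθ) (hΦ : IsImmersionInto Φ g)
    (hcomm : Φ.comp (MvPolynomial.rename Fin.castSucc).toRingHom = F.comp θ)
    (hχ : ∀ r, (κ.comp θ) (MvPolynomial.C r) = algebraMap R D r)
    {F₀ : Finset (MvPolynomial (Fin (n + 1)) R)}
    (hF₀ : Ideal.span (F₀ : Set (MvPolynomial (Fin (n + 1)) R)) = RingHom.ker Φ)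
    (y : D →ₐ[R] R) (t : R) :
    Fin.snoc (α := fun _ => R) (coords (κ.comp θ) y) t ∈ realLocus F₀ g ↔
      Q.eval₂ (y : D →+* R) t = 0 ∧ H.eval₂ (y : D →+* R) t ≠ 0 :=
  hroot.aeval_snoc_iff hθ hΦ hcomm hχ hF₀ y t

variable [Algebra R E]

theorem coords_eq_snoc_of_comp_eq
    (hcomm : Φ.comp (MvPolynomial.rename Fin.castSucc).toRingHom = F.comp θ)
    {y : D →ₐ[R] R} {u : E →ₐ[R] R} (hu : (u : E →+* R).comp F = (y : D →+* R).comp κ) :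
    coords Φ u = Fin.snoc (α := fun _ => R) (coords (κ.comp θ) y)
      (u (Φ (MvPolynomial.X (Fin.last n)))) := by
  ext j
  refine Fin.lastCases ?_ (fun j => ?_) j
  · simp [coords]
  · have h1 := RingHom.congr_fun hcomm (MvPolynomial.X j)
    have h2 := RingHom.congr_fun hu (θ (MvPolynomial.X j))
    simp only [AlgHom.toRingHom_eq_coe, RingHom.comp_apply, RingHom.coe_coe,
      MvPolynomial.rename_X] at h1 h2
    simp [coords, h1, h2]

/-- The real points above an `R`-point `y` are given by the coordinate `x`. -/
theorem IsRootFamily.exists_algHom_iff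
    (hroot : IsRootFamily (R := R) F κ (Φ (MvPolynomial.X (Fin.last n))) Q H)
    (hθ : IsImmersionInto θ gθ)
    (hcomm : Φ.comp (MvPolynomial.rename Fin.castSucc).toRingHom = F.comp θ)
    (hχ : ∀ r, (κ.comp θ) (MvPolynomial.C r) = algebraMap R D r)
    (hΦC : ∀ r, Φ (MvPolynomial.C r) = algebraMap R E r) (y : D →ₐ[R] R) (t : R) :
    (∃ u : E →ₐ[R] R, (u : E →+* R).comp F = (y : D →+* R).comp κ ∧
      u (Φ (MvPolynomial.X (Fin.last n))) = t) ↔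
      Q.eval₂ (y : D →+* R) t = 0 ∧ H.eval₂ (y : D →+* R) t ≠ 0 := by
  refine Iff.trans ⟨?_, ?_⟩ (hroot R (RingHom.id R) y t)
  · rintro ⟨u, hu, ht⟩
    exact ⟨u, hu, ht⟩
  · rintro ⟨u, hu, ht⟩
    refine ⟨⟨u, fun r => ?_⟩, hu, ht⟩
    have h1 := (comp_eq_snocHom_iff hθ hcomm u _ t).mpr ⟨hu, ht⟩
    have h2 := RingHom.congr_fun h1 (MvPolynomial.C r)
    have h3 := hχ r
    simp only [RingHom.comp_apply, hΦC] at h2 h3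
    change u (algebraMap R E r) = r
    rw [h2]
    simp [snocHom, h3]

theorem algHom_eq_of_comp_eq (hθ : IsImmersionInto θ gθ) (hΦ : IsImmersionInto Φ g)
    (hcomm : Φ.comp (MvPolynomial.rename Fin.castSucc).toRingHom = F.comp θ)
    {u u' : E →ₐ[R] R} (h : (u : E →+* R).comp F = (u' : E →+* R).comp F)
    (hx : u (Φ (MvPolynomial.X (Fin.last n))) = u' (Φ (MvPolynomial.X (Fin.last n)))) :
    u = u' := by
  have h1 : (u : E →+* R) = (u' : E →+* R) := by
    refine hΦ.ringHom_ext ?_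
    rw [(comp_eq_snocHom_iff hθ hcomm (u : E →+* R) _ _).mpr ⟨rfl, rfl⟩]
    exact ((comp_eq_snocHom_iff hθ hcomm (u' : E →+* R) _ _).mpr ⟨h.symm, hx.symm⟩).symm
  exact AlgHom.ext fun e => RingHom.congr_fun h1 e

theorem isGeometricallyDelineable_empty {R : Type*} [Field R] [LinearOrder R] [TopologicalSpace R]
    {E : Type*} [CommRing E] {n : ℕ} {Φ : MvPolynomial (Fin (n + 1)) R →+* E}
    {g : MvPolynomial (Fin (n + 1)) R} (hΦ : IsImmersionInto Φ g) :
    IsGeometricallyDelineable (Set.range (PrimeSpectrum.comap Φ)) (∅ : Set (Fin n → R)) := by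
  obtain ⟨F₀, hF₀⟩ := IsNoetherian.noetherian (RingHom.ker Φ)
  exact ⟨F₀, g, hΦ.range_comap hF₀, ⟨0, by simp⟩,
    0, fun i => i.elim0, fun i => i.elim0, fun i => i.elim0, fun i => i.elim0, by simp⟩

variable [LinearOrder R] [IsStrictOrderedRing R] [IsRealClosed R] [TopologicalSpace R]
  [OrderTopology R]

/-- A family of roots over a semi-algebraically connected set whose number is constant over the
algebraic closure is geometrically delineable. -/
theorem IsRootFamily.delineable
    (hroot : IsRootFamily (R := R) F κ (Φ (MvPolynomial.X (Fin.last n))) Q H)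
    (hθ : IsImmersionInto θ gθ) (hΦ : IsImmersionInto Φ g)
    (hcomm : Φ.comp (MvPolynomial.rename Fin.castSucc).toRingHom = F.comp θ)
    (hχ : ∀ r, (κ.comp θ) (MvPolynomial.C r) = algebraMap R D r)
    (hΦC : ∀ r, Φ (MvPolynomial.C r) = algebraMap R E r)
    {gχ : MvPolynomial (Fin n) R} (himm : IsImmersionInto (κ.comp θ) gχ) (hQ : Q.Monic)
    {S : Set (D →ₐ[R] R)} (hS : IsSemialgebraic (coords (κ.comp θ) '' S))
    (hconn : IsSemialgebraicallyConnected (coords (κ.comp θ) '' S)) {N : ℕ}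
    (hN : ∀ y ∈ S, (activeFactor (Q.map (y : D →+* R)) (H.map (y : D →+* R))).natDegree = N) :
    (∀ y₁ ∈ S, ∀ y₂ ∈ S,
      {u : E →ₐ[R] R | (u : E →+* R).comp F = (y₁ : D →+* R).comp κ}.encard =
      {u : E →ₐ[R] R | (u : E →+* R).comp F = (y₂ : D →+* R).comp κ}.encard) ∧
    (∃ (k : ℕ) (ξ : Fin k → S → (E →ₐ[R] R)),
      (∀ i, ∀ y : S, (ξ i y : E →+* R).comp F = (y.1 : D →+* R).comp κ) ∧
      (∀ y : S, ∀ u : E →ₐ[R] R, (u : E →+* R).comp F = (y.1 : D →+* R).comp κ →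
        ∃ i, u = ξ i y) ∧
      (∀ i, ∃ s : (Fin n → R) → Fin (n + 1) → R,
        ContinuousOn s (coords (κ.comp θ) '' S) ∧
        IsSemialgebraicOn s (coords (κ.comp θ) '' S) ∧
        ∀ y : S, coords Φ (ξ i y) = s (coords (κ.comp θ) y.1))) ∧
    IsGeometricallyDelineable (Set.range (PrimeSpectrum.comap Φ)) (coords (κ.comp θ) '' S) := by
  obtain ⟨k, ξ, hcont, hmono, hmem, hsemi⟩ := exists_activeRoot_sections hχ himm hS hconn hQ H hN
  have hcont' : ∀ i, ContinuousOn (fun a => Fin.snoc (α := fun _ => R) a (ξ i a))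
      (coords (κ.comp θ) '' S) := by
    intro i
    refine continuousOn_pi.mpr fun j => ?_
    refine Fin.lastCases ?_ (fun j => ?_) j
    · simpa using hcont i
    · simpa using (continuous_apply j).continuousOn
  have hpt : ∀ (i : Fin k) (y : S), ∃ u : E →ₐ[R] R,
      (u : E →+* R).comp F = (y.1 : D →+* R).comp κ ∧
        u (Φ (MvPolynomial.X (Fin.last n))) = ξ i (coords (κ.comp θ) y.1) := fun i y =>
    (hroot.exists_algHom_iff hθ hcomm hχ hΦC y.1 _).mpr ((hmem y.1 y.2 _).mpr ⟨i, rfl⟩)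
  choose pt hpt hptx using hpt
  have hcover : ∀ y : S, ∀ u : E →ₐ[R] R, (u : E →+* R).comp F = (y.1 : D →+* R).comp κ →
      ∃ i, u = pt i y := by
    intro y u hu
    obtain ⟨i, hi⟩ := (hmem y.1 y.2 _).mp
      ((hroot.exists_algHom_iff hθ hcomm hχ hΦC y.1 _).mp ⟨u, hu, rfl⟩)
    exact ⟨i, algHom_eq_of_comp_eq hθ hΦ hcomm (hu.trans (hpt i y).symm)
      (hi.trans (hptx i y).symm)⟩
  have hcard : ∀ y ∈ S,
      {u : E →ₐ[R] R | (u : E →+* R).comp F = (y : D →+* R).comp κ}.encard = k := by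
    intro y hy
    have h1 : {u : E →ₐ[R] R | (u : E →+* R).comp F = (y : D →+* R).comp κ} =
        Set.range fun i => pt i ⟨y, hy⟩ := by
      ext u
      constructor
      · intro hu
        obtain ⟨i, rfl⟩ := hcover ⟨y, hy⟩ u hu
        exact ⟨i, rfl⟩
      · rintro ⟨i, rfl⟩
        exact hpt i ⟨y, hy⟩
    have h2 : Function.Injective fun i => pt i ⟨y, hy⟩ := by
      intro i j hij
      refine (hmono _ (Set.mem_image_of_mem _ hy)).injective ?_
      have h3 := hptx i ⟨y, hy⟩
      rw [show pt i ⟨y, hy⟩ = pt j ⟨y, hy⟩ from hij, hptx j ⟨y, hy⟩] at h3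
      exact h3.symm
    rw [h1, ← Set.image_univ, h2.encard_image, Set.encard_univ, ENat.card_eq_coe_fintype_card,
      Fintype.card_fin]
  refine ⟨fun y₁ h₁ y₂ h₂ => (hcard y₁ h₁).trans (hcard y₂ h₂).symm,
    ⟨k, pt, hpt, hcover, fun i => ⟨_, hcont' i, hsemi i, fun y => ?_⟩⟩, ?_⟩
  · rw [coords_eq_snoc_of_comp_eq hcomm (hpt i y), hptx]
  obtain ⟨F₀, hF₀⟩ := IsNoetherian.noetherian (RingHom.ker Φ)
  refine ⟨F₀, g, hΦ.range_comap hF₀, ⟨N, ?_⟩, k,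
    fun i a => Fin.snoc (α := fun _ => R) a (ξ i a), fun i => ⟨hcont' i, hsemi i⟩, ?_, ?_, ?_⟩
  · rintro _ ⟨y, hy, rfl⟩
    rw [hroot.encard_complexSolutions hθ hΦ hcomm hχ hQ hF₀, hN y hy]
  · rintro i _ ⟨y, hy, rfl⟩
    exact ⟨(hroot.snoc_mem_realLocus_iff hθ hΦ hcomm hχ hF₀ y _).mpr
      ((hmem y hy _).mpr ⟨i, rfl⟩), Fin.init_snoc _ _⟩
  · intro i j hij a ha
    simpa using hmono a ha hij
  · intro t ht hinit
    obtain ⟨y, hy, hya⟩ := hinit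
    have hts : t = Fin.snoc (α := fun _ => R) (coords (κ.comp θ) y) (t (Fin.last n)) := by
      rw [hya, Fin.snoc_init_self]
    rw [hts, hroot.snoc_mem_realLocus_iff hθ hΦ hcomm hχ hF₀] at ht
    obtain ⟨i, hi⟩ := (hmem y hy _).mp ht
    refine ⟨i, ?_, fun j hj => ?_⟩
    · change t = Fin.snoc (α := fun _ => R) (Fin.init t) (ξ i (Fin.init t))
      rw [← hya, ← hi]
      exact hts
    · refine (hmono _ (Set.mem_image_of_mem _ hy)).injective ?_
      have h1 : t (Fin.last n) = Fin.snoc (α := fun _ => R) (Fin.init t) (ξ j (Fin.init t))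
        (Fin.last n) := congrFun hj (Fin.last n)
      rw [Fin.snoc_last, ← hya, hi] at h1
      exact h1.symm

end RootFamily

end GeomCAD

namespace GeomCAD

open Polynomial

/-! ### Geometric fibres over rational points -/

section RationalPoints

variable {R D : Type*} [Field R] [CommRing D] [Algebra R D]

/-- The residue field at a rational point is the base field. -/
theorem exists_algebraMap_algebraicClosure_eq_comp {V : Type*} [CommRing V] {α : V →+* D}
    {ι : R →+* V} (hι : ∀ r, α (ι r) = algebraMap R D r) (y : D →ₐ[R] R) :
    ∃ τ : R →+* AlgebraicClosure (PrimeSpectrum.comap α (ratPoint y)).asIdeal.ResidueField,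
      algebraMap V _ = (τ.comp (y : D →+* R)).comp α := by
  refine ⟨(algebraMap V _).comp ι, RingHom.ext fun a => ?_⟩
  rw [← sub_eq_zero]
  simp only [RingHom.comp_apply, RingHom.coe_coe]
  rw [← map_sub, IsScalarTower.algebraMap_apply V
    (PrimeSpectrum.comap α (ratPoint y)).asIdeal.ResidueField]
  have h1 : a - ι (y (α a)) ∈ (PrimeSpectrum.comap α (ratPoint y)).asIdeal := by
    change y (α (a - ι (y (α a)))) = 0
    rw [map_sub, hι, map_sub, AlgHom.commutes, sub_eq_zero]
    rfl
  rw [Ideal.algebraMap_residueField_eq_zero.mpr h1, map_zero]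

variable {V U : Type*} [CommRing V] [CommRing U] {f : V →+* U} {v : V} {h x : U}

theorem card_geometricFiber_away [CharZero R] (hfree : IsFreeHom (Localization.awayMap f v))
    (hfin : (Localization.awayMap f v).Finite) (hgen : IsFractionGenerated f x) {H : V[X]}
    (hH : H.eval₂ f x = h) {α : V →+* D} {β : Localization.Away v →+* D}
    (hβ : β.comp (algebraMap V _) = α) {ι : R →+* V}
    (hι : ∀ r, α (ι r) = algebraMap R D r) (y : D →ₐ[R] R) :
    ENat.card (GeometricFiber ((algebraMap U (Localization.Away h)).comp f)
      (PrimeSpectrum.comap α (ratPoint y))) =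
    (activeFactor (((fiberPolynomial (Localization.awayMap f v) hfree hfin
      (algebraMap U _ x)).map β).map (y : D →+* R)) ((H.map α).map (y : D →+* R))).natDegree := by
  obtain ⟨τ, hτ⟩ := exists_algebraMap_algebraicClosure_eq_comp hι y
  have hσ : ((τ.comp (y : D →+* R)).comp β).comp (algebraMap V (Localization.Away v)) =
      algebraMap V (AlgebraicClosure
        (PrimeSpectrum.comap α (ratPoint y)).asIdeal.ResidueField) := by
    rw [RingHom.comp_assoc, hβ, hτ]
  have hP := ((fiberPolynomial_monic (Localization.awayMap f v) hfree hfin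
    (algebraMap U _ x)).map β).map (y : D →+* R)
  refine (card_primeSpectrum_away_tensorProduct hfree hfin hgen hH _ hσ).trans ?_
  rw [← encard_setOf_eval₂_eq_zero_and_ne_zero hP.ne_zero ((H.map α).map (y : D →+* R)) τ, hτ]
  congr 1
  ext c
  simp only [eval₂_map, Set.mem_ofPred_eq]

end RationalPoints

/-! ### The maps of the two-layer setting -/

section TwoLayer

theorem awayMap_comp_algebraMap {V U : Type*} [CommRing V] [CommRing U] (f : V →+* U) (v : V) :
    (Localization.awayMap f v).comp (algebraMap V (Localization.Away v)) =
      (algebraMap U (Localization.Away (f v))).comp f := by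
  rw [Localization.awayMap, IsLocalization.Away.map, IsLocalization.map_comp]

variable {A B : Type*} [CommRing A] [CommRing B] {π : A →+* B} {w : A}
  {J : Ideal (RingXW π w)}

/-- `V ⟶ Y`. -/
noncomputable def mapVY (h' : RingXW π w ⧸ J) : A →+* RingV h' :=
  (Ideal.Quotient.mk (RingHom.ker (mapUW h'))).comp (algebraMap A (RingW w))

theorem mapUV_comp_mk (h' : RingXW π w ⧸ J) :
    (mapUV h').comp (Ideal.Quotient.mk (RingHom.ker (mapUW h'))) = mapUW h' :=
  RingHom.ext fun a => RingHom.kerLift_mk (mapUW h') a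

theorem mapUV_comp_mapVY (h' : RingXW π w ⧸ J) :
    (mapUV h').comp (mapVY h') = (mapUX h').comp π := by
  rw [mapVY, ← RingHom.comp_assoc, mapUV_comp_mk, mapUW, mapUX, RingHom.comp_assoc,
    RingHom.comp_assoc, mapXW, awayMap_comp_algebraMap]
  rfl

/-- The last coordinate generates `U` over `V`, in the sense of fractions. -/
theorem isFractionGenerated_mapUV {x : B} (hx : IsFractionGenerated π x) (h' : RingXW π w ⧸ J) :
    IsFractionGenerated (mapUV h') (mapUX h' x) := by
  have h1 := ((hx.comp_away (E := RingXW π w) (π w)).comp_surjective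
    (Ideal.Quotient.mk_surjective (I := J))).comp_away (E := RingU h') h'
  have h2 : (mapUV h').comp (mapVY h') = (algebraMap (RingXW π w ⧸ J) (RingU h')).comp
      ((Ideal.Quotient.mk J).comp ((algebraMap B (RingXW π w)).comp π)) := by
    rw [mapUV_comp_mapVY]
    rfl
  rw [← h2] at h1
  exact h1.of_comp

/-- `V_v ⟶ W`. -/
noncomputable def mapVvW {h' : RingXW π w ⧸ J} (v : RingV h') : RingW w →+* RingVv v :=
  (algebraMap (RingV h') (RingVv v)).comp (Ideal.Quotient.mk (RingHom.ker (mapUW h')))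

/-- The polynomial of a coordinate function over `W` still annihilates it over `V_v`. -/
theorem eval₂_map_fiberPolynomial_eq_zero {h' : RingXW π w ⧸ J} (v : RingV h')
    (hfree : IsFreeHom (mapXW π w)) (hfin : (mapXW π w).Finite) (x : B) :
    ((fiberPolynomial (mapXW π w) hfree hfin (algebraMap B _ x)).map (mapVvW v)).eval₂
      (mapUvVv v) (algebraMap (RingU h') (RingUv v) (mapUX h' x)) = 0 := by
  have h1 : (mapUvVv v).comp (mapVvW v) =
      ((algebraMap (RingU h') (RingUv v)).comp ((algebraMap (RingXW π w ⧸ J) (RingU h')).comp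
        (Ideal.Quotient.mk J))).comp (mapXW π w) := by
    rw [mapVvW, ← RingHom.comp_assoc, mapUvVv, awayMap_comp_algebraMap, RingHom.comp_assoc,
      mapUV_comp_mk]
    rfl
  have h2 : algebraMap (RingU h') (RingUv v) (mapUX h' x) =
      ((algebraMap (RingU h') (RingUv v)).comp ((algebraMap (RingXW π w ⧸ J) (RingU h')).comp
        (Ideal.Quotient.mk J))) (algebraMap B (RingXW π w) x) := by
    simp only [RingHom.comp_apply, mapUX]
  rw [eval₂_map, h1, h2, ← hom_eval₂, eval₂_fiberPolynomial_self, map_zero]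

theorem isFractionGenerated_mapUvVv {x : B} (hx : IsFractionGenerated π x) {h' : RingXW π w ⧸ J}
    (v : RingV h') :
    IsFractionGenerated (mapUvVv v) (algebraMap (RingU h') (RingUv v) (mapUX h' x)) := by
  refine IsFractionGenerated.of_comp (g := algebraMap (RingV h') _) ?_
  rw [mapUvVv, awayMap_comp_algebraMap]
  exact (isFractionGenerated_mapUV hx h').comp_away (mapUV h' v)

/-- `U_v` is not only free but finite over `V_v`: the last coordinate is integral, since it is so
over `W`, and hence generates a finite-dimensional fibre. -/
theorem finite_mapUvVv {x : B} (hx : IsFractionGenerated π x) {h' : RingXW π w ⧸ J} {v : RingV h'}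
    (hfree : IsFreeHom (mapXW π w)) (hfin : (mapXW π w).Finite) (hv : IsFreeHom (mapUvVv v))
    {K : Type*} [Field K] (σ : RingVv v →+* K) : (mapUvVv v).Finite :=
  (isFractionGenerated_mapUvVv hx v).finite_of_isFreeHom hv
    ⟨_, (fiberPolynomial_monic _ hfree hfin _).map _,
      eval₂_map_fiberPolynomial_eq_zero v hfree hfin x⟩ σ

/-- The roots of the fibre polynomial of `U_v` are roots of that of `X_W`. -/
theorem eval₂_fiberPolynomial_eq_zero_of_mapUvVv {x : B} (hx : IsFractionGenerated π x)
    {h' : RingXW π w ⧸ J} {v : RingV h'} (hfree : IsFreeHom (mapXW π w)) (hfin : (mapXW π w).Finite)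
    (hv : IsFreeHom (mapUvVv v)) (hvfin : (mapUvVv v).Finite) {K : Type*} [Field K]
    (σ : RingVv v →+* K) (c : K)
    (hc : (fiberPolynomial (mapUvVv v) hv hvfin
      (algebraMap (RingU h') (RingUv v) (mapUX h' x))).eval₂ σ c = 0) :
    ((fiberPolynomial (mapXW π w) hfree hfin (algebraMap B _ x)).map (mapVvW v)).eval₂ σ c = 0 := by
  obtain ⟨γ, hγ, rfl⟩ :=
    (eval₂_fiberPolynomial_eq_zero_iff hv hvfin (isFractionGenerated_mapUvVv hx v) σ c).mp hc
  rw [← hγ, ← hom_eval₂, eval₂_map_fiberPolynomial_eq_zero, map_zero]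

/-- The function `h` as a polynomial in the coordinate, over `V`. -/
theorem eval₂_map_mapVY {x h : B} {H : A[X]} (hH : H.eval₂ π x = h) (h' : RingXW π w ⧸ J) :
    (H.map (mapVY h')).eval₂ (mapUV h') (mapUX h' x) = mapUX h' h := by
  rw [eval₂_map, mapUV_comp_mapVY, ← hom_eval₂, hH]

theorem map_mapVvY (H : A[X]) {h' : RingXW π w ⧸ J} (v : RingV h') :
    H.map (mapVvY v) = (H.map (mapVY h')).map (algebraMap (RingV h') (RingVv v)) :=
  (Polynomial.map_map _ _ _).symm

theorem isRootFamily_mapUhV {R : Type*} [Field R] [Algebra R A] {x h : B}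
    (hx : IsFractionGenerated π x) {h' : RingXW π w ⧸ J} {v : RingV h'}
    (hv : IsFreeHom (mapUvVv v)) (hvfin : (mapUvVv v).Finite) {H : A[X]}
    (hH : H.eval₂ π x = h) :
    IsRootFamily (R := R) (mapUhV h' h) (algebraMap (RingV h') (RingVv v)) (mapUhX h' h x)
      (fiberPolynomial (mapUvVv v) hv hvfin (algebraMap (RingU h') (RingUv v) (mapUX h' x)))
      (H.map (mapVvY v)) := by
  intro K _ τ y c
  rw [map_mapVvY, Polynomial.eval₂_map (algebraMap (RingV h') (RingVv v))]
  exact exists_ringHom_away_iff_eval₂ hv hvfin (isFractionGenerated_mapUV hx h')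
    (eval₂_map_mapVY hH h') (τ.comp (y : RingVv v →+* R)) c

theorem cardFiberUh_eq {R : Type*} [Field R] [CharZero R] [Algebra R A] {x h : B}
    (hx : IsFractionGenerated π x) {h' : RingXW π w ⧸ J} {v : RingV h'}
    (hv : IsFreeHom (mapUvVv v)) (hvfin : (mapUvVv v).Finite) {H : A[X]}
    (hH : H.eval₂ π x = h) (y : RingVv v →ₐ[R] R) :
    cardFiberUh h y = (activeFactor ((fiberPolynomial (mapUvVv v) hv hvfin
      (algebraMap (RingU h') (RingUv v) (mapUX h' x))).map (y : RingVv v →+* R))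
      ((H.map (mapVvY v)).map (y : RingVv v →+* R))).natDegree := by
  have h1 := card_geometricFiber_away hv hvfin (isFractionGenerated_mapUV hx h')
    (eval₂_map_mapVY hH h') (RingHom.id_comp (algebraMap (RingV h') (RingVv v)))
    (ι := algebraMap R (RingV h')) (fun r => rfl) y
  rw [Polynomial.map_id] at h1
  rw [map_mapVvY]
  exact h1

theorem cardFiberDh_eq {R : Type*} [Field R] [CharZero R] [Algebra R A] {x h : B}
    (hx : IsFractionGenerated π x) {h' : RingXW π w ⧸ J} {v : RingV h'}
    (hfree : IsFreeHom (mapXW π w)) (hfin : (mapXW π w).Finite) {H : A[X]}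
    (hH : H.eval₂ π x = h) (y : RingVv v →ₐ[R] R) :
    cardFiberDh (π := π) h y = (activeFactor (((fiberPolynomial (mapXW π w) hfree hfin
      (algebraMap B _ x)).map (mapVvW v)).map (y : RingVv v →+* R))
      ((H.map (mapVvY v)).map (y : RingVv v →+* R))).natDegree :=
  card_geometricFiber_away (β := mapVvW v) (α := mapVvY v) hfree hfin hx hH rfl
    (ι := algebraMap R A) (fun _ => rfl) y

variable {R : Type*} [Field R] {n : ℕ}

theorem exists_isImmersionInto_mapVY [Algebra R A] {iY : MvPolynomial (Fin n) R →ₐ[R] A}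
    (hY : Function.Surjective iY) (h' : RingXW π w ⧸ J) :
    ∃ g, IsImmersionInto ((mapVY h').comp iY.toRingHom) g := by
  obtain ⟨g, hg⟩ := (isImmersionInto_of_surjective (φ := iY.toRingHom) hY).comp
    (isImmersionInto_away (E' := RingW w) w)
  exact hg.comp (isImmersionInto_of_surjective
    (Ideal.Quotient.mk_surjective (I := RingHom.ker (mapUW h'))))

theorem exists_isImmersionInto_mapUhAffine [Algebra R B]
    {iX : MvPolynomial (Fin (n + 1)) R →ₐ[R] B} (hX : Function.Surjective iX)
    (h' : RingXW π w ⧸ J) (h : B) : ∃ g, IsImmersionInto (mapUhAffine iX h' h) g := by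
  obtain ⟨g₁, hg₁⟩ := (isImmersionInto_of_surjective (φ := iX.toRingHom) hX).comp
    (isImmersionInto_away (E' := RingXW π w) (π w))
  obtain ⟨g₂, hg₂⟩ := hg₁.comp (isImmersionInto_of_surjective
    (Ideal.Quotient.mk_surjective (I := J)))
  obtain ⟨g₃, hg₃⟩ := hg₂.comp (isImmersionInto_away (E' := RingU h') h')
  exact hg₃.comp (isImmersionInto_away (E' := RingUh h' h) (mapUX h' h))

/-- The embedding of `V_v` in affine space is compatible with the structure morphisms to
`Spec R`. -/
theorem mapVvY_comp_C [Algebra R A] (iY : MvPolynomial (Fin n) R →ₐ[R] A) {h' : RingXW π w ⧸ J}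
    (v : RingV h') (r : R) :
    (algebraMap (RingV h') (RingVv v)).comp ((mapVY h').comp iY.toRingHom) (MvPolynomial.C r) =
      algebraMap R (RingVv v) r :=
  congrArg (mapVvY v) (iY.commutes r)

theorem mapUhAffine_C [Algebra R B] (iX : MvPolynomial (Fin (n + 1)) R →ₐ[R] B)
    (h' : RingXW π w ⧸ J) (h : B) (r : R) :
    mapUhAffine iX h' h (MvPolynomial.C r) = algebraMap R (RingUh h' h) r :=
  congrArg (mapUhX h' h) (iX.commutes r)

end TwoLayer

section Projection

variable {R A B : Type*} [Field R] [CommRing A] [CommRing B] [Algebra R A] [Algebra R B] {n : ℕ}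
  {π : A →ₐ[R] B} {iX : MvPolynomial (Fin (n + 1)) R →ₐ[R] B}
  {iY : MvPolynomial (Fin n) R →ₐ[R] A}

theorem IsProjectionOfRelDimOne.eval₂_polynomialInLast (hπ : IsProjectionOfRelDimOne π iX iY)
    (p : MvPolynomial (Fin (n + 1)) R) :
    (polynomialInLast iY.toRingHom p).eval₂ (π : A →+* B) (iX (MvPolynomial.X (Fin.last n))) =
      iX p := by
  rw [GeomCAD.eval₂_polynomialInLast]
  have h1 : (π : A →+* B).comp iY.toRingHom =
      iX.toRingHom.comp (MvPolynomial.rename Fin.castSucc).toRingHom :=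
    RingHom.ext fun f => (AlgHom.congr_fun hπ.comm f).symm
  rw [h1]
  exact RingHom.congr_fun (snocHom_eq iX.toRingHom) p

theorem IsProjectionOfRelDimOne.isFractionGenerated (hπ : IsProjectionOfRelDimOne π iX iY) :
    IsFractionGenerated (π : A →+* B) (iX (MvPolynomial.X (Fin.last n))) := by
  intro e
  obtain ⟨p, rfl⟩ := hπ.closedImmersion_X e
  exact ⟨polynomialInLast iY.toRingHom p, 1, by simp, by
    rw [hπ.eval₂_polynomialInLast, eval₂_one, one_mul]⟩

theorem IsProjectionOfRelDimOne.mapUhAffine_comp_rename (hπ : IsProjectionOfRelDimOne π iX iY)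
    {w : A} {J : Ideal (RingXW (π : A →+* B) w)} (h' : RingXW (π : A →+* B) w ⧸ J) (h : B) :
    (mapUhAffine iX h' h).comp (MvPolynomial.rename Fin.castSucc).toRingHom =
      (mapUhV h' h).comp ((mapVY h').comp iY.toRingHom) := by
  rw [mapUhV, RingHom.comp_assoc, ← RingHom.comp_assoc _ (mapVY h'), mapUV_comp_mapVY]
  exact RingHom.ext fun f => congrArg (mapUhX h' h) (AlgHom.congr_fun hπ.comm f)

end Projection

end GeomCAD

set_option maxHeartbeats 1000000 in
theorem mainTheorem5
    {R : Type*} [Field R] [LinearOrder R] [IsStrictOrderedRing R] [IsRealClosed R]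
    [TopologicalSpace R] [OrderTopology R]
    {A B : Type*} [CommRing A] [IsDomain A] [CommRing B] [Algebra R A] [Algebra R B]
    {n : ℕ} (π : A →ₐ[R] B)
    (iX : MvPolynomial (Fin (n + 1)) R →ₐ[R] B) (iY : MvPolynomial (Fin n) R →ₐ[R] A)
    (hπ : GeomCAD.IsProjectionOfRelDimOne π iX iY)
    (hgen : GeomCAD.IsGenericallyFinite (π : A →+* B))
    (w : A)
    (hw_finite : (GeomCAD.mapXW (π : A →+* B) w).Finite)
    (hw_free : GeomCAD.IsFreeHom (GeomCAD.mapXW (π : A →+* B) w))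
    (J : Ideal (GeomCAD.RingXW (π : A →+* B) w))
    (h' : GeomCAD.RingXW (π : A →+* B) w ⧸ J)
    (hV : IsDomain (GeomCAD.RingV h'))
    (v : GeomCAD.RingV h')
    (hv_free : GeomCAD.IsFreeHom (GeomCAD.mapUvVv v))
    (h : B)
    (S : Set (GeomCAD.RingVv v →ₐ[R] R))
    (hS : GeomCAD.IsSemialgebraic (GeomCAD.coordsVv iY '' S))
    (hS_conn : GeomCAD.IsSemialgebraicallyConnected (GeomCAD.coordsVv iY '' S))
    (hDh : ∀ y₁ ∈ S, ∀ y₂ ∈ S, GeomCAD.cardFiberDh h y₁ = GeomCAD.cardFiberDh h y₂) :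
    -- the geometric fiber cardinality of `U_h` is invariant over `S`
    (∀ y₁ ∈ S, ∀ y₂ ∈ S, GeomCAD.cardFiberUh h y₁ = GeomCAD.cardFiberUh h y₂) ∧
    -- the real fiber cardinality of `U_h` is invariant over `S`
    (∀ y₁ ∈ S, ∀ y₂ ∈ S, (GeomCAD.realFiberUh h y₁).encard = (GeomCAD.realFiberUh h y₂).encard) ∧
    -- continuous semi-algebraic sections `S → U_h(R)` cover the preimage of `S`
    (∃ (k : ℕ) (ξ : Fin k → S → (GeomCAD.RingUh h' h →ₐ[R] R)),
      (∀ i, ∀ y : S, ξ i y ∈ GeomCAD.realFiberUh h y.1) ∧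
      (∀ y : S, ∀ u ∈ GeomCAD.realFiberUh h y.1, ∃ i, u = ξ i y) ∧
      (∀ i, ∃ g : (Fin n → R) → Fin (n + 1) → R,
        ContinuousOn g (GeomCAD.coordsVv iY '' S) ∧
        GeomCAD.IsSemialgebraicOn g (GeomCAD.coordsVv iY '' S) ∧
        ∀ y : S, GeomCAD.coordsUh iX (ξ i y) = g (GeomCAD.coordsVv iY y.1))) ∧
    -- `U_h`, as a subset of affine `(n + 1)`-space, is geometrically delineable over `S`
    GeomCAD.IsGeometricallyDelineable
      (Set.range (PrimeSpectrum.comap (GeomCAD.mapUhAffine iX h' h)))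
      (GeomCAD.coordsVv iY '' S) := by
  obtain ⟨gθ, hθ⟩ := GeomCAD.exists_isImmersionInto_mapVY hπ.closedImmersion_Y h'
  obtain ⟨g, hΦ⟩ := GeomCAD.exists_isImmersionInto_mapUhAffine hπ.closedImmersion_X h' h
  -- the finiteness of `U_v ⟶ V_v` is obtained from a finite fibre, over a point of `S`
  rcases S.eq_empty_or_nonempty with rfl | ⟨y₀, hy₀⟩
  · refine ⟨by simp, by simp, ⟨0, fun i => i.elim0, fun i => i.elim0, fun y => y.2.elim,
      fun i => i.elim0⟩, ?_⟩
    rw [Set.image_empty]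
    exact GeomCAD.isGeometricallyDelineable_empty hΦ
  obtain ⟨gχ, himm⟩ := hθ.comp (GeomCAD.isImmersionInto_away (E' := GeomCAD.RingVv v) v)
  have hx := hπ.isFractionGenerated
  have hfin := GeomCAD.finite_mapUvVv hx hw_free hw_finite hv_free (y₀ : GeomCAD.RingVv v →+* R)
  -- the function `h` as a polynomial in the last coordinate
  obtain ⟨p, hp⟩ := hπ.closedImmersion_X h
  have hH := (hπ.eval₂_polynomialInLast p).trans hp
  have hQ := GeomCAD.fiberPolynomial_monic _ hv_free hfin
    (algebraMap (GeomCAD.RingU h') (GeomCAD.RingUv v)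
      (GeomCAD.mapUX h' (iX (MvPolynomial.X (Fin.last n)))))
  have hχ := GeomCAD.mapVvY_comp_C iY v
  have hdeg := fun y₁ (h₁ : y₁ ∈ S) y₂ (h₂ : y₂ ∈ S) =>
    GeomCAD.natDegree_activeFactor_eq_of_connected hχ himm hS hS_conn
      ((GeomCAD.fiberPolynomial_monic _ hw_free hw_finite
        (algebraMap B _ (iX (MvPolynomial.X (Fin.last n))))).map (GeomCAD.mapVvW v)) hQ
      ((GeomCAD.polynomialInLast iY.toRingHom p).map (GeomCAD.mapVvY v))
      (fun y _ c hc => by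
        rw [Polynomial.eval₂_map] at hc ⊢
        exact GeomCAD.eval₂_fiberPolynomial_eq_zero_of_mapUvVv hx hw_free hw_finite hv_free hfin
          _ c hc)
      (fun z₁ hz₁ z₂ hz₂ => by
        have h1 := hDh z₁ hz₁ z₂ hz₂
        rw [GeomCAD.cardFiberDh_eq hx hw_free hw_finite hH,
          GeomCAD.cardFiberDh_eq hx hw_free hw_finite hH] at h1
        exact_mod_cast h1) h₁ h₂
  refine ⟨fun y₁ h₁ y₂ h₂ => ?_, (GeomCAD.isRootFamily_mapUhV hx hv_free hfin hH).delineable hθ hΦ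
    (hπ.mapUhAffine_comp_rename h' h) hχ (GeomCAD.mapUhAffine_C iX h' h) himm hQ hS hS_conn
    fun y hy => hdeg y hy y₀ hy₀⟩
  rw [GeomCAD.cardFiberUh_eq hx hv_free hfin hH, GeomCAD.cardFiberUh_eq hx hv_free hfin hH,
    hdeg y₁ h₁ y₂ h₂]
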